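/- Let $r\ge 2$. All orbifold curves $C$ have coarse curve $|C|\cong\mathbb{CP}^1$ with finitely many distinct marked points, isotropy group $\mathbb{Z}/r$ at each marked point and trivial isotropy elsewhere; $\rho:C\to|C|$ is the coarsening map. The multiplicity $\mathrm{mult}_p(S)\in\{0,\dots,r-1\}$ of an orbifold line bundle $S$ at a marked point $p$ is the $m$ such that $S$ is locally $[\mathbb{C}^2/(\mathbb{Z}/r)]$ with action $\zeta\cdot(t,v)=(\zeta t,\zeta^m v)$. A twisted $r$-spin structure is an orbifold line bundle $S$ with an isomorphism $\tau:S^{\otimes r}\cong\rho^*\big(\omega_{|C|,\log}(-\sum_{p\in I_0}r[p])\big)$, where $I_0$ is a set of marked points of multiplicity $0$, and at most one marked point (for a sphere), respectively none (for a disk), has multiplicity $0$ and is not in $I_0$. The twist at $p$ is $\mathrm{mult}_p(S)-1$ if $p\notin I_0$ and $r-1$ if $p\in I_0$; thus $|S|^{\otimes r}\cong\omega_{|C|}(-\sum_p \mathrm{twist}(p)[p])$ for $|S|=\rho_*S$. Isomorphisms of structures on a fixed $C$ are isomorphisms of orbifold line bundles over $\mathrm{id}_C$ commuting with $\tau$.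 (1) Let $(C;z_1,\dots,z_l)$ be a marked sphere and $a_1,\dots,a_l\in\{-1,0,\dots,r-1\}$, at most one of them equal to $-1$, with $\frac{\sum a_i-(r-2)}{r}\in\mathbb{Z}$. Then there is a twisted $r$-spin structure $S$ on $C$ with twists $a_1,\dots,a_l$, unique up to isomorphism, and its automorphisms are exactly the fibrewise scalings by $r$th roots of unity. For any $z_i$ that may be an anchor (it is the only marked point labeled $0$, and it is the point of twist $-1$ if there is one), a graded structure on $(C,S)$ with anchor $z_i$ exists and is unique up to isomorphism, and it has no nontrivial automorphisms if $a_i=r-1$. Here, if $a_i\ne r-1$ a graded structure has no data beyond the anchor; if $a_i=r-1$ it consists of an antilinear involution $\widetilde\phi$ of the line $F=(|S|\otimes\mathcal{O}([z_i]))_{z_i}$ and a connected component $V$ of $F^{\widetilde\phi}\setminus\{0\}$ such that, for the map $\tau':F^{\otimes r}\to\mathbb{C}$ given by $\tau$ and the residue at $z_i$, one has $\tau'(\widetilde\phi(v)^{\otimes r})=-\overline{\tau'(v^{\otimes r})}$ for all $v\in F$, $\{\tau'(v^{\otimes r}):v\in F^{\widetilde\phi}\}\supseteq i\mathbb{R}_+$,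 and $\tau'(v^{\otimes r})\in i\mathbb{R}_+$ for $v\in V$; isomorphisms preserve $\widetilde\phi$ and $V$. (2) Let $C$ be a connected marked disk: $\phi$ is an antiholomorphic involution of $C$ with $|C|=\Sigma\cup\phi(\Sigma)$, $\Sigma\cap\phi(\Sigma)=\partial\Sigma=\mathrm{Fix}(|\phi|)$; the marked points are $z_1,\dots,z_l\in\Sigma\setminus\partial\Sigma$, their conjugates $\phi(z_i)$, and $x_1,\dots,x_k\in\partial\Sigma$. A twisted $r$-spin structure on the disk also carries an antiholomorphic involution $\widetilde\phi:S\to S$ lifting $\phi$ and compatible with $\tau$, preserved by isomorphisms. A lifting of $S$ is a continuous $\widetilde\phi$-invariant section $v$ of $|S|$ over $\partial\Sigma\setminus\{x_j\}$ with $v^{\otimes r}$ positive in $\omega_{|C|}$ on vectors in the direction of the orientation of $\partial\Sigma$; a lifting of $J$ is a continuous $\widetilde\phi$-invariant section $w$ of $|J|=|S|^\vee\otimes\omega_{|C|}$ over the same set with $\langle w,v\rangle$ positive for some lifting $v$ of $S$. Liftings are considered up to multiplication by continuous positive functions. The point $x_j$ is illegal for a lifting if some equivalent lifting extends continuously to $x_j$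 without vanishing; otherwise it is legal, and the lifting alternates at $x_j$. Let $a_i\in\{0,\dots,r-1\}$ and $b_j\in\{0,\dots,r-2\}$ with $\frac{2\sum a_i+\sum b_j-(r-2)}{r}\in\mathbb{Z}$. If $r$ is even, assume that all $b_j$ are even and let $D\subseteq[k]$ be any set with $\frac{2\sum a_i+\sum b_j+2}{r}\equiv|D|\pmod 2$; if $r$ is odd, let $D=\{j\in[k]: b_j \text{ odd}\}$. Then there is a twisted $r$-spin structure on $C$ with a lifting (of $S$, or equivalently of $J$) whose internal twists at $z_i$ and $\phi(z_i)$ are $a_i$, whose boundary twists are $b_j$, and for which $D$ is the set of legal boundary marked points; it is unique up to isomorphisms preserving the class of liftings, and it has no nontrivial automorphisms preserving that class. (3) In particular, if $a_i\in\{0,\dots,r-1\}$, all $b_j=r-2$, and $e=\frac{2\sum a_i+k(r-2)-(r-2)}{r}$ is an integer with $e\equiv k-1\pmod 2$, then there is a graded $r$-spin structure on the disk with internal twists $a_i$ (a twisted $r$-spin structure with boundary twists $r-2$ and a class of liftings of $J$ alternating at every $x_j$), unique up to isomorphism, and it has no nontrivial automorphisms. -/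

import Mathlib

open scoped Manifold ContDiff Topology TensorProduct

namespace RSpin

/-! ### Riemann surfaces of genus zero -/

section Surface

variable {X : Type*} [TopologicalSpace X] [ChartedSpace ℂ X]

/-- `X` is biholomorphic to the Riemann sphere `ℂ ∪ {∞}`: there is a homeomorphism `f` which is
holomorphic away from `f⁻¹(∞)` and whose reciprocal is holomorphic away from `f⁻¹(0)`. -/
def IsRiemannSphere (X : Type*) [TopologicalSpace X] [ChartedSpace ℂ X] : Prop :=
  ∃ f : X ≃ₜ OnePoint ℂ,
    (∀ x, f x ≠ OnePoint.infty →
      MDifferentiableAt 𝓘(ℂ, ℂ) 𝓘(ℂ, ℂ) (fun y => (f y).elim (0 : ℂ) (fun c => c)) x) ∧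
    (∀ x, f x ≠ ((0 : ℂ) : OnePoint ℂ) →
      MDifferentiableAt 𝓘(ℂ, ℂ) 𝓘(ℂ, ℂ) (fun y => (f y).elim (0 : ℂ) (fun c => c⁻¹)) x)

/-- The fibre at `x` of the holomorphic cotangent bundle `ω` of the Riemann surface `X`. -/
abbrev Cotangent (x : X) : Type := TangentSpace 𝓘(ℂ, ℂ) x →L[ℂ] ℂ

/-- The centred local coordinate `z` at `x` given by the preferred chart at `x`. -/
noncomputable def coord (x y : X) : ℂ := chartAt ℂ x y - chartAt ℂ x x

/-- The value at `y` (near `x`) of the differential `dz` of the local coordinate at `x`. -/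
noncomputable def dz (x y : X) : Cotangent y :=
  mfderiv 𝓘(ℂ, ℂ) 𝓘(ℂ, ℂ) (chartAt ℂ x) y

/-- `φ` is antiholomorphic. -/
def IsAntiholomorphic (φ : X → X) : Prop :=
  Continuous φ ∧ ∀ x, AnalyticAt ℂ
    (fun s => (starRingEnd ℂ) (chartAt ℂ (φ x) (φ ((chartAt ℂ x).symm s)))) (chartAt ℂ x x)

/-- The (real) differential of `φ` at `x`, as a map `T_x X → T_y X` where `y = φ x`. -/
noncomputable def tangentMapAt (φ : X → X) (x y : X) (u : TangentSpace 𝓘(ℂ, ℂ) x) :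
    TangentSpace 𝓘(ℂ, ℂ) y :=
  mfderiv 𝓘(ℝ, ℂ) 𝓘(ℝ, ℂ) φ x u

/-! ### Orbifold structure with isotropy `ℤ/r` at a set `M` of points

The orbifold `C` has coarse space `X`. Near `x` it is uniformized by
`t ↦ z⁻¹(t ^ n)`, where `z` is the local coordinate at `x` and `n` is the order of the isotropy
group at `x`, which acts on `t` by multiplication by `n`-th roots of unity. -/

open Classical in
/-- The order of the isotropy group at `x`. -/
noncomputable def isotropy (r : ℕ) (M : Set X) (x : X) : ℕ := if x ∈ M then r else 1

/-- The uniformizing orbifold chart at `x`, to be used for `t` near `0`. -/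
noncomputable def orbiChart (r : ℕ) (M : Set X) (x : X) (t : ℂ) : X :=
  (chartAt ℂ x).symm (chartAt ℂ x x + t ^ isotropy r M x)

end Surface

/-- A holomorphic orbifold line bundle on the orbifold with coarse space `X` and isotropy `ℤ/r`
exactly at the points of `M`, given by its fibres and by local trivializations in the
uniformizing charts. -/
structure OrbiLineBundle (X : Type*) [TopologicalSpace X] [ChartedSpace ℂ X]
    (r : ℕ) (M : Set X) where
  /-- the fibre at `x` (at the origin of the uniformizing chart, if `x` is an orbifold point) -/
  fiber : X → Type
  [addCommGroup : ∀ x, AddCommGroup (fiber x)]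
  [module : ∀ x, Module ℂ (fiber x)]
  /-- `triv x t y` is the local trivialization, over the uniformizing chart at `x`, of the fibre
  at the point `t` of this chart, where `y = orbiChart r M x t` is the image of `t`. Only the values
  with `t` near `0` and `y = orbiChart r M x t` matter. -/
  triv : ∀ (_x : X) (_t : ℂ) (y : X), fiber y ≃ₗ[ℂ] ℂ
  /-- the multiplicity at `x` -/
  mult : X → ℕ
  mult_lt : ∀ x, mult x < isotropy r M x
  /-- In the trivialization at `x`, an element `ζ` of the isotropy group acts by
  `(t, v) ↦ (ζ t, ζ ^ mult x * v)`. -/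
  equivariant : ∀ x, ∀ᶠ t in 𝓝[≠] (0 : ℂ), ∀ ζ : ℂ, ζ ^ isotropy r M x = 1 →
    ∀ v : fiber (orbiChart r M x t),
      triv x (ζ * t) (orbiChart r M x t) v = ζ ^ mult x * triv x t (orbiChart r M x t) v
  /-- The transition functions are holomorphic: near a point `y` with trivial isotropy in the
  uniformizing chart at `x`, the trivializations at `x` and at `y` differ by a holomorphic function
  (the point `orbiChart r M x t` of the chart at `y` has parameter its local coordinate at `y`). -/
  compatible : ∀ x, ∀ᶠ t₀ in 𝓝[≠] (0 : ℂ), AnalyticAt ℂ (fun t =>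
    triv (orbiChart r M x t₀) (coord (orbiChart r M x t₀) (orbiChart r M x t)) (orbiChart r M x t)
      ((triv x t (orbiChart r M x t)).symm 1)) t₀

attribute [instance] OrbiLineBundle.addCommGroup OrbiLineBundle.module

namespace OrbiLineBundle

variable {X : Type*} [TopologicalSpace X] [ChartedSpace ℂ X] {r : ℕ} {M : Set X}

/-- The local frame `e_x(t)` over the uniformizing chart at `x`. -/
noncomputable def frame (S : OrbiLineBundle X r M) (x : X) (t : ℂ) :
    S.fiber (orbiChart r M x t) :=
  (S.triv x t (orbiChart r M x t)).symm 1

/-- The `r`-th tensor power of a vector. -/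
noncomputable def tpow (S : OrbiLineBundle X r M) {x : X} (v : S.fiber x) : ⨂[ℂ]^r (S.fiber x) :=
  PiTensorProduct.tprod ℂ (fun _ : Fin r => v)

end OrbiLineBundle

/-! ### Twisted spin bundles -/

open Classical in
/-- The order of vanishing at `x`, with respect to the coordinate of the coarse curve, of a local
generator of `ω_log(-∑_{p ∈ I₀} r[p])`, seen as a meromorphic differential. Here `ω_log = ω(∑_{p ∈ M} [p])`
and `I₀ ⊆ M`. -/
noncomputable def logOrder {X : Type*} (r : ℕ) (M I₀ : Set X) (x : X) : ℤ :=
  if x ∈ I₀ then r - 1 else if x ∈ M then -1 else 0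

/-- An orbifold line bundle `S` with an isomorphism
`τ : S^{⊗ r} ≅ ρ^* (ω_log (-∑_{p ∈ I₀} r[p]))`, where `I₀` is a set of orbifold
points at which the multiplicity of `S` vanishes and `ρ` is the map to the coarse curve. -/
structure TwistedSpinBundle (X : Type*) [TopologicalSpace X] [ChartedSpace ℂ X]
    (r : ℕ) (M : Set X) extends OrbiLineBundle X r M where
  /-- the set `I₀` -/
  I₀ : Set X
  I₀_subset : I₀ ⊆ {p | p ∈ M ∧ mult p = 0}
  /-- The isomorphism `τ` on the complement of the orbifold points, where its target is `ω`. -/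
  τ : ∀ x, x ∉ M → ⨂[ℂ]^r (fiber x) →ₗ[ℂ] Cotangent x
  /-- `τ` is holomorphic, and it extends to an isomorphism over the orbifold points: it sends the `r`-th
  power of a local frame of `S` to a nowhere vanishing holomorphic multiple of a local frame of the
  target. -/
  τ_iso : ∀ x, ∃ g : ℂ → ℂ, AnalyticAt ℂ g 0 ∧ g 0 ≠ 0 ∧
    ∀ᶠ t in 𝓝 (0 : ℂ), ∀ h : orbiChart r M x t ∉ M,
      τ (orbiChart r M x t) h (toOrbiLineBundle.tpow (toOrbiLineBundle.frame x t)) =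
        (g t * (t ^ isotropy r M x) ^ logOrder r M I₀ x) • dz x (orbiChart r M x t)

namespace TwistedSpinBundle

variable {X : Type*} [TopologicalSpace X] [ChartedSpace ℂ X] {r : ℕ} {M : Set X}

open Classical in
/-- The twist at a marked point `p`: it is congruent to `mult p - 1` modulo `r`, and
`|S|^{⊗ r} ≅ ω(-∑ twist(p) [p])` for the coarse bundle `|S|`, whose local generator at `p` is
`t ^ mult p • e_p(t)`. -/
noncomputable def twist (S : TwistedSpinBundle X r M) (p : X) : ℤ :=
  (S.mult p : ℤ) - 1 + (if p ∈ S.I₀ then (r : ℤ) else 0)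

/-- An isomorphism of twisted spin bundles over the identity of the base orbifold: a holomorphic
isomorphism of orbifold line bundles commuting with the maps `τ`. -/
structure Iso (S S' : TwistedSpinBundle X r M) where
  toEquiv : ∀ x, S.fiber x ≃ₗ[ℂ] S'.fiber x
  holomorphic : ∀ x, AnalyticAt ℂ (fun t =>
    S'.triv x t (orbiChart r M x t) (toEquiv (orbiChart r M x t) (S.frame x t))) 0
  comm_τ : ∀ x (hx : x ∉ M) (v : S.fiber x), S'.τ x hx (S'.tpow (toEquiv x v)) = S.τ x hx (S.tpow v)

/-- The leading coefficient at `x` of `τ(e_x ^ r)` with respect to the local coordinate. -/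
noncomputable def leadCoeff (S : TwistedSpinBundle X r M) (x : X) : ℂ :=
  Classical.choose (S.τ_iso x) 0

/-- For a marked point `p` of twist `r - 1`, the fibre at `p` of `|S| ⊗ O([p])`. As
`mult p = 0`, the fibre of `|S|` at `p` is the fibre of `S`, and the fibre of `O([p])` is the
tangent space, the class of `1/z` being `∂/∂z`. -/
abbrev PoleFiber (S : TwistedSpinBundle X r M) (p : X) : Type :=
  S.fiber p ⊗[ℂ] TangentSpace 𝓘(ℂ, ℂ) p

/-- The coordinate on `PoleFiber` for which `e_p(0) ⊗ ∂/∂z` has coordinate `1`. -/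
noncomputable def poleCoord (S : TwistedSpinBundle X r M) (p : X) (v : S.PoleFiber p) : ℂ :=
  TensorProduct.lid ℂ ℂ
    (TensorProduct.map (S.triv p 0 p).toLinearMap (dz p p).toLinearMap v)

/-- For a marked point `p` of twist `r - 1`, the map `v ↦ τ'(v^{⊗ r})`: the residue at `p` of the
image of the `r`-th power of a local section of `|S| ⊗ O([p])` with value `v` at `p`. Indeed
`τ((e_p/z)^r) = g z^{r-1} dz / z^r` has residue `g(0)`. -/
noncomputable def residuePow (S : TwistedSpinBundle X r M) (p : X) (v : S.PoleFiber p) : ℂ :=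
  S.poleCoord p v ^ r * S.leadCoeff p

/-- The map on `PoleFiber` induced by an isomorphism. -/
noncomputable def Iso.poleMap {S S' : TwistedSpinBundle X r M} (f : Iso S S') (p : X) :
    S.PoleFiber p →ₗ[ℂ] S'.PoleFiber p :=
  TensorProduct.map (f.toEquiv p).toLinearMap LinearMap.id

end TwistedSpinBundle

/-! ### Markings -/

/-- The label set `{0} ∪ (2^ℕ ∖ {∅})`, with `ℕ = {1, 2, …}`; `none` is the label `0`. -/
abbrev Label : Type := Option {A : Set ℕ+ // A.Nonempty}

/-- A marking: distinct points not marked `0` have disjoint labels. -/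
def IsMarking {I : Type*} (m : I → Label) : Prop :=
  ∀ i j, i ≠ j → ∀ A B, m i = some A → m j = some B → Disjoint A.1 B.1

/-! ### The closed case -/

/-- A smooth marked sphere, with coarse curve `X` and marked points labeled by `I`. -/
structure MarkedSphere (X : Type*) [TopologicalSpace X] [ChartedSpace ℂ X] (I : Type*) where
  sphere : IsRiemannSphere X
  z : I → X
  z_injective : Function.Injective z
  mark : I → Label
  isMarking : IsMarking mark

/-- The set of orbifold points of a marked sphere. -/
def MarkedSphere.M {X : Type*} [TopologicalSpace X] [ChartedSpace ℂ X] {I : Type*}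
    (C : MarkedSphere X I) : Set X := Set.range C.z

/-- A closed twisted `r`-spin structure on a marked sphere. -/
structure SphereSpin {X : Type*} [TopologicalSpace X] [ChartedSpace ℂ X] {I : Type*}
    (C : MarkedSphere X I) (r : ℕ) extends TwistedSpinBundle X r C.M where
  /-- At most one marked point of multiplicity zero is not in `I₀`. -/
  atMostOne : ∀ p ∈ C.M, ∀ q ∈ C.M, mult p = 0 → mult q = 0 → p ∉ I₀ → q ∉ I₀ → p = q

namespace SphereSpin

variable {X : Type*} [TopologicalSpace X] [ChartedSpace ℂ X] {I : Type*} {C : MarkedSphere X I}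
  {r : ℕ}

/-- The twists of `S` are the integers `a i`. -/
def HasTwists (S : SphereSpin C r) (a : I → ℤ) : Prop := ∀ i, S.twist (C.z i) = a i

/-- An isomorphism of closed twisted `r`-spin structures on a marked sphere. -/
abbrev Iso (S S' : SphereSpin C r) : Type _ :=
  TwistedSpinBundle.Iso S.toTwistedSpinBundle S'.toTwistedSpinBundle

/-- The structure of a graded `r`-spin sphere on `(C, S)` with anchor `z i`. If the anchor has twist
`r - 1`, it consists of an involution of the fibre of `|S| ⊗ O([z i])` at `z i` and of a positive
direction; otherwise there are no further data. -/
structure Grading (S : SphereSpin C r) (i : I) where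
  mark_anchor : C.mark i = none
  mark_ne : ∀ j, j ≠ i → C.mark j ≠ none
  anchor_of_twist : ∀ j, S.twist (C.z j) = -1 → j = i
  /-- the antilinear involution -/
  inv : S.twist (C.z i) = r - 1 →
    (S.PoleFiber (C.z i) →ₛₗ[starRingEnd ℂ] S.PoleFiber (C.z i))
  inv_inv : ∀ h v, inv h (inv h v) = v
  residue_inv : ∀ h v, S.residuePow (C.z i) (inv h v) =
    -(starRingEnd ℂ) (S.residuePow (C.z i) v)
  residue_image : ∀ h (s : ℝ), 0 < s →
    ∃ v, inv h v = v ∧ S.residuePow (C.z i) v = s * Complex.I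
  /-- the positive direction -/
  pos : S.twist (C.z i) = r - 1 → Set (S.PoleFiber (C.z i))
  /-- It is a connected component of the invariant real line without the origin, that is, an open
  ray in it. -/
  pos_ray : ∀ h, ∃ v, v ≠ 0 ∧ inv h v = v ∧ pos h = {u | ∃ c : ℝ, 0 < c ∧ u = (c : ℂ) • v}
  residue_pos : ∀ h, ∀ v ∈ pos h, ∃ s : ℝ, 0 < s ∧ S.residuePow (C.z i) v = s * Complex.I

/-- The isomorphism `f` of twisted `r`-spin structures is an isomorphism from the graded structure
`G` to the graded structure `G'`. -/
def Grading.IsIso {S S' : SphereSpin C r} {i : I} (G : Grading S i) (G' : Grading S' i)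
    (f : Iso S S') : Prop :=
  ∀ (h : S.twist (C.z i) = r - 1) (h' : S'.twist (C.z i) = r - 1),
    (∀ v, f.poleMap (C.z i) (G.inv h v) = G'.inv h' (f.poleMap (C.z i) v)) ∧
    f.poleMap (C.z i) '' G.pos h = G'.pos h'

end SphereSpin

/-! ### Disks -/

/-- A smooth connected marked disk, with closed coarse curve `X` (the double of the disk `half`),
internal marked points labeled by `I` and boundary marked points labeled by `B`. -/
structure MarkedDisk (X : Type*) [TopologicalSpace X] [ChartedSpace ℂ X] (I B : Type*) where
  sphere : IsRiemannSphere X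
  /-- the conjugation -/
  φ : X → X
  φ_anti : IsAntiholomorphic φ
  φ_φ : ∀ x, φ (φ x) = x
  /-- the preferred half `Σ` -/
  half : Set X
  half_closed : IsClosed half
  half_union : half ∪ φ '' half = Set.univ
  half_inter : half ∩ φ '' half = {x | φ x = x}
  /-- the internal marked points -/
  z : I → X
  z_injective : Function.Injective z
  z_mem : ∀ i, z i ∈ half
  z_ne : ∀ i, φ (z i) ≠ z i
  /-- the boundary marked points -/
  x : B → X
  x_injective : Function.Injective x
  x_fix : ∀ j, φ (x j) = x j
  markI : I → Label
  markB : B → Label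
  isMarkingI : IsMarking markI
  isMarkingB : IsMarking markB
  /-- The marking of the internal marked points is strict. -/
  strictI : ∀ i, markI i ≠ none

namespace MarkedDisk

variable {X : Type*} [TopologicalSpace X] [ChartedSpace ℂ X] {I B : Type*}

/-- The set of orbifold points. -/
def M (C : MarkedDisk X I B) : Set X :=
  Set.range C.z ∪ Set.range (fun i => C.φ (C.z i)) ∪ Set.range C.x

/-- The boundary `∂Σ` without the boundary marked points. -/
def A (C : MarkedDisk X I B) : Set X := {p | C.φ p = p ∧ p ∉ C.M}

/-- `u` is a nonzero tangent vector of `∂Σ` at the boundary point `p`, in the direction of the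
orientation of `∂Σ` as the boundary of `Σ` (so that `i u` points into `Σ`). -/
def IsPosTangent (C : MarkedDisk X I B) (p : X) (u : TangentSpace 𝓘(ℂ, ℂ) p) : Prop :=
  u ≠ 0 ∧ tangentMapAt C.φ p p u = u ∧
    ∀ᶠ s : ℝ in 𝓝[>] 0,
      (chartAt ℂ p).symm (chartAt ℂ p p + (s : ℂ) * (Complex.I * (show ℂ from u))) ∈ C.half

/-- Positivity of a cotangent vector at a boundary point. -/
def IsPos (C : MarkedDisk X I B) (p : X) (ξ : Cotangent p) : Prop :=
  ∀ u, C.IsPosTangent p u → 0 < (ξ u).re ∧ (ξ u).im = 0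

end MarkedDisk

/-- A twisted `r`-spin structure on a marked disk. -/
structure DiskSpin {X : Type*} [TopologicalSpace X] [ChartedSpace ℂ X] {I B : Type*}
    (C : MarkedDisk X I B) (r : ℕ) extends TwistedSpinBundle X r C.M where
  I₀_eq : I₀ = {p | p ∈ C.M ∧ mult p = 0}
  /-- The involution lifting `φ`, on the fibres over points `x` with trivial isotropy, as a map from
  the fibre at `x` to the fibre at `y = φ x`. -/
  inv : ∀ x y, C.φ x = y → x ∉ C.M → (fiber x →ₛₗ[starRingEnd ℂ] fiber y)
  inv_inv : ∀ x y (h : C.φ x = y) (h' : C.φ y = x) (hx : x ∉ C.M) (hy : y ∉ C.M) (v : fiber x),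
    inv y x h' hy (inv x y h hx v) = v
  /-- The involution is antiholomorphic, and it extends over the orbifold points: if `ψ` is a lift
  of `φ` to the uniformizing charts at `x` and `φ x`, then the frame `e_x(t)` is sent to
  an antiholomorphic nonvanishing multiple of the frame `e_{φ x}(ψ t)`. -/
  inv_anti : ∀ x, ∃ ψ c : ℂ → ℂ,
    AnalyticAt ℂ (fun t => (starRingEnd ℂ) (ψ t)) 0 ∧ ψ 0 = 0 ∧
    (∀ᶠ t in 𝓝 (0 : ℂ), orbiChart r C.M (C.φ x) (ψ t) = C.φ (orbiChart r C.M x t)) ∧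
    AnalyticAt ℂ c 0 ∧ c 0 ≠ 0 ∧
    ∀ᶠ t in 𝓝 (0 : ℂ), ∀ h : orbiChart r C.M x t ∉ C.M,
      triv (C.φ x) (ψ t) (C.φ (orbiChart r C.M x t))
        (inv (orbiChart r C.M x t) _ rfl h (toOrbiLineBundle.frame x t)) = (starRingEnd ℂ) (c t)
  /-- The `r`-th power of the involution is the involution `ξ ↦ conj (φ^* ξ)` of `ω`. -/
  inv_τ : ∀ x y (h : C.φ x = y) (hx : x ∉ C.M) (hy : y ∉ C.M) (v : fiber x)
    (u : TangentSpace 𝓘(ℂ, ℂ) x),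
    τ y hy (toOrbiLineBundle.tpow (inv x y h hx v)) (tangentMapAt C.φ x y u) =
      (starRingEnd ℂ) (τ x hx (toOrbiLineBundle.tpow v) u)

namespace DiskSpin

variable {X : Type*} [TopologicalSpace X] [ChartedSpace ℂ X] {I B : Type*} {C : MarkedDisk X I B}
  {r : ℕ}

/-- The internal twists of `S` are the integers `a i` and the boundary twists the integers `b j`. -/
def HasTwists (S : DiskSpin C r) (a : I → ℤ) (b : B → ℤ) : Prop :=
  (∀ i, S.twist (C.z i) = a i) ∧ (∀ i, S.twist (C.φ (C.z i)) = a i) ∧ ∀ j, S.twist (C.x j) = b j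

/-- An isomorphism of twisted `r`-spin structures on a marked disk. -/
structure Iso (S S' : DiskSpin C r) extends
    TwistedSpinBundle.Iso S.toTwistedSpinBundle S'.toTwistedSpinBundle where
  comm_inv : ∀ x y (h : C.φ x = y) (hx : x ∉ C.M) (v : S.fiber x),
    toEquiv y (S.inv x y h hx v) = S'.inv x y h hx (toEquiv x v)

/-- The parameters `t ≠ 0` of the uniformizing chart at `p` lying over the boundary without the
boundary marked points. -/
def punctured (C : MarkedDisk X I B) (r : ℕ) (p : X) : Set ℂ :=
  {t | t ≠ 0 ∧ orbiChart r C.M p t ∈ C.A}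

/-! #### Liftings of `S` -/

/-- A lifting of `S` over `∂Σ` without the boundary marked points (only the values of `v` there
matter): a continuous invariant section with positive `r`-th power. -/
structure IsLiftingS (S : DiskSpin C r) (v : ∀ x, S.fiber x) : Prop where
  continuous : ∀ x ∈ C.A, ContinuousWithinAt (fun y => S.triv x (coord x y) y (v y)) C.A x
  invariant : ∀ x (hx : x ∈ C.A), S.inv x x hx.1 hx.2 (v x) = v x
  positive : ∀ x (hx : x ∈ C.A), C.IsPos x (S.τ x hx.2 (S.tpow (v x)))

/-- Equivalence of liftings of `S`. -/
def EquivS (S : DiskSpin C r) (v v' : ∀ x, S.fiber x) : Prop :=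
  ∃ c : X → ℝ, ContinuousOn c C.A ∧ ∀ x ∈ C.A, 0 < c x ∧ v x = (c x : ℂ) • v' x

/-- The boundary marked point `p` is illegal for the lifting `v` of `S`: some equivalent lifting
`v'` extends continuously to `p` without vanishing, as a section of `|S|`. In other words
`v' = h f` with `h` having a nonzero limit at `p`, where `f = t ^ mult p • e_p(t)` is
the local generator of `|S|`. -/
def IllegalS (S : DiskSpin C r) (v : ∀ x, S.fiber x) (p : X) : Prop :=
  ∃ v', S.IsLiftingS v' ∧ S.EquivS v' v ∧ ∃ (h : ℂ → ℂ) (h₀ : ℂ), h₀ ≠ 0 ∧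
    Filter.Tendsto h (𝓝[punctured C r p] 0) (𝓝 h₀) ∧
    ∀ᶠ t in 𝓝[punctured C r p] 0,
      v' (orbiChart r C.M p t) = (h t * t ^ S.mult p) • S.frame p t

/-! #### Liftings of `J` -/

/-- A section of the coarse bundle `|J| = |S|^∨ ⊗ ω` away from the orbifold points. -/
abbrev SectionJ (S : DiskSpin C r) : Type _ := ∀ x, S.fiber x →ₗ[ℂ] Cotangent x

/-- A lifting of `J` over `∂Σ` without the boundary marked points (only the values of `w` there
matter): a continuous invariant section whose pairing with some lifting of `S` is positive. -/
structure IsLiftingJ (S : DiskSpin C r) (w : S.SectionJ) : Prop where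
  continuous : ∀ x ∈ C.A, ∃ h : X → ℂ, ContinuousWithinAt h C.A x ∧
    ∀ᶠ y in 𝓝[C.A] x, w y ((S.triv x (coord x y) y).symm 1) = h y • dz x y
  invariant : ∀ x (hx : x ∈ C.A) (v : S.fiber x) (u : TangentSpace 𝓘(ℂ, ℂ) x),
    w x (S.inv x x hx.1 hx.2 v) (tangentMapAt C.φ x x u) = (starRingEnd ℂ) (w x v u)
  positive : ∃ v, S.IsLiftingS v ∧ ∀ x ∈ C.A, C.IsPos x (w x (v x))

/-- Equivalence of liftings of `J`. -/
def EquivJ (S : DiskSpin C r) (w w' : S.SectionJ) : Prop :=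
  ∃ c : X → ℝ, ContinuousOn c C.A ∧ ∀ x ∈ C.A, 0 < c x ∧ w x = (c x : ℂ) • w' x

/-- The boundary marked point `p` is illegal for the lifting `w` of `J`: some equivalent lifting
`w'` extends continuously to `p` without vanishing, as a section of `|J|`. In other words
`w' = h (f^∨ ⊗ dz)` with `h` having a nonzero limit at `p`, where `f = t ^ mult p • e_p(t)`
is the local generator of `|S|`. -/
def IllegalJ (S : DiskSpin C r) (w : S.SectionJ) (p : X) : Prop :=
  ∃ w', S.IsLiftingJ w' ∧ S.EquivJ w' w ∧ ∃ (h : ℂ → ℂ) (h₀ : ℂ), h₀ ≠ 0 ∧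
    Filter.Tendsto h (𝓝[punctured C r p] 0) (𝓝 h₀) ∧
    ∀ᶠ t in 𝓝[punctured C r p] 0,
      w' (orbiChart r C.M p t) (t ^ S.mult p • S.frame p t) = h t • dz p (orbiChart r C.M p t)

/-- `S` is compatible: it admits a lifting. -/
def Compatible (S : DiskSpin C r) : Prop := ∃ v, S.IsLiftingS v

end DiskSpin

open DiskSpin in
/-- A twisted `r`-spin structure on a marked disk with a lifting of `S`; an equivalence class of liftings
is given by a representative. -/
structure LiftedS {X : Type*} [TopologicalSpace X] [ChartedSpace ℂ X] {I B : Type*}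
    (C : MarkedDisk X I B) (r : ℕ) extends DiskSpin C r where
  v : ∀ x, fiber x
  isLifting : toDiskSpin.IsLiftingS v

open DiskSpin in
/-- A twisted `r`-spin structure on a marked disk with a lifting of `J`; an equivalence class of liftings
is given by a representative. -/
structure LiftedJ {X : Type*} [TopologicalSpace X] [ChartedSpace ℂ X] {I B : Type*}
    (C : MarkedDisk X I B) (r : ℕ) extends DiskSpin C r where
  w : toDiskSpin.SectionJ
  isLifting : toDiskSpin.IsLiftingJ w

section Lifted

variable {X : Type*} [TopologicalSpace X] [ChartedSpace ℂ X] {I B : Type*} {C : MarkedDisk X I B}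
  {r : ℕ}

/-- `D` is the set of legal boundary marked points. -/
def LiftedS.LegalSet (S : LiftedS C r) (D : Finset B) : Prop :=
  ∀ j, j ∈ D ↔ ¬ S.toDiskSpin.IllegalS S.v (C.x j)

/-- `D` is the set of legal boundary marked points. -/
def LiftedJ.LegalSet (S : LiftedJ C r) (D : Finset B) : Prop :=
  ∀ j, j ∈ D ↔ ¬ S.toDiskSpin.IllegalJ S.w (C.x j)

/-- An isomorphism preserving the equivalence classes of liftings. -/
structure LiftedS.Iso (S S' : LiftedS C r) extends
    toDiskIso : DiskSpin.Iso S.toDiskSpin S'.toDiskSpin where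
  map_lifting : S'.EquivS (fun x => toEquiv x (S.v x)) S'.v

/-- An isomorphism preserving the equivalence classes of liftings. -/
structure LiftedJ.Iso (S S' : LiftedJ C r) extends
    toDiskIso : DiskSpin.Iso S.toDiskSpin S'.toDiskSpin where
  map_lifting : S'.EquivJ (fun x => S.w x ∘ₗ (toEquiv x).symm.toLinearMap) S'.w

end Lifted

/-- A graded `r`-spin structure on a marked disk: a compatible twisted `r`-spin structure with all
boundary twists `r - 2`, and a lifting of `J` that alternates at every boundary marked point. -/
structure GradedDisk {X : Type*} [TopologicalSpace X] [ChartedSpace ℂ X] {I B : Type*}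
    (C : MarkedDisk X I B) (r : ℕ) extends LiftedJ C r where
  compatible_lifting : toDiskSpin.Compatible
  twist_boundary : ∀ j, toTwistedSpinBundle.twist (C.x j) = r - 2
  alternates : ∀ j, ¬ toDiskSpin.IllegalJ w (C.x j)

end RSpin

namespace RSpin

/-! ### Torsors under a discrete group -/

section Torsor

variable {A G : Type*} [TopologicalSpace A] [Group G]

/-- `c x` is a family of local sections, defined near `x`, any two of which differ by a locally
constant factor. -/
def IsLocalFamily (c : A → A → G) : Prop :=
  ∀ x, ∀ᶠ y in 𝓝 x, ∃ k, ∀ᶠ y' in 𝓝 y, c x y' = k * c y y'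

/-- The section `s` is, near `x`, a constant multiple of the local section given by `c x`. -/
def IsSectionAt (c : A → A → G) (s : A → G) (x : A) : Prop :=
  ∃ k, ∀ᶠ y in 𝓝 x, s y = k * c x y

theorem IsLocalFamily.eventually {c : A → A → G} (hc : IsLocalFamily c) (x : A) :
    ∀ᶠ y in 𝓝 x, ∀ᶠ y' in 𝓝 y, c x y' = c x y * (c y y)⁻¹ * c y y' := by
  filter_upwards [hc x] with y ⟨k, hk⟩
  have := hk.self_of_nhds
  filter_upwards [hk] with y' hy'
  rw [hy', this]; group

/-- The total space of the torsor under `G` given by a family of local sections. -/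
structure TorsorSpace (c : A → A → G) where
  /-- the base point -/
  base : A
  /-- the coordinate in the torsor -/
  val : G

/-- The filter of neighbourhoods of a point of the total space. -/
def torsorNhds (c : A → A → G) (e : TorsorSpace c) : Filter (TorsorSpace c) :=
  Filter.map (fun y => ⟨y, e.val * (c e.base e.base)⁻¹ * c e.base y⟩) (𝓝 e.base)

instance (c : A → A → G) : TopologicalSpace (TorsorSpace c) :=
  TopologicalSpace.mkOfNhds (torsorNhds c)

theorem nhds_torsor {c : A → A → G} (hc : IsLocalFamily c) (e : TorsorSpace c) :
    𝓝 e = torsorNhds c e := by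
  refine TopologicalSpace.nhds_mkOfNhds _ _ ?_ ?_
  · intro e s hs
    replace hs : ∀ᶠ y in 𝓝 e.base,
      (⟨y, e.val * (c e.base e.base)⁻¹ * c e.base y⟩ : TorsorSpace c) ∈ s := hs
    simpa using hs.self_of_nhds
  · intro e s hs
    replace hs : ∀ᶠ y in 𝓝 e.base,
      (⟨y, e.val * (c e.base e.base)⁻¹ * c e.base y⟩ : TorsorSpace c) ∈ s := hs
    show ∀ᶠ y in 𝓝 e.base, _
    filter_upwards [hs.eventually_nhds, hc.eventually e.base] with y h1 h2
    show ∀ᶠ y' in 𝓝 y, _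
    filter_upwards [h1, h2] with y' h3 h4
    convert h3 using 2
    simp [h4, mul_assoc]

/-- The local trivialization of the torsor near `x`. -/
noncomputable def torsorTrivialization [TopologicalSpace G] [DiscreteTopology G] {c : A → A → G} (hc : IsLocalFamily c) (x : A) :
    Bundle.Trivialization G (TorsorSpace.base : TorsorSpace c → A) where
  toFun := fun e => (e.base, e.val * (c x e.base)⁻¹)
  invFun := fun e => ⟨e.1, e.2 * c x e.1⟩
  source := TorsorSpace.base ⁻¹'
    interior {y | ∀ᶠ y' in 𝓝 y, c x y' = c x y * (c y y)⁻¹ * c y y'}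
  target := interior {y | ∀ᶠ y' in 𝓝 y, c x y' = c x y * (c y y)⁻¹ * c y y'} ×ˢ Set.univ
  map_source' := fun e he => ⟨he, trivial⟩
  map_target' := fun e he => he.1
  left_inv' := fun e _ => by simp
  right_inv' := fun e _ => by simp
  open_source := isOpen_interior.preimage <| by
    refine continuous_iff_continuousAt.2 fun e => ?_
    rw [ContinuousAt, nhds_torsor hc]
    exact Filter.tendsto_map'_iff.2 Filter.tendsto_id
  open_target := isOpen_interior.prod isOpen_univ
  continuousOn_toFun := by
    intro e he
    refine ContinuousAt.continuousWithinAt ?_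
    rw [ContinuousAt, nhds_torsor hc, nhds_prod_eq]
    refine Filter.tendsto_map'_iff.2 (Filter.tendsto_id.prodMk ?_)
    rw [nhds_discrete G, Filter.tendsto_pure]
    have := interior_subset (show e.base ∈ interior _ from he)
    filter_upwards [this] with y hy
    simp [hy, mul_assoc]
  continuousOn_invFun := by
    rintro ⟨y, g⟩ he
    refine ContinuousAt.continuousWithinAt ?_
    rw [ContinuousAt, nhds_torsor hc, nhds_prod_eq, nhds_discrete G, Filter.prod_pure]
    refine Filter.tendsto_map'_iff.2 (Filter.Tendsto.congr' ?_ Filter.tendsto_map)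
    have := interior_subset (show y ∈ interior _ from he.1)
    filter_upwards [this] with y' hy'
    simp [hy', mul_assoc]
  baseSet := interior {y | ∀ᶠ y' in 𝓝 y, c x y' = c x y * (c y y)⁻¹ * c y y'}
  open_baseSet := isOpen_interior
  source_eq := rfl
  target_eq := rfl
  proj_toFun := fun _ _ => rfl

theorem isCoveringMap_torsor [TopologicalSpace G] [DiscreteTopology G] {c : A → A → G} (hc : IsLocalFamily c) :
    IsCoveringMap (TorsorSpace.base : TorsorSpace c → A) := by
  intro x
  refine (IsEvenlyCovered.of_trivialization (t := torsorTrivialization hc x)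
    ?_).to_isEvenlyCovered_preimage
  exact mem_interior_iff_mem_nhds.2 (hc.eventually x)

/-- A torsor on a simply connected space has a section. -/
theorem IsLocalFamily.exists_section [SimplyConnectedSpace A] [LocallyPathConnectedSpace A]
    {c : A → A → G} (hc : IsLocalFamily c) : ∃ s : A → G, ∀ x, IsSectionAt c s x := by
  let _ : TopologicalSpace G := ⊥
  have : DiscreteTopology G := ⟨rfl⟩
  have a₀ : A := Classical.arbitrary A
  obtain ⟨F, ⟨-, hF⟩, -⟩ := (isCoveringMap_torsor hc).existsUnique_continuousMap_lifts
    (ContinuousMap.id A) a₀ ⟨a₀, 1⟩ rfl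
  refine ⟨fun x => (F x).val, fun x => ⟨(F x).val * (c x x)⁻¹, ?_⟩⟩
  have h1 : ∀ y, (F y).base = y := fun y => congrFun hF y
  have h2 := F.continuous.continuousAt (x := x)
  rw [ContinuousAt, nhds_torsor hc] at h2
  have h3 : {e : TorsorSpace c | e.val = (F x).val * (c x x)⁻¹ * c x e.base} ∈
      torsorNhds c (F x) := by
    refine Filter.mem_map.2 (Filter.univ_mem' fun y => ?_)
    simp [h1]
  filter_upwards [h2 h3] with y hy
  simpa [h1] using hy

/-- Two sections over a connected set differ by a constant. -/
theorem IsSectionAt.exists_const {c : A → A → G} {s s' : A → G} {U : Set A} (hU : IsPreconnected U)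
    (h : ∀ x ∈ U, IsSectionAt c s x) (h' : ∀ x ∈ U, IsSectionAt c s' x) :
    ∃ k, ∀ x ∈ U, s x = k * s' x := by
  rcases U.eq_empty_or_nonempty with rfl | ⟨x₀, hx₀⟩
  · exact ⟨1, by simp⟩
  let _ : TopologicalSpace G := ⊥
  have : DiscreteTopology G := ⟨rfl⟩
  have hcont : ContinuousOn (fun x => s x * (s' x)⁻¹) U := by
    intro x hx
    obtain ⟨k, hk⟩ := h x hx
    obtain ⟨k', hk'⟩ := h' x hx
    refine ContinuousAt.continuousWithinAt ?_
    rw [ContinuousAt, nhds_discrete G, Filter.tendsto_pure]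
    have e1 := hk.self_of_nhds
    have e2 := hk'.self_of_nhds
    filter_upwards [hk, hk'] with y hy hy'
    simp [hy, hy', e1, e2]
  refine ⟨s x₀ * (s' x₀)⁻¹, fun x hx => ?_⟩
  have := hU.constant hcont hx hx₀
  exact mul_inv_eq_iff_eq_mul.1 this

end Torsor

theorem isPreconnected_punctured_ball {ρ : ℝ} (hρ : 0 < ρ) :
    IsPreconnected (Metric.ball (0 : ℂ) ρ \ {0}) := by
  have : Metric.ball (0 : ℂ) ρ \ {0} = Complex.exp '' {z | z.re < Real.log ρ} := by
    ext z
    simp only [Set.mem_sdiff, Metric.mem_ball, dist_zero_right, Set.mem_singleton_iff, Set.mem_image,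
      Set.mem_ofPred_eq]
    constructor
    · rintro ⟨h1, h2⟩
      refine ⟨Complex.log z, ?_, Complex.exp_log h2⟩
      rw [Complex.log_re]
      exact Real.log_lt_log (norm_pos_iff.2 h2) h1
    · rintro ⟨w, h1, rfl⟩
      refine ⟨?_, Complex.exp_ne_zero w⟩
      rw [Complex.norm_exp, ← Real.lt_log_iff_exp_lt hρ]
      exact h1
  rw [this]
  exact ((convex_halfSpace_re_lt _).isPreconnected).image _ Complex.continuous_exp.continuousOn

end RSpin

namespace RSpin

/-! ### Local complex analysis -/

theorem exists_analytic_root {n : ℕ} (hn : n ≠ 0) {w₀ : ℂ} (hw₀ : w₀ ≠ 0) :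
    ∃ ρ : ℂ → ℂ, AnalyticAt ℂ ρ w₀ ∧ ρ w₀ ≠ 0 ∧ ∀ w, w ≠ 0 → ρ w ^ n = w := by
  obtain ⟨b, hb⟩ := IsAlgClosed.exists_pow_nat_eq w₀ (Nat.pos_of_ne_zero hn)
  have hb0 : b ≠ 0 := by rintro rfl; simp [hn] at hb; exact hw₀ hb.symm
  refine ⟨fun w => b * Complex.exp (Complex.log (w / w₀) / n), ?_, ?_, fun w hw => ?_⟩
  · have h1 : AnalyticAt ℂ (fun w : ℂ => w / w₀) w₀ := analyticAt_id.div_const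
    refine analyticAt_const.mul (AnalyticAt.cexp ?_)
    exact (h1.clog (by simp [hw₀])).div_const
  · exact mul_ne_zero hb0 (Complex.exp_ne_zero _)
  · rw [mul_pow, hb, ← Complex.exp_nat_mul, mul_div_cancel₀ _ (Nat.cast_ne_zero.2 hn),
      Complex.exp_log (div_ne_zero hw hw₀), mul_div_cancel₀ _ hw₀]

theorem nhds_le_map_of_not_const {f : ℂ → ℂ} {z₀ : ℂ} (hf : AnalyticAt ℂ f z₀)
    (h : ∃ᶠ z in 𝓝 z₀, f z ≠ f z₀) : 𝓝 (f z₀) ≤ Filter.map f (𝓝 z₀) := by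
  rcases hf.eventually_constant_or_nhds_le_map_nhds with h' | h'
  · exact (h (h'.mono fun z hz => not_not.2 hz)).elim
  · exact h'

theorem nhds_le_map_of_injOn {f : ℂ → ℂ} {z₀ : ℂ} (hf : AnalyticAt ℂ f z₀) {U : Set ℂ}
    (hU : U ∈ 𝓝 z₀) (hinj : Set.InjOn f U) : 𝓝 (f z₀) ≤ Filter.map f (𝓝 z₀) := by
  refine nhds_le_map_of_not_const hf ?_
  have h1 : ∀ᶠ z in 𝓝[≠] z₀, f z ≠ f z₀ := by
    filter_upwards [nhdsWithin_le_nhds hU, self_mem_nhdsWithin] with z hz hz'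
    exact fun h => hz' (hinj hz (mem_of_mem_nhds hU) h)
  exact h1.frequently.filter_mono nhdsWithin_le_nhds

/-- An injective holomorphic function has nowhere vanishing derivative. -/
theorem deriv_ne_zero_of_injOn {f : ℂ → ℂ} {z₀ : ℂ} (hf : AnalyticAt ℂ f z₀) {U : Set ℂ}
    (hU : U ∈ 𝓝 z₀) (hinj : Set.InjOn f U) : deriv f z₀ ≠ 0 := by
  have hsub : AnalyticAt ℂ (fun z => f z - f z₀) z₀ := hf.sub analyticAt_const
  have htop : analyticOrderAt (fun z => f z - f z₀) z₀ ≠ ⊤ := by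
    intro h
    have h1 := analyticOrderAt_eq_top.1 h
    have h2 : ∀ᶠ z in 𝓝[≠] z₀, False := by
      filter_upwards [nhdsWithin_le_nhds hU, self_mem_nhdsWithin, nhdsWithin_le_nhds h1]
        with z hz hz' hz''
      exact hz' (hinj hz (mem_of_mem_nhds hU) (sub_eq_zero.1 hz''))
    simpa using h2.exists
  obtain ⟨n, hn⟩ := ENat.ne_top_iff_exists.1 htop
  obtain ⟨g, hg, hg0, hfg⟩ := hsub.analyticOrderAt_eq_natCast.1 hn.symm
  have hn0 : n ≠ 0 := by
    rintro rfl
    have := hfg.self_of_nhds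
    simp at this
    exact hg0 this.symm
  obtain ⟨ρ, hρ, hρ0, hρn⟩ := exists_analytic_root hn0 hg0
  have hh : AnalyticAt ℂ (fun z => (z - z₀) * ρ (g z)) z₀ :=
    (analyticAt_id.sub analyticAt_const).mul (hρ.comp hg)
  have hpow : ∀ᶠ z in 𝓝 z₀, ((z - z₀) * ρ (g z)) ^ n = f z - f z₀ := by
    filter_upwards [hfg, hg.continuousAt.eventually_ne hg0] with z hz hz'
    rw [mul_pow, hρn _ hz', hz, smul_eq_mul]
  by_cases hn1 : n = 1
  · subst hn1
    have h1 : HasDerivAt (fun z => (z - z₀) * ρ (g z)) (1 * ρ (g z₀) + (z₀ - z₀) * deriv (ρ ∘ g) z₀)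
        z₀ := ((hasDerivAt_id z₀).sub_const z₀).mul (hρ.comp hg).differentiableAt.hasDerivAt
    have h2 : HasDerivAt (fun z => f z - f z₀) (ρ (g z₀)) z₀ := by
      simp at h1
      exact h1.congr_of_eventuallyEq (hpow.mono fun z hz => by simpa using hz.symm)
    have h3 := (h2.add_const (f z₀)).deriv
    simp only [sub_add_cancel] at h3
    rw [h3]; exact hρ0
  · exfalso
    have hopen : 𝓝 (0 : ℂ) ≤ Filter.map (fun z => (z - z₀) * ρ (g z)) (𝓝 z₀) := by
      have := nhds_le_map_of_not_const hh (by
        have h1 : ∀ᶠ z in 𝓝[≠] z₀, (z - z₀) * ρ (g z) ≠ (z₀ - z₀) * ρ (g z₀) := by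
          filter_upwards [self_mem_nhdsWithin, nhdsWithin_le_nhds
            ((hρ.comp hg).continuousAt.eventually_ne hρ0)] with z hz hz'
          simpa [sub_eq_zero] using ⟨hz, hz'⟩
        exact h1.frequently.filter_mono nhdsWithin_le_nhds)
      simpa using this
    set V := {z | z ∈ U ∧ ((z - z₀) * ρ (g z)) ^ n = f z - f z₀}
    have hV : V ∈ 𝓝 z₀ := Filter.inter_mem hU hpow
    have h1 : (fun z => (z - z₀) * ρ (g z)) '' V ∈ 𝓝 (0 : ℂ) := hopen (Filter.image_mem_map hV)
    have hζ := Complex.isPrimitiveRoot_exp n hn0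
    set ζ := Complex.exp (2 * Real.pi * Complex.I / n)
    have h2 : ∀ᶠ w in 𝓝 (0 : ℂ), ζ * w ∈ (fun z => (z - z₀) * ρ (g z)) '' V := by
      have : Filter.Tendsto (fun w => ζ * w) (𝓝 0) (𝓝 0) := by
        simpa using (continuous_const_mul ζ).tendsto 0
      exact this h1
    obtain ⟨w, ⟨⟨z, hz, hzw⟩, ⟨z', hz', hzw'⟩⟩, hw0⟩ :=
      (Filter.Eventually.and (nhdsWithin_le_nhds (Filter.inter_mem h1 h2))
        self_mem_nhdsWithin : ∀ᶠ w in 𝓝[≠] (0 : ℂ), _).exists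
    simp only at hzw hzw'
    have h3 : f z - f z₀ = f z' - f z₀ := by
      rw [← hz.2, ← hz'.2, hzw, hzw', mul_pow, hζ.pow_eq_one, one_mul]
    have h4 : z = z' := hinj hz.1 hz'.1 (by simpa using h3)
    rw [← h4, hzw] at hzw'
    have h5 : ζ = 1 := by
      have : (ζ - 1) * w = 0 := by rw [sub_mul, ← hzw']; ring
      rcases mul_eq_zero.1 this with h | h
      · exact sub_eq_zero.1 h
      · exact (hw0 h).elim
    exact hn1 (hζ.unique (by rw [h5]; exact IsPrimitiveRoot.one))

/-! ### Linear forms on `ℂ` -/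

theorem clm_apply (ξ : ℂ →L[ℂ] ℂ) (u : ℂ) : ξ u = u * ξ 1 := by
  rw [← smul_eq_mul, ← map_smul, smul_eq_mul, mul_one]

theorem clm_one_ne_zero {ξ : ℂ →L[ℂ] ℂ} (hξ : ξ ≠ 0) : ξ 1 ≠ 0 :=
  fun h => hξ <| ContinuousLinearMap.ext fun u => by rw [clm_apply, h, mul_zero]; rfl

theorem clm_apply_eq_zero_iff {ξ : ℂ →L[ℂ] ℂ} (hξ : ξ ≠ 0) (u : ℂ) : ξ u = 0 ↔ u = 0 := by
  rw [clm_apply, mul_eq_zero, or_iff_left (clm_one_ne_zero hξ)]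

theorem clm_exists_smul {ξ : ℂ →L[ℂ] ℂ} (hξ : ξ ≠ 0) (η : ℂ →L[ℂ] ℂ) : ∃ c : ℂ, η = c • ξ := by
  refine ⟨η 1 / ξ 1, ContinuousLinearMap.ext fun u => ?_⟩
  have := clm_one_ne_zero hξ
  rw [smul_apply, clm_apply η u, clm_apply ξ u, smul_eq_mul]
  field_simp

theorem clm_smul_inj {ξ : ℂ →L[ℂ] ℂ} (hξ : ξ ≠ 0) {c c' : ℂ} (h : c • ξ = c' • ξ) : c = c' :=
  smul_left_injective ℂ hξ h

/-! ### Uniformizing charts -/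

section Charts

theorem isotropy_ne_zero {X : Type*} {r : ℕ} {M : Set X} (hr : r ≠ 0) (x : X) : isotropy r M x ≠ 0 := by
  unfold isotropy; split_ifs <;> simp [hr]

theorem isotropy_of_mem {X : Type*} {r : ℕ} {M : Set X} {x : X} (hx : x ∈ M) : isotropy r M x = r := by simp [isotropy, hx]

theorem isotropy_of_notMem {X : Type*} {r : ℕ} {M : Set X} {x : X} (hx : x ∉ M) :
    isotropy r M x = 1 := by simp [isotropy, hx]

theorem eventually_notMem {X : Type*} [TopologicalSpace X] {M : Set X} [T1Space X] (hM : M.Finite)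
    (x : X) : ∀ᶠ y in 𝓝[≠] x, y ∉ M := by
  have h1 : (M \ {x})ᶜ ∈ 𝓝 x :=
    (hM.subset Set.sdiff_subset).isClosed.isOpen_compl.mem_nhds (by simp)
  filter_upwards [nhdsWithin_le_nhds h1, self_mem_nhdsWithin] with y h2 h3 h4
  exact h2 ⟨h4, h3⟩

variable {X : Type*} [TopologicalSpace X] [ChartedSpace ℂ X] {r : ℕ} {M : Set X}

/-- The parameter `t` belongs to the domain of the uniformizing chart at `x`. -/
def InDomain (r : ℕ) (M : Set X) (x : X) (t : ℂ) : Prop :=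
  chartAt ℂ x x + t ^ isotropy r M x ∈ (chartAt ℂ x).target

theorem orbiChart_zero (hr : r ≠ 0) (x : X) : orbiChart r M x 0 = x := by
  simp [orbiChart, isotropy_ne_zero hr]

theorem isOpen_inDomain (x : X) : IsOpen {t | InDomain r M x t} :=
  (chartAt ℂ x).open_target.preimage (by fun_prop)

theorem inDomain_zero (hr : r ≠ 0) (x : X) : InDomain r M x 0 := by
  simp [InDomain, isotropy_ne_zero hr]

theorem eventually_inDomain (hr : r ≠ 0) (x : X) : ∀ᶠ t in 𝓝 (0 : ℂ), InDomain r M x t :=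
  (isOpen_inDomain x).mem_nhds (inDomain_zero hr x)

theorem InDomain.chart_eq {x : X} {t : ℂ} (h : InDomain r M x t) :
    chartAt ℂ x (orbiChart r M x t) = chartAt ℂ x x + t ^ isotropy r M x :=
  (chartAt ℂ x).right_inv h

theorem InDomain.coord_eq {x : X} {t : ℂ} (h : InDomain r M x t) :
    coord x (orbiChart r M x t) = t ^ isotropy r M x := by
  simp [coord, h.chart_eq]

theorem InDomain.mem_source {x : X} {t : ℂ} (h : InDomain r M x t) :
    orbiChart r M x t ∈ (chartAt ℂ x).source := (chartAt ℂ x).map_target h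

theorem InDomain.continuousAt {x : X} {t : ℂ} (h : InDomain r M x t) :
    ContinuousAt (orbiChart r M x) t :=
  ((chartAt ℂ x).continuousAt_symm h).comp (f := fun t => chartAt ℂ x x + t ^ isotropy r M x)
    (by fun_prop)

theorem InDomain.orbiChart_eq_iff (hr : r ≠ 0) {x : X} {t : ℂ} (h : InDomain r M x t) :
    orbiChart r M x t = x ↔ t = 0 := by
  constructor
  · intro h'
    have := h.chart_eq
    rw [h'] at this
    simpa [isotropy_ne_zero hr] using this
  · rintro rfl; exact orbiChart_zero hr x

theorem InDomain.nhds_le (hr : r ≠ 0) {x : X} {t : ℂ} (h : InDomain r M x t) :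
    𝓝 (orbiChart r M x t) ≤ Filter.map (orbiChart r M x) (𝓝 t) := by
  have h1 : 𝓝 (chartAt ℂ x x + t ^ isotropy r M x) ≤
      Filter.map (fun t => chartAt ℂ x x + t ^ isotropy r M x) (𝓝 t) := by
    have : IsOpenMap (fun t : ℂ => chartAt ℂ x x + t ^ isotropy r M x) := by
      have : NeZero (isotropy r M x) := ⟨isotropy_ne_zero hr x⟩
      exact (isOpenMap_add_left (chartAt ℂ x x)).comp (Complex.isOpenQuotientMap_pow _).isOpenMap
    exact this.nhds_le t
  have h2 : 𝓝 (orbiChart r M x t) = Filter.map (chartAt ℂ x).symm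
      (𝓝 (chartAt ℂ x x + t ^ isotropy r M x)) := ((chartAt ℂ x).symm.map_nhds_eq h).symm
  rw [h2]
  exact Filter.map_mono h1

theorem tendsto_orbiChart (hr : r ≠ 0) (x : X) :
    Filter.Tendsto (orbiChart r M x) (𝓝 0) (𝓝 x) := by
  have := (inDomain_zero hr x : InDomain r M x 0).continuousAt
  rwa [ContinuousAt, orbiChart_zero hr] at this

theorem map_orbiChart (hr : r ≠ 0) (x : X) : Filter.map (orbiChart r M x) (𝓝 0) = 𝓝 x := by
  refine le_antisymm (tendsto_orbiChart hr x) ?_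
  have := (inDomain_zero hr x : InDomain r M x 0).nhds_le hr
  rwa [orbiChart_zero hr] at this

theorem InDomain.map_nhds (hr : r ≠ 0) {x : X} {t : ℂ} (h : InDomain r M x t) :
    Filter.map (orbiChart r M x) (𝓝 t) = 𝓝 (orbiChart r M x t) :=
  le_antisymm h.continuousAt (h.nhds_le hr)

theorem eventually_orbiChart_iff (hr : r ≠ 0) {x : X} {p : X → Prop} :
    (∀ᶠ t in 𝓝 0, p (orbiChart r M x t)) ↔ ∀ᶠ y in 𝓝 x, p y := by
  rw [← map_orbiChart (M := M) hr x, Filter.eventually_map]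

theorem tendsto_punctured_orbiChart (hr : r ≠ 0) (x : X) :
    Filter.Tendsto (orbiChart r M x) (𝓝[≠] 0) (𝓝[≠] x) := by
  refine tendsto_nhdsWithin_iff.2
    ⟨(tendsto_orbiChart hr x).mono_left nhdsWithin_le_nhds, ?_⟩
  filter_upwards [nhdsWithin_le_nhds (eventually_inDomain hr x), self_mem_nhdsWithin] with t h h'
  exact fun h'' => h' ((h.orbiChart_eq_iff hr).1 h'')

theorem nhdsNE_neBot (x : X) : (𝓝[≠] x).NeBot :=
  (tendsto_punctured_orbiChart (r := 1) (M := ∅) one_ne_zero x).neBot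

/-- Points of the chart which have the same image differ by the action of the isotropy group. -/
theorem InDomain.exists_root {x : X} {t t' : ℂ} (h : InDomain r M x t) (h' : InDomain r M x t')
    (heq : orbiChart r M x t = orbiChart r M x t') (ht : t ≠ 0) :
    ∃ ζ : ℂ, ζ ^ isotropy r M x = 1 ∧ t' = ζ * t := by
  have h1 := h.coord_eq
  rw [heq, h'.coord_eq] at h1
  exact ⟨t' / t, by rw [div_pow, h1, div_self (pow_ne_zero _ ht)], by field_simp⟩

theorem orbiChart_coord {x y : X} (hx : x ∉ M) (hy : y ∈ (chartAt ℂ x).source) :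
    orbiChart r M x (coord x y) = y := by
  simp [orbiChart, isotropy_of_notMem hx, coord, hy]

@[simp] theorem coord_self (x : X) : coord x x = 0 := by simp [coord]

theorem continuousAt_coord {x y : X} (hy : y ∈ (chartAt ℂ x).source) :
    ContinuousAt (coord x) y :=
  ((chartAt ℂ x).continuousAt hy).sub continuousAt_const

theorem tendsto_coord (x : X) : Filter.Tendsto (coord x) (𝓝 x) (𝓝 0) := by
  simpa [ContinuousAt] using continuousAt_coord (mem_chart_source ℂ x)

theorem eventually_mem_source (x : X) : ∀ᶠ y in 𝓝 x, y ∈ (chartAt ℂ x).source :=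
  (chartAt ℂ x).open_source.mem_nhds (mem_chart_source ℂ x)

/-! ### Differentials of holomorphic functions -/

/-- The expression of a function in the preferred chart at `x`. -/
noncomputable def inChart (F : X → ℂ) (x : X) : ℂ → ℂ := F ∘ (chartAt ℂ x).symm

/-- The differential of a function as a section of the cotangent bundle. -/
noncomputable def differential (F : X → ℂ) (x : X) : Cotangent x := mfderiv 𝓘(ℂ, ℂ) 𝓘(ℂ, ℂ) F x

theorem smul_cotangent_inj {y : X} {ξ : Cotangent y} (hξ : ξ ≠ 0) {c c' : ℂ}
    (h : c • ξ = c' • ξ) : c = c' :=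
  clm_smul_inj (ξ := ξ) hξ h

variable [IsManifold 𝓘(ℂ, ℂ) ω X]

theorem mdifferentiableAt_chartAt {x y : X} (hy : y ∈ (chartAt ℂ x).source) :
    MDifferentiableAt 𝓘(ℂ, ℂ) 𝓘(ℂ, ℂ) (chartAt ℂ x) y := by
  have : IsManifold 𝓘(ℂ, ℂ) 1 X := IsManifold.of_le (n := ω) le_top
  exact mdifferentiableAt_atlas (chart_mem_atlas ℂ x) hy

theorem differentiableAt_inChart {F : X → ℂ} {x y : X} (hy : y ∈ (chartAt ℂ x).source)
    (hF : MDifferentiableAt 𝓘(ℂ, ℂ) 𝓘(ℂ, ℂ) F y) :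
    DifferentiableAt ℂ (inChart F x) (chartAt ℂ x y) := by
  have : IsManifold 𝓘(ℂ, ℂ) 1 X := IsManifold.of_le (n := ω) le_top
  rw [← mdifferentiableAt_iff_differentiableAt]
  have h1 : MDifferentiableAt 𝓘(ℂ, ℂ) 𝓘(ℂ, ℂ) (chartAt ℂ x).symm (chartAt ℂ x y) :=
    mdifferentiableAt_atlas_symm (chart_mem_atlas ℂ x) ((chartAt ℂ x).map_source hy)
  refine MDifferentiableAt.comp _ ?_ h1
  rwa [(chartAt ℂ x).left_inv hy]

theorem differential_eq {F : X → ℂ} {x y : X} (hy : y ∈ (chartAt ℂ x).source)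
    (hF : MDifferentiableAt 𝓘(ℂ, ℂ) 𝓘(ℂ, ℂ) F y) :
    differential F y = deriv (inChart F x) (chartAt ℂ x y) • dz x y := by
  have h1 : F =ᶠ[𝓝 y] inChart F x ∘ chartAt ℂ x := by
    filter_upwards [(chartAt ℂ x).open_source.mem_nhds hy] with y' hy'
    simp [inChart, hy']
  have h2 := differentiableAt_inChart hy hF
  rw [differential, h1.mfderiv_eq, mfderiv_comp y
    (mdifferentiableAt_iff_differentiableAt.2 h2) (mdifferentiableAt_chartAt hy), mfderiv_eq_fderiv]
  refine ContinuousLinearMap.ext fun u => ?_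
  exact (clm_apply (fderiv ℂ (inChart F x) (chartAt ℂ x y)) _).trans (mul_comm _ _)

theorem analyticAt_inChart {F : X → ℂ} {x : X}
    (hF : ∀ᶠ y in 𝓝 x, MDifferentiableAt 𝓘(ℂ, ℂ) 𝓘(ℂ, ℂ) F y) :
    AnalyticAt ℂ (inChart F x) (chartAt ℂ x x) := by
  rw [Complex.analyticAt_iff_eventually_differentiableAt]
  have h1 : Filter.Tendsto (chartAt ℂ x).symm (𝓝 (chartAt ℂ x x)) (𝓝 x) := by
    simpa [ContinuousAt] using (chartAt ℂ x).continuousAt_symm (mem_chart_target ℂ x)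
  filter_upwards [h1.eventually hF, (chartAt ℂ x).open_target.mem_nhds (mem_chart_target ℂ x)]
    with s hs hs'
  have := differentiableAt_inChart ((chartAt ℂ x).map_target hs') hs
  rwa [(chartAt ℂ x).right_inv hs'] at this

theorem analyticAt_comp_add_pow {f : ℂ → ℂ} {a : ℂ} (hf : AnalyticAt ℂ f a) {n : ℕ} (hn : n ≠ 0) :
    AnalyticAt ℂ (fun t => f (a + t ^ n)) 0 := by
  refine AnalyticAt.fun_comp (g := f) ?_ (by fun_prop)
  simpa [hn] using hf

theorem analyticAt_comp_orbiChart (hr : r ≠ 0) {F : X → ℂ} {x : X}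
    (hF : ∀ᶠ y in 𝓝 x, MDifferentiableAt 𝓘(ℂ, ℂ) 𝓘(ℂ, ℂ) F y) :
    AnalyticAt ℂ (fun t => F (orbiChart r M x t)) 0 :=
  analyticAt_comp_add_pow (analyticAt_inChart hF) (isotropy_ne_zero hr x)

theorem dz_self (x : X) (u : TangentSpace 𝓘(ℂ, ℂ) x) : dz x x u = u := by
  have : IsManifold 𝓘(ℂ, ℂ) 1 X := IsManifold.of_le (n := ω) le_top
  rw [dz, mfderiv_chartAt_eq_tangentCoordChange (mem_chart_source ℂ x)]
  exact tangentCoordChange_self (by simp)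

theorem dz_ne_zero {x y : X} (hy : y ∈ (chartAt ℂ x).source) : dz x y ≠ 0 := by
  intro h
  have h2 := differential_eq hy (mdifferentiableAt_chartAt (mem_chart_source ℂ y))
  have h3 : differential (chartAt ℂ y) y (1 : ℂ) = (1 : ℂ) := dz_self y (1 : ℂ)
  rw [h2, h] at h3
  have h4 : (deriv (inChart (chartAt ℂ y) x) (chartAt ℂ x y) * 0 : ℂ) = 1 := h3
  simp at h4

theorem exists_smul_dz {x y : X} (hy : y ∈ (chartAt ℂ x).source) (ξ : Cotangent y) :
    ∃ c : ℂ, ξ = c • dz x y :=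
  clm_exists_smul (ξ := dz x y) (dz_ne_zero hy) ξ

theorem smul_dz_inj {x y : X} (hy : y ∈ (chartAt ℂ x).source) {c c' : ℂ}
    (h : c • dz x y = c' • dz x y) : c = c' :=
  smul_cotangent_inj (dz_ne_zero hy) h

end Charts

end RSpin

namespace RSpin

set_option linter.unusedSectionVars false

/-! ### Scalars attached to line bundles and spin bundles -/

theorem eventually_eq_of_pow_eq_one {α : Type*} [TopologicalSpace α] {l : Filter α} {f : α → ℂ}
    {r : ℕ} (hr : r ≠ 0) {z : ℂ} (hf : Filter.Tendsto f l (𝓝 z)) (h : ∀ᶠ x in l, f x ^ r = 1) :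
    ∀ᶠ x in l, f x = z := by
  have hfin : {z : ℂ | z ^ r = 1}.Finite := by
    refine (Polynomial.nthRoots r (1 : ℂ)).toFinset.finite_toSet.subset fun z hz => ?_
    simpa [Polynomial.mem_nthRoots (Nat.pos_of_ne_zero hr)] using hz
  have h1 : ({z' : ℂ | z' ^ r = 1} \ {z})ᶜ ∈ 𝓝 z :=
    (hfin.subset Set.sdiff_subset).isClosed.isOpen_compl.mem_nhds (by simp)
  filter_upwards [hf h1, h] with x hx hx'
  by_contra hne
  exact hx ⟨hx', hne⟩

variable {X : Type*} [TopologicalSpace X] [ChartedSpace ℂ X] {r : ℕ} {M : Set X}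

namespace OrbiLineBundle

variable (S : OrbiLineBundle X r M)

/-- The coordinate on the fibre at `y` given by the trivialization at `y`. -/
noncomputable def fiberCoord (y : X) : S.fiber y ≃ₗ[ℂ] ℂ := S.triv y 0 y

/-- The coordinate of the local frame at `x` in the fibre at `y`. -/
noncomputable def frameCoeff (x : X) (t : ℂ) (y : X) : ℂ :=
  S.fiberCoord y ((S.triv x t y).symm 1)

theorem frameCoeff_ne_zero (x : X) (t : ℂ) (y : X) : S.frameCoeff x t y ≠ 0 := by
  simp [frameCoeff]

@[simp] theorem frameCoeff_self (x : X) : S.frameCoeff x 0 x = 1 := by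
  simp [frameCoeff, fiberCoord]

theorem fiberCoord_eq (x : X) (t : ℂ) (y : X) (v : S.fiber y) :
    S.fiberCoord y v = S.triv x t y v * S.frameCoeff x t y := by
  have : v = S.triv x t y v • (S.triv x t y).symm 1 := by
    apply (S.triv x t y).injective
    simp
  conv_lhs => rw [this]
  rw [map_smul, smul_eq_mul, frameCoeff]

theorem triv_eq (x : X) (t : ℂ) (y : X) (v : S.fiber y) :
    S.triv x t y v = S.fiberCoord y v / S.frameCoeff x t y := by
  rw [S.fiberCoord_eq x t y, mul_div_cancel_right₀ _ (S.frameCoeff_ne_zero x t y)]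

theorem triv_symm_eq (x : X) (t : ℂ) (y : X) :
    (S.triv x t y).symm 1 = S.frameCoeff x t y • (S.fiberCoord y).symm 1 := by
  apply (S.fiberCoord y).injective
  simp [frameCoeff]

theorem eq_smul (y : X) (v : S.fiber y) : v = S.fiberCoord y v • (S.fiberCoord y).symm 1 := by
  apply (S.fiberCoord y).injective
  simp

theorem tpow_smul {y : X} (c : ℂ) (v : S.fiber y) : S.tpow (c • v) = c ^ r • S.tpow v := by
  have := (PiTensorProduct.tprod ℂ (s := fun _ : Fin r => S.fiber y)).map_smul_univ
    (fun _ => c) (fun _ => v)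
  simpa [tpow] using this

theorem frameCoeff_equivariant (x : X) : ∀ᶠ t in 𝓝[≠] (0 : ℂ), ∀ ζ : ℂ,
    ζ ^ isotropy r M x = 1 → S.frameCoeff x t (orbiChart r M x t) =
      ζ ^ S.mult x * S.frameCoeff x (ζ * t) (orbiChart r M x t) := by
  filter_upwards [S.equivariant x] with t ht ζ hζ
  have h1 := ht ζ hζ ((S.fiberCoord _).symm 1)
  rw [S.triv_eq, S.triv_eq, LinearEquiv.apply_symm_apply] at h1
  have h2 := S.frameCoeff_ne_zero x t (orbiChart r M x t)
  have h3 := S.frameCoeff_ne_zero x (ζ * t) (orbiChart r M x t)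
  field_simp at h1
  rw [h1, mul_comm]

/-- The transition functions are continuous. -/
theorem continuousAt_frameCoeff_div (x : X) : ∀ᶠ t₀ in 𝓝[≠] (0 : ℂ), ContinuousAt (fun t =>
    S.frameCoeff x t (orbiChart r M x t) / S.frameCoeff (orbiChart r M x t₀)
      (coord (orbiChart r M x t₀) (orbiChart r M x t)) (orbiChart r M x t)) t₀ := by
  filter_upwards [S.compatible x] with t₀ h
  refine h.continuousAt.congr (Filter.Eventually.of_forall fun t => ?_)
  simp only []
  rw [S.triv_eq]
  rfl

end OrbiLineBundle

namespace TwistedSpinBundle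

variable (S S' S'' : TwistedSpinBundle X r M)

/-- The coefficient of `τ` in the local frame at `x`. -/
noncomputable def coeff (x : X) : ℂ → ℂ := Classical.choose (S.τ_iso x)

theorem analyticAt_coeff (x : X) : AnalyticAt ℂ (S.coeff x) 0 :=
  (Classical.choose_spec (S.τ_iso x)).1

theorem coeff_zero (x : X) : S.coeff x 0 = S.leadCoeff x := rfl

theorem leadCoeff_ne_zero (x : X) : S.leadCoeff x ≠ 0 :=
  (Classical.choose_spec (S.τ_iso x)).2.1

theorem τ_frame (x : X) : ∀ᶠ t in 𝓝 (0 : ℂ), ∀ y, y = orbiChart r M x t → ∀ h : y ∉ M,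
    S.τ y h (S.tpow ((S.triv x t y).symm 1)) =
      (S.coeff x t * (t ^ isotropy r M x) ^ logOrder r M S.I₀ x) • dz x y := by
  filter_upwards [(Classical.choose_spec (S.τ_iso x)).2.2] with t ht y hy h
  subst hy
  exact ht h

theorem logOrder_eq_zero {x : X} (hx : x ∉ M) : logOrder r M S.I₀ x = 0 := by
  have : x ∉ S.I₀ := fun h => hx (S.I₀_subset h).1
  simp [logOrder, this, hx]

theorem τ_tpow {x : X} (hx : x ∉ M) (v : S.fiber x) :
    S.τ x hx (S.tpow v) = (S.fiberCoord x v ^ r * S.leadCoeff x) • dz x x := by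
  have h1 := (S.τ_frame x).self_of_nhds x
    (by simp [orbiChart, isotropy_of_notMem hx]) hx
  rw [S.logOrder_eq_zero hx, zpow_zero, mul_one, coeff_zero, S.triv_symm_eq, S.frameCoeff_self,
    one_smul] at h1
  conv_lhs => rw [S.eq_smul x v, S.tpow_smul, map_smul, h1]
  rw [mul_smul]

theorem frameCoeff_pow (x : X) : ∀ᶠ t in 𝓝 (0 : ℂ), ∀ y, y = orbiChart r M x t → y ∉ M →
    (S.frameCoeff x t y ^ r * S.leadCoeff y) • dz y y =
      (S.coeff x t * (t ^ isotropy r M x) ^ logOrder r M S.I₀ x) • dz x y := by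
  filter_upwards [S.τ_frame x] with t ht y hy h
  rw [← ht y hy h, S.τ_tpow]
  rfl

/-- The scalar by which an isomorphism acts on the fibres. -/
noncomputable def Iso.scalar {S S' : TwistedSpinBundle X r M} (f : Iso S S') (y : X) : ℂ :=
  S'.fiberCoord y (f.toEquiv y ((S.fiberCoord y).symm 1))

variable {S S' S''}

theorem Iso.fiberCoord_apply (f : Iso S S') (y : X) (v : S.fiber y) :
    S'.fiberCoord y (f.toEquiv y v) = f.scalar y * S.fiberCoord y v := by
  conv_lhs => rw [S.eq_smul y v]
  rw [map_smul, map_smul, smul_eq_mul, mul_comm, Iso.scalar]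

theorem Iso.scalar_ne_zero (f : Iso S S') (y : X) : f.scalar y ≠ 0 := by simp [Iso.scalar]

theorem Iso.analyticAt_scalar (f : Iso S S') (x : X) : AnalyticAt ℂ (fun t =>
    f.scalar (orbiChart r M x t) * (S.frameCoeff x t (orbiChart r M x t) /
      S'.frameCoeff x t (orbiChart r M x t))) 0 := by
  refine (f.holomorphic x).congr (Filter.Eventually.of_forall fun t => ?_)
  simp only []
  rw [S'.triv_eq, f.fiberCoord_apply, mul_div_assoc]
  rfl

variable [IsManifold 𝓘(ℂ, ℂ) ω X]

theorem Iso.scalar_pow (f : Iso S S') {y : X} (hy : y ∉ M) :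
    f.scalar y ^ r * S'.leadCoeff y = S.leadCoeff y := by
  have h1 := f.comm_τ y hy ((S.fiberCoord y).symm 1)
  rw [τ_tpow, τ_tpow] at h1
  simpa [Iso.scalar] using smul_dz_inj (mem_chart_source ℂ y) h1

/-- An isomorphism given by scalars. -/
noncomputable def Iso.ofScalar (l : X → ℂ) (hl : ∀ y, l y ≠ 0)
    (hol : ∀ x, AnalyticAt ℂ (fun t => l (orbiChart r M x t) *
      (S.frameCoeff x t (orbiChart r M x t) / S'.frameCoeff x t (orbiChart r M x t))) 0)
    (hτ : ∀ y, y ∉ M → l y ^ r * S'.leadCoeff y = S.leadCoeff y) : Iso S S' where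
  toEquiv y := (S.fiberCoord y).trans
    ((LinearEquiv.smulOfNeZero ℂ ℂ (l y) (hl y)).trans (S'.fiberCoord y).symm)
  holomorphic x := by
    refine (hol x).congr (Filter.Eventually.of_forall fun t => ?_)
    simp only []
    rw [S'.triv_eq, ← mul_div_assoc]
    simp [OrbiLineBundle.frame, OrbiLineBundle.frameCoeff]
  comm_τ x hx v := by
    rw [τ_tpow, τ_tpow, ← hτ x hx]
    simp [mul_pow]
    ring_nf

@[simp] theorem Iso.ofScalar_scalar (l : X → ℂ) (hl hol hτ) (y : X) :
    (Iso.ofScalar (S := S) (S' := S') l hl hol hτ).scalar y = l y := by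
  simp [Iso.ofScalar, Iso.scalar]

/-- The inverse isomorphism. -/
noncomputable def Iso.symm (f : Iso S S') : Iso S' S :=
  Iso.ofScalar (fun y => (f.scalar y)⁻¹) (fun y => inv_ne_zero (f.scalar_ne_zero y))
    (fun x => by
      have h := (f.analyticAt_scalar x).inv
        (mul_ne_zero (f.scalar_ne_zero _) (div_ne_zero (S.frameCoeff_ne_zero _ _ _)
          (S'.frameCoeff_ne_zero _ _ _)))
      refine h.congr (Filter.Eventually.of_forall fun t => ?_)
      simp [mul_inv_rev, mul_comm])
    (fun y hy => by
      rw [← f.scalar_pow hy, inv_pow, inv_mul_cancel_left₀ (pow_ne_zero _ (f.scalar_ne_zero y))])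

/-- The composition of isomorphisms. -/
noncomputable def Iso.trans (f : Iso S S') (g : Iso S' S'') : Iso S S'' :=
  Iso.ofScalar (fun y => f.scalar y * g.scalar y)
    (fun y => mul_ne_zero (f.scalar_ne_zero y) (g.scalar_ne_zero y))
    (fun x => by
      refine ((f.analyticAt_scalar x).mul (g.analyticAt_scalar x)).congr
        (Filter.Eventually.of_forall fun t => ?_)
      have := S'.frameCoeff_ne_zero x t (orbiChart r M x t)
      simp only [Pi.mul_apply]
      field_simp)
    (fun y hy => by rw [← f.scalar_pow hy, ← g.scalar_pow hy]; ring)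

/-- Scaling an isomorphism by a root of unity. -/
noncomputable def Iso.rescale (f : Iso S S') (ζ : ℂ) (hr : r ≠ 0) (hζ : ζ ^ r = 1) : Iso S S' :=
  Iso.ofScalar (fun y => ζ * f.scalar y)
    (fun y => mul_ne_zero (by rintro rfl; simp [hr] at hζ) (f.scalar_ne_zero y))
    (fun x => by simpa only [mul_assoc, Pi.mul_apply] using!
        (analyticAt_const (v := ζ)).mul (f.analyticAt_scalar x))
    (fun y hy => by rw [mul_pow, hζ, one_mul, f.scalar_pow hy])

variable (S) in
/-- The identity. -/
noncomputable def Iso.refl : Iso S S :=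
  Iso.ofScalar (fun _ => 1) (fun _ => one_ne_zero)
    (fun x => by
      refine (analyticAt_const (v := (1 : ℂ))).congr (Filter.Eventually.of_forall fun t => ?_)
      simp [div_self (S.frameCoeff_ne_zero x t (orbiChart r M x t))])
    (fun y hy => by simp)

theorem Iso.continuous_scalar (hr : r ≠ 0) (f : Iso S S) : Continuous f.scalar := by
  refine continuous_iff_continuousAt.2 fun x => ?_
  rw [ContinuousAt, ← map_orbiChart (M := M) hr x, Filter.tendsto_map'_iff]
  have h := (f.analyticAt_scalar x).continuousAt
  rw [ContinuousAt] at h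
  simpa [div_self (S.frameCoeff_ne_zero _ _ _), orbiChart_zero hr, Function.comp_def] using h

/-- An automorphism of a twisted spin bundle is multiplication by a root of unity. -/
theorem Iso.exists_scalar [PreconnectedSpace X] [T1Space X] [Nonempty X] (hM : M.Finite)
    (hr : r ≠ 0) (f : Iso S S) : ∃ ζ : ℂ, ζ ^ r = 1 ∧ ∀ y, f.scalar y = ζ := by
  have h1 : ∀ y, f.scalar y ^ r = 1 := by
    intro y
    have h2 : Filter.Tendsto (fun y => f.scalar y ^ r) (𝓝[≠] y) (𝓝 (f.scalar y ^ r)) :=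
      (((f.continuous_scalar hr).pow r).tendsto y).mono_left nhdsWithin_le_nhds
    have h3 : Filter.Tendsto (fun y => f.scalar y ^ r) (𝓝[≠] y) (𝓝 1) := by
      refine tendsto_const_nhds.congr' ?_
      filter_upwards [eventually_notMem hM y] with y' hy'
      have := f.scalar_pow hy'
      exact (mul_right_cancel₀ (S.leadCoeff_ne_zero y') (this.trans (one_mul _).symm)).symm
    have := nhdsNE_neBot y
    exact tendsto_nhds_unique h2 h3
  obtain ⟨x₀⟩ := ‹Nonempty X›
  refine ⟨f.scalar x₀, h1 x₀, fun y => ?_⟩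
  have hloc : IsLocallyConstant f.scalar := by
    rw [IsLocallyConstant.iff_eventually_eq]
    intro x
    exact eventually_eq_of_pow_eq_one hr ((f.continuous_scalar hr).tendsto x)
      (Filter.Eventually.of_forall h1)
  exact hloc.apply_eq_of_preconnectedSpace y x₀

theorem Iso.apply_eq_smul {f : Iso S S} {y : X} {ζ : ℂ} (h : f.scalar y = ζ) (v : S.fiber y) :
    f.toEquiv y v = ζ • v := by
  apply (S.fiberCoord y).injective
  rw [f.fiberCoord_apply, h, map_smul, smul_eq_mul]

end TwistedSpinBundle
end RSpin

namespace RSpin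

set_option linter.unusedSectionVars false

/-! ### Uniqueness of twisted spin bundles -/

namespace TwistedSpinBundle

variable {X : Type*} [TopologicalSpace X] [ChartedSpace ℂ X] [IsManifold 𝓘(ℂ, ℂ) ω X]
  {r : ℕ} {M : Set X} {S S' : TwistedSpinBundle X r M}

/-- The quotient of the local frames at `x` of two bundles. -/
noncomputable def frameQuot (S S' : TwistedSpinBundle X r M) (x : X) (t : ℂ) (y : X) : ℂ :=
  S'.frameCoeff x t y / S.frameCoeff x t y

theorem frameQuot_ne_zero (x : X) (t : ℂ) (y : X) : frameQuot S S' x t y ≠ 0 :=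
  div_ne_zero (S'.frameCoeff_ne_zero _ _ _) (S.frameCoeff_ne_zero _ _ _)

@[simp] theorem frameQuot_self (x : X) : frameQuot S S' x 0 x = 1 := by simp [frameQuot]

theorem frameQuot_pow (hr : r ≠ 0) (hI : S.I₀ = S'.I₀) (x : X) :
    ∀ᶠ t in 𝓝 (0 : ℂ), orbiChart r M x t ∉ M →
      frameQuot S S' x t (orbiChart r M x t) ^ r * (S.coeff x t / S'.coeff x t) =
        S.leadCoeff (orbiChart r M x t) / S'.leadCoeff (orbiChart r M x t) := by
  filter_upwards [S.frameCoeff_pow x, S'.frameCoeff_pow x, eventually_inDomain (M := M) hr x,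
    (S'.analyticAt_coeff x).continuousAt.eventually_ne (S'.leadCoeff_ne_zero x)]
    with t h1 h2 h3 h4 h5
  replace h1 := h1 _ rfl h5
  replace h2 := h2 _ rfl h5
  rw [← hI] at h2
  set y := orbiChart r M x t
  set N := (t ^ isotropy r M x) ^ logOrder r M S.I₀ x
  have hN : N ≠ 0 := by
    by_cases ht : t = 0
    · have hx : x ∉ M := by
        have : y = x := (h3.orbiChart_eq_iff hr).2 ht
        rwa [this] at h5
      simp only [N, S.logOrder_eq_zero hx, zpow_zero, ne_eq, one_ne_zero, not_false_eq_true]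
    · exact zpow_ne_zero _ (pow_ne_zero _ ht)
  obtain ⟨c, hc⟩ := exists_smul_dz (mem_chart_source ℂ y) (dz x y)
  rw [hc, smul_smul] at h1 h2
  have h6 := smul_dz_inj (mem_chart_source ℂ y) h1
  have h7 := smul_dz_inj (mem_chart_source ℂ y) h2
  have hc0 : c ≠ 0 := by
    rintro rfl
    exact dz_ne_zero h3.mem_source (by rw [hc]; exact zero_smul ℂ (dz y y))
  have a1 := S.leadCoeff_ne_zero y
  have a2 := S'.leadCoeff_ne_zero y
  have a3 := S.frameCoeff_ne_zero x t y
  have a4 := S'.frameCoeff_ne_zero x t y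
  rw [frameQuot, div_pow, div_mul_div_comm, div_eq_div_iff
    (mul_ne_zero (pow_ne_zero _ a3) h4) a2]
  have e1 : S.coeff x t = S.frameCoeff x t y ^ r * S.leadCoeff y / (N * c) := by
    rw [h6]; field_simp
  have e2 : S'.coeff x t = S'.frameCoeff x t y ^ r * S'.leadCoeff y / (N * c) := by
    rw [h7]; field_simp
  rw [e1, e2]
  ring

theorem frameQuot_equivariant (hm : S.mult = S'.mult) (x : X) :
    ∀ᶠ t in 𝓝[≠] (0 : ℂ), ∀ ζ : ℂ, ζ ^ isotropy r M x = 1 →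
      frameQuot S S' x (ζ * t) (orbiChart r M x t) =
        frameQuot S S' x t (orbiChart r M x t) := by
  filter_upwards [S.frameCoeff_equivariant x, S'.frameCoeff_equivariant x, self_mem_nhdsWithin]
    with t h1 h2 ht ζ hζ
  rw [frameQuot, frameQuot, h1 ζ hζ, h2 ζ hζ, hm, mul_div_mul_left]
  refine pow_ne_zero _ ?_
  rintro rfl
  by_cases h : isotropy r M x = 0
  · have := S.mult_lt x
    omega
  · simp [h] at hζ

theorem continuousAt_frameQuot_div (x : X) : ∀ᶠ t₀ in 𝓝[≠] (0 : ℂ), ContinuousAt (fun t =>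
    frameQuot S S' x t (orbiChart r M x t) / frameQuot S S' (orbiChart r M x t₀)
      (coord (orbiChart r M x t₀) (orbiChart r M x t)) (orbiChart r M x t)) t₀ := by
  filter_upwards [S.continuousAt_frameCoeff_div x, S'.continuousAt_frameCoeff_div x] with t₀ h1 h2
  refine (h2.div h1 (div_ne_zero (S.frameCoeff_ne_zero _ _ _) (S.frameCoeff_ne_zero _ _ _))).congr
    (Filter.Eventually.of_forall fun t => ?_)
  simp only [frameQuot, Pi.div_apply]
  rw [div_div_div_comm]

/-- Near every point there is an isomorphism, given by scalars `v`. -/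
theorem exists_local_iso [T1Space X] (hr : r ≠ 0) (hM : M.Finite) (hm : S.mult = S'.mult)
    (hI : S.I₀ = S'.I₀) (x : X) : ∃ (v : X → ℂ) (q : ℂ → ℂ), AnalyticAt ℂ q 0 ∧ q 0 ≠ 0 ∧
      (∀ᶠ t in 𝓝 0, v (orbiChart r M x t) = q t * frameQuot S S' x t (orbiChart r M x t)) ∧
      ∀ᶠ y in 𝓝 x, y ∉ M → v y ^ r = S.leadCoeff y / S'.leadCoeff y := by
  set h : ℂ → ℂ := fun t => S.coeff x t / S'.coeff x t
  have hh : AnalyticAt ℂ h 0 :=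
    (S.analyticAt_coeff x).div (S'.analyticAt_coeff x) (S'.leadCoeff_ne_zero x)
  have hh0 : h 0 ≠ 0 := div_ne_zero (S.leadCoeff_ne_zero x) (S'.leadCoeff_ne_zero x)
  obtain ⟨ρ, hρ, hρ0, hρr⟩ := exists_analytic_root hr hh0
  obtain ⟨N, hN, hN'⟩ := ((eventually_inDomain (M := M) hr x).and ((frameQuot_pow hr hI x).and
    ((hh.continuousAt.eventually_ne hh0).and ((eventually_nhdsWithin_iff.1
      (frameQuot_equivariant (S := S) (S' := S') hm x)).and (eventually_nhdsWithin_iff.1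
        ((tendsto_punctured_orbiChart (M := M) hr x).eventually (eventually_notMem hM x))))))).exists_mem
  have key : ∀ t ∈ N, ∀ t' ∈ N, orbiChart r M x t = orbiChart r M x t' →
      ρ (h t') * frameQuot S S' x t' (orbiChart r M x t') =
      ρ (h t) * frameQuot S S' x t (orbiChart r M x t) := by
    intro t ht t' ht' heq
    obtain ⟨a1, a2, a3, a4, a5⟩ := hN' t ht
    obtain ⟨b1, b2, b3, b4, b5⟩ := hN' t' ht'
    by_cases h0 : t = 0
    · have h1 : t' = 0 := by
        rw [← b1.orbiChart_eq_iff hr, ← heq, a1.orbiChart_eq_iff hr]; exact h0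
      rw [h0, h1]
    · obtain ⟨ζ, hζ, rfl⟩ := a1.exists_root b1 heq h0
      have h1 := a4 h0 ζ hζ
      have h2 := a2 (a5 h0)
      have h3 := b2 (heq ▸ a5 h0)
      rw [← heq] at h3 ⊢
      rw [h1] at h3 ⊢
      have h4 : h (ζ * t) = h t :=
        mul_left_cancel₀ (pow_ne_zero r (frameQuot_ne_zero x t (orbiChart r M x t)))
          (h3.trans h2.symm)
      rw [h4]
  classical
  set v : X → ℂ := fun y => if hy : ∃ t ∈ N, orbiChart r M x t = y then
    ρ (h hy.choose) * frameQuot S S' x hy.choose y else 0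
  have hv : ∀ t ∈ N, v (orbiChart r M x t) = ρ (h t) * frameQuot S S' x t (orbiChart r M x t) := by
    intro t ht
    have hy : ∃ t' ∈ N, orbiChart r M x t' = orbiChart r M x t := ⟨t, ht, rfl⟩
    simp only [v, dif_pos hy]
    have := key t ht _ hy.choose_spec.1 hy.choose_spec.2.symm
    rw [hy.choose_spec.2] at this
    exact this
  refine ⟨v, fun t => ρ (h t), hρ.comp hh, hρ0, Filter.mem_of_superset hN hv, ?_⟩
  rw [← eventually_orbiChart_iff (M := M) hr]
  filter_upwards [hN] with t ht hM'
  obtain ⟨a1, a2, a3, -, -⟩ := hN' t ht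
  rw [hv t ht, mul_pow, hρr _ a3, mul_comm]
  exact a2 hM'

/-- Two twisted spin bundles with the same multiplicities are isomorphic, on a surface on which
torsors under finite groups are trivial. -/
theorem nonempty_iso [T1Space X] (hr : r ≠ 0) (hM : M.Finite) (hm : S.mult = S'.mult)
    (hI : S.I₀ = S'.I₀) (hX : ∀ c : X → X → rootsOfUnity r ℂ, IsLocalFamily c →
      ∃ s : X → rootsOfUnity r ℂ, ∀ x, IsSectionAt c s x) : Nonempty (Iso S S') := by
  choose v q hq hq0 hvq hvr using exists_local_iso hr hM hm hI
  have : NeZero r := ⟨hr⟩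
  have hvx : ∀ x, v x x = q x 0 := fun x => by
    have := (hvq x).self_of_nhds
    rwa [orbiChart_zero hr, frameQuot_self, mul_one] at this
  have hvx0 : ∀ x, v x x ≠ 0 := fun x => by rw [hvx]; exact hq0 x
  have hvself : ∀ y, y ∉ M → v y y ^ r = S.leadCoeff y / S'.leadCoeff y :=
    fun y hy => (hvr y).self_of_nhds hy
  have hpow : ∀ x, ∀ᶠ y in 𝓝 x, (v x y / v y y) ^ r = 1 := by
    intro x
    filter_upwards [hvr x, eventually_nhdsWithin_iff.1 (eventually_notMem hM x)] with y h1 h2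
    by_cases hy : y = x
    · subst hy; simp [div_self (hvx0 y)]
    · rw [div_pow, h1 (h2 hy), hvself y (h2 hy), div_self]
      exact div_ne_zero (S.leadCoeff_ne_zero y) (S'.leadCoeff_ne_zero y)
  classical
  set c : X → X → rootsOfUnity r ℂ := fun x y =>
    if h : (v x y / v y y) ^ r = 1 then rootsOfUnity.mkOfPowEq _ h else 1
  have hc : ∀ x y, (v x y / v y y) ^ r = 1 → ((c x y : ℂˣ) : ℂ) = v x y / v y y := by
    intro x y h
    simp only [c, dif_pos h, rootsOfUnity.coe_mkOfPowEq]
  have hfam : IsLocalFamily c := by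
    intro x
    have hmain : ∀ᶠ t₀ in 𝓝 (0 : ℂ), t₀ ≠ 0 → ∃ k, ∀ᶠ y' in 𝓝 (orbiChart r M x t₀),
        c x y' = k * c (orbiChart r M x t₀) y' := by
      filter_upwards [(hvq x).eventually_nhds, (hq x).eventually_analyticAt,
        eventually_inDomain (M := M) hr x, (eventually_orbiChart_iff (M := M) hr).2
          (hpow x).eventually_nhds,
        eventually_nhdsWithin_iff.1 (continuousAt_frameQuot_div (S := S) (S' := S') x),
        eventually_nhdsWithin_iff.1 ((tendsto_punctured_orbiChart (M := M) hr x).eventually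
          (eventually_notMem hM x))]
        with t₀ h1 h2 h3 h4 h5 h6 h0
      replace h5 := h5 h0
      replace h6 := h6 h0
      set y₀ := orbiChart r M x t₀
      have hcoord : Filter.Tendsto (fun t => coord y₀ (orbiChart r M x t)) (𝓝 t₀) (𝓝 0) :=
        (tendsto_coord y₀).comp h3.continuousAt
      have hlim : ContinuousAt (fun t => q x t / q y₀ (coord y₀ (orbiChart r M x t)) *
          (frameQuot S S' x t (orbiChart r M x t) / frameQuot S S' y₀
            (coord y₀ (orbiChart r M x t)) (orbiChart r M x t))) t₀ := by
        refine (h2.continuousAt.div ?_ ?_).mul h5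
        · have := (hq y₀).continuousAt.tendsto.comp hcoord
          rw [ContinuousAt]
          simpa [y₀, Function.comp_def] using this
        · simpa [y₀] using hq0 y₀
      have heq : ∀ᶠ t in 𝓝 t₀, v x (orbiChart r M x t) / v y₀ (orbiChart r M x t) =
          q x t / q y₀ (coord y₀ (orbiChart r M x t)) *
          (frameQuot S S' x t (orbiChart r M x t) / frameQuot S S' y₀
            (coord y₀ (orbiChart r M x t)) (orbiChart r M x t)) := by
        filter_upwards [h1, hcoord.eventually (hvq y₀),
          h3.continuousAt.eventually (eventually_mem_source y₀)] with t b1 b2 b3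
        rw [orbiChart_coord h6 b3] at b2
        rw [b1, b2, mul_div_mul_comm]
      have hpow' : ∀ᶠ y in 𝓝 y₀, (v x y / v y₀ y) ^ r = 1 := by
        filter_upwards [h4, hpow y₀] with y b1 b2
        have b3 : v y₀ y ≠ 0 := by
          intro b4
          rw [b4, zero_div, zero_pow hr] at b2
          exact zero_ne_one b2
        have : v x y / v y₀ y = (v x y / v y y) / (v y₀ y / v y y) :=
          (div_div_div_cancel_right₀ (hvx0 y) _ _).symm
        rw [this, div_pow, b1, b2, div_one]
      have hconst : ∀ᶠ t in 𝓝 t₀, v x (orbiChart r M x t) / v y₀ (orbiChart r M x t) =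
          v x y₀ / v y₀ y₀ := by
        refine eventually_eq_of_pow_eq_one hr ?_ (h3.continuousAt.eventually hpow')
        have := hlim.tendsto
        rw [← heq.self_of_nhds] at this
        exact this.congr' (heq.mono fun t ht => ht.symm)
      have hconst' : ∀ᶠ y in 𝓝 y₀, v x y / v y₀ y = v x y₀ / v y₀ y₀ := by
        have := h3.map_nhds hr
        rw [← this, Filter.eventually_map]
        exact hconst
      refine ⟨c x y₀, ?_⟩
      filter_upwards [hconst', h4, hpow y₀] with y b1 b2 b3
      have b4 := h4.self_of_nhds
      rw [← Subtype.coe_inj, ← Units.val_inj]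
      push_cast
      rw [hc _ _ b2, hc _ _ b3, hc _ _ b4, ← b1]
      have b5 : v y₀ y ≠ 0 := by
        intro b4
        rw [b4, zero_div, zero_pow hr] at b3
        exact zero_ne_one b3
      field_simp
    have := (eventually_orbiChart_iff (M := M) hr (x := x) (p := fun y => y ≠ x →
      ∃ k, ∀ᶠ y' in 𝓝 y, c x y' = k * c y y')).1 (by
        filter_upwards [hmain] with t ht hne
        refine ht ?_
        rintro rfl
        exact hne (orbiChart_zero hr x))
    filter_upwards [this] with y hy
    by_cases hxy : y = x
    · subst hxy; exact ⟨1, by simp⟩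
    · exact hy hxy
  obtain ⟨s, hs⟩ := hX c hfam
  have hsr : ∀ y, ((s y : ℂˣ) : ℂ) ^ r = 1 := fun y => by
    have := (s y).2
    rw [mem_rootsOfUnity] at this
    rw [← Units.val_pow_eq_pow_val, this, Units.val_one]
  refine ⟨Iso.ofScalar (fun y => ((s y : ℂˣ) : ℂ) * v y y)
    (fun y => mul_ne_zero (Units.ne_zero _) (hvx0 y)) (fun x => ?_) (fun y hy => ?_)⟩
  · obtain ⟨k, hk⟩ := hs x
    refine ((analyticAt_const (v := ((k : ℂˣ) : ℂ))).mul (hq x)).congr ?_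
    filter_upwards [(eventually_orbiChart_iff (M := M) hr).2 hk, hvq x,
      (eventually_orbiChart_iff (M := M) hr).2 (hpow x)] with t h1 h2 h3
    have e : S.frameCoeff x t (orbiChart r M x t) / S'.frameCoeff x t (orbiChart r M x t) =
      (frameQuot S S' x t (orbiChart r M x t))⁻¹ := by rw [frameQuot, inv_div]
    rw [h1, e]
    push_cast
    rw [hc _ _ h3, h2]
    have a1 := hvx0 (orbiChart r M x t)
    have a2 := frameQuot_ne_zero (S := S) (S' := S') x t (orbiChart r M x t)
    simp only [Pi.mul_apply]
    field_simp
  · rw [mul_pow, hsr, one_mul, hvself y hy, div_mul_cancel₀ _ (S'.leadCoeff_ne_zero y)]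

end TwistedSpinBundle
end RSpin

namespace RSpin

set_option linter.unusedSectionVars false

/-! ### Global coordinates on the Riemann sphere -/

section Coordinates

variable {X : Type*} [TopologicalSpace X] [ChartedSpace ℂ X]

/-- `Z` is a coordinate on the sphere `X` with a simple pole at `p`; its value at the pole is `0` by
convention, so that `-(Z)⁻¹` is the coordinate at the pole. -/
structure IsCoord (p : X) (Z : X → ℂ) : Prop where
  pole : Z p = 0
  mdiff : ∀ x, x ≠ p → MDifferentiableAt 𝓘(ℂ, ℂ) 𝓘(ℂ, ℂ) Z x
  mdiff_inv : MDifferentiableAt 𝓘(ℂ, ℂ) 𝓘(ℂ, ℂ) (fun y => -(Z y)⁻¹) p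
  inj : ∀ x y, x ≠ p → y ≠ p → Z x = Z y → x = y
  surj : ∀ z, ∃ x, x ≠ p ∧ Z x = z

theorem mdifferentiableAt_comp {F : X → ℂ} {g : ℂ → ℂ} {x : X} (hg : DifferentiableAt ℂ g (F x))
    (hF : MDifferentiableAt 𝓘(ℂ, ℂ) 𝓘(ℂ, ℂ) F x) :
    MDifferentiableAt 𝓘(ℂ, ℂ) 𝓘(ℂ, ℂ) (fun y => g (F y)) x :=
  MDifferentiableAt.comp x (mdifferentiableAt_iff_differentiableAt.2 hg) hF

section Local

variable [IsManifold 𝓘(ℂ, ℂ) ω X]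

theorem analyticAt_inChart' {F : X → ℂ} {x y : X} (hy : y ∈ (chartAt ℂ x).source)
    (hF : ∀ᶠ y' in 𝓝 y, MDifferentiableAt 𝓘(ℂ, ℂ) 𝓘(ℂ, ℂ) F y') :
    AnalyticAt ℂ (inChart F x) (chartAt ℂ x y) := by
  rw [Complex.analyticAt_iff_eventually_differentiableAt]
  have h1 : Filter.Tendsto (chartAt ℂ x).symm (𝓝 (chartAt ℂ x y)) (𝓝 y) := by
    simpa [ContinuousAt, hy] using
      (chartAt ℂ x).continuousAt_symm ((chartAt ℂ x).map_source hy)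
  filter_upwards [h1.eventually hF, (chartAt ℂ x).open_target.mem_nhds
    ((chartAt ℂ x).map_source hy)] with s hs hs'
  have := differentiableAt_inChart ((chartAt ℂ x).map_target hs') hs
  rwa [(chartAt ℂ x).right_inv hs'] at this

theorem exists_injOn_inChart {F : X → ℂ} {x y : X} (hy : y ∈ (chartAt ℂ x).source)
    {U : Set X} (hU : U ∈ 𝓝 y) (hinj : Set.InjOn F U) :
    ∃ V ∈ 𝓝 (chartAt ℂ x y), Set.InjOn (inChart F x) V := by
  have h1 : Filter.Tendsto (chartAt ℂ x).symm (𝓝 (chartAt ℂ x y)) (𝓝 y) := by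
    simpa [ContinuousAt, hy] using
      (chartAt ℂ x).continuousAt_symm ((chartAt ℂ x).map_source hy)
  refine ⟨_, Filter.inter_mem (h1 hU) ((chartAt ℂ x).open_target.mem_nhds
    ((chartAt ℂ x).map_source hy)), ?_⟩
  rintro s ⟨hs, hs'⟩ s' ⟨hs1, hs1'⟩ h
  exact (chartAt ℂ x).symm.injOn hs' hs1' (hinj hs hs1 h)

/-- The derivative of an injective holomorphic function does not vanish. -/
theorem deriv_inChart_ne_zero {F : X → ℂ} {x y : X} (hy : y ∈ (chartAt ℂ x).source)
    (hF : ∀ᶠ y' in 𝓝 y, MDifferentiableAt 𝓘(ℂ, ℂ) 𝓘(ℂ, ℂ) F y')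
    {U : Set X} (hU : U ∈ 𝓝 y) (hinj : Set.InjOn F U) :
    deriv (inChart F x) (chartAt ℂ x y) ≠ 0 := by
  obtain ⟨V, hV, hV'⟩ := exists_injOn_inChart hy hU hinj
  exact deriv_ne_zero_of_injOn (analyticAt_inChart' hy hF) hV hV'

/-- Injective holomorphic functions are open. -/
theorem nhds_le_map_of_injOn_of_mdifferentiableAt {F : X → ℂ} {y : X}
    (hF : ∀ᶠ y' in 𝓝 y, MDifferentiableAt 𝓘(ℂ, ℂ) 𝓘(ℂ, ℂ) F y')
    {U : Set X} (hU : U ∈ 𝓝 y) (hinj : Set.InjOn F U) : 𝓝 (F y) ≤ Filter.map F (𝓝 y) := by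
  have hy := mem_chart_source ℂ y
  obtain ⟨V, hV, hV'⟩ := exists_injOn_inChart hy hU hinj
  have h1 := nhds_le_map_of_injOn (analyticAt_inChart' hy hF) hV hV'
  have h2 : inChart F y (chartAt ℂ y y) = F y := by simp [inChart]
  rw [h2] at h1
  have h3 : Filter.Tendsto (chartAt ℂ y).symm (𝓝 (chartAt ℂ y y)) (𝓝 y) := by
    simpa [ContinuousAt] using (chartAt ℂ y).continuousAt_symm (mem_chart_target ℂ y)
  refine h1.trans ?_
  rw [inChart, ← Filter.map_map]
  exact Filter.map_mono h3

end Local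

/-- On a Riemann sphere there is a coordinate. -/
theorem IsRiemannSphere.exists_coord (h : IsRiemannSphere X) : ∃ (p : X) (Z : X → ℂ),
    IsCoord p Z := by
  obtain ⟨f, h1, h2⟩ := h
  have hz : ∀ y, f y ≠ OnePoint.infty → (((f y).elim (0 : ℂ) (fun c => c) : ℂ) : OnePoint ℂ) = f y := by
    intro y hy
    obtain ⟨c, hc⟩ := OnePoint.ne_infty_iff_exists.1 hy
    rw [← hc]; rfl
  have hp : ∀ y, y ≠ f.symm OnePoint.infty → f y ≠ OnePoint.infty := by
    intro y hy h
    exact hy (by rw [← h, f.symm_apply_apply])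
  refine ⟨f.symm OnePoint.infty, fun y => (f y).elim (0 : ℂ) (fun c => c), ?_, ?_, ?_, ?_, ?_⟩
  · rw [f.apply_symm_apply]; rfl
  · exact fun x hx => h1 x (hp x hx)
  · have h3 := h2 (f.symm OnePoint.infty) (by rw [f.apply_symm_apply]; exact OnePoint.infty_ne_coe 0)
    have h4 : (fun y => -((f y).elim (0 : ℂ) (fun c => c))⁻¹) =
        fun y => -((f y).elim (0 : ℂ) (fun c => c⁻¹)) := by
      funext y
      induction f y using OnePoint.rec with
      | infty => simp
      | coe c => simp
    rw [h4]
    exact mdifferentiableAt_comp (g := fun z => -z) (by fun_prop) h3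
  · intro x y hx hy h
    apply f.injective
    rw [← hz x (hp x hx), ← hz y (hp y hy)]
    exact congrArg _ h
  · intro z
    refine ⟨f.symm (z : OnePoint ℂ), ?_, ?_⟩
    · intro h
      exact OnePoint.coe_ne_infty z (f.symm.injective h)
    · rw [f.apply_symm_apply]; rfl

theorem IsRiemannSphere.t2Space (h : IsRiemannSphere X) : T2Space X := by
  obtain ⟨f, -⟩ := h
  exact f.symm.t2Space

theorem IsRiemannSphere.connectedSpace (h : IsRiemannSphere X) : ConnectedSpace X := by
  obtain ⟨f, -⟩ := h
  exact f.symm.surjective.connectedSpace f.symm.continuous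

namespace IsCoord

variable [T1Space X] {p : X} {Z : X → ℂ}

theorem eventually_ne {x : X} (hx : x ≠ p) : ∀ᶠ y in 𝓝 x, y ≠ p :=
  isOpen_compl_singleton.mem_nhds hx

theorem eventually_mdiff (hZ : IsCoord p Z) {x : X} (hx : x ≠ p) :
    ∀ᶠ y in 𝓝 x, MDifferentiableAt 𝓘(ℂ, ℂ) 𝓘(ℂ, ℂ) Z y := by
  filter_upwards [eventually_ne hx] with y hy using hZ.mdiff y hy

theorem eventually_ne_zero (hZ : IsCoord p Z) : ∀ᶠ y in 𝓝 p, y ≠ p → Z y ≠ 0 := by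
  obtain ⟨x₀, hx₀, h0⟩ := hZ.surj 0
  filter_upwards [eventually_ne hx₀.symm] with y hy hyp hz
  exact hy (hZ.inj y x₀ hyp hx₀ (hz.trans h0.symm))

theorem eventually_mdiff_inv (hZ : IsCoord p Z) :
    ∀ᶠ y in 𝓝 p, MDifferentiableAt 𝓘(ℂ, ℂ) 𝓘(ℂ, ℂ) (fun y => -(Z y)⁻¹) y := by
  filter_upwards [hZ.eventually_ne_zero] with y hy
  by_cases hyp : y = p
  · subst hyp; exact hZ.mdiff_inv
  · exact mdifferentiableAt_comp (g := fun z => -(z)⁻¹)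
      ((differentiableAt_inv (hy hyp)).neg) (hZ.mdiff y hyp)

theorem inv_pole (hZ : IsCoord p Z) : -(Z p)⁻¹ = 0 := by simp [hZ.pole]

theorem exists_injOn_inv (hZ : IsCoord p Z) : ∃ U ∈ 𝓝 p, Set.InjOn (fun y => -(Z y)⁻¹) U := by
  refine ⟨_, hZ.eventually_ne_zero, ?_⟩
  intro y hy y' hy' h
  simp only [neg_inj, inv_inj] at h
  by_cases h1 : y = p
  · by_contra h2
    have h3 : y' ≠ p := fun h3 => h2 (h1.trans h3.symm)
    exact hy' h3 (by rw [← h, h1, hZ.pole])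
  · by_cases h2 : y' = p
    · exact (hy h1 (by rw [h, h2, hZ.pole])).elim
    · exact hZ.inj y y' h1 h2 h

theorem continuousAt (hZ : IsCoord p Z) {x : X} (hx : x ≠ p) : ContinuousAt Z x :=
  (hZ.mdiff x hx).continuousAt

theorem continuousAt_inv (hZ : IsCoord p Z) : ContinuousAt (fun y => -(Z y)⁻¹) p :=
  hZ.mdiff_inv.continuousAt

/-- The coordinate with a pole at another point. -/
theorem exists_pole (hZ : IsCoord p Z) (q : X) : ∃ Z', IsCoord q Z' := by
  classical
  by_cases hqp : q = p
  · exact ⟨Z, hqp ▸ hZ⟩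
  refine ⟨fun y => if y = p then 0 else (Z y - Z q)⁻¹, by simp, ?_, ?_, ?_, ?_⟩
  · intro x hx
    by_cases hxp : x = p
    · subst hxp
      have h1 : (fun y => if y = x then 0 else (Z y - Z q)⁻¹) =ᶠ[𝓝 x]
          fun y => (fun v => -v / (1 + Z q * v)) (-(Z y)⁻¹) := by
        filter_upwards [hZ.eventually_ne_zero] with y hy
        by_cases hyx : y = x
        · subst hyx; simp [hZ.pole]
        · have := hy hyx
          simp only [if_neg hyx]
          rw [neg_neg, mul_neg, ← sub_eq_add_neg, ← one_div, ← one_div, div_div]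
          congr 1
          field_simp
      refine (mdifferentiableAt_comp (g := fun v => -v / (1 + Z q * v)) ?_
        hZ.mdiff_inv).congr_of_eventuallyEq h1
      refine DifferentiableAt.div (by fun_prop) (by fun_prop) ?_
      simp [hZ.pole]
    · refine (mdifferentiableAt_comp (g := fun z => (z - Z q)⁻¹) ?_
        (hZ.mdiff x hxp)).congr_of_eventuallyEq ?_
      · refine DifferentiableAt.inv (by fun_prop) (sub_ne_zero.2 fun h => hx ?_)
        exact hZ.inj x q hxp hqp h
      · filter_upwards [eventually_ne hxp] with y hy
        simp [hy]
  · refine (mdifferentiableAt_comp (g := fun z => -(z - Z q)) (by fun_prop)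
      (hZ.mdiff q hqp)).congr_of_eventuallyEq ?_
    filter_upwards [eventually_ne hqp] with y hy
    simp [hy]
  · intro x y hx hy h
    split_ifs at h with h1 h2 h2
    · exact h1.trans h2.symm
    · rw [eq_comm, inv_eq_zero, sub_eq_zero] at h
      exact (hy (hZ.inj y q h2 hqp h)).elim
    · rw [inv_eq_zero, sub_eq_zero] at h
      exact (hx (hZ.inj x q h1 hqp h)).elim
    · rw [inv_inj, sub_left_inj] at h
      exact hZ.inj x y h1 h2 h
  · intro z
    by_cases hz : z = 0
    · exact ⟨p, fun h => hqp h.symm, by simp [hz]⟩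
    · obtain ⟨x, hx, hxz⟩ := hZ.surj (Z q + z⁻¹)
      refine ⟨x, ?_, by simp [hx, hxz]⟩
      rintro rfl
      simp [hz] at hxz

/-- An affine change of coordinate. -/
theorem exists_affine (hZ : IsCoord p Z) {a : ℂ} (ha : a ≠ 0) (b : ℂ) :
    ∃ Z', IsCoord p Z' ∧ ∀ y, y ≠ p → Z' y = a * Z y + b := by
  classical
  refine ⟨fun y => if y = p then 0 else a * Z y + b, ⟨by simp, ?_, ?_, ?_, ?_⟩, ?_⟩
  · intro x hx
    refine (mdifferentiableAt_comp (g := fun z => a * z + b) (by fun_prop)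
      (hZ.mdiff x hx)).congr_of_eventuallyEq ?_
    filter_upwards [eventually_ne hx] with y hy
    simp [hy]
  · have h1 : (fun y => -(if y = p then 0 else a * Z y + b)⁻¹) =ᶠ[𝓝 p]
        fun y => (fun v => v / (a - b * v)) (-(Z y)⁻¹) := by
      filter_upwards [hZ.eventually_ne_zero] with y hy
      by_cases hyx : y = p
      · subst hyx; simp [hZ.pole]
      · have := hy hyx
        simp only [if_neg hyx]
        have e : a - b * -(Z y)⁻¹ = (a * Z y + b) * (Z y)⁻¹ := by field_simp; ring
        rw [e, div_eq_mul_inv, mul_inv_rev, inv_inv, ← mul_assoc, neg_mul, inv_mul_cancel₀ this]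
        simp
    refine (mdifferentiableAt_comp (g := fun v => v / (a - b * v)) ?_
      hZ.mdiff_inv).congr_of_eventuallyEq h1
    refine DifferentiableAt.div (by fun_prop) (by fun_prop) ?_
    simpa [hZ.pole] using ha
  · intro x y hx hy h
    simp only [if_neg hx, if_neg hy, add_left_inj, mul_right_inj' ha] at h
    exact hZ.inj x y hx hy h
  · intro z
    obtain ⟨x, hx, hxz⟩ := hZ.surj ((z - b) / a)
    refine ⟨x, hx, ?_⟩
    simp only [if_neg hx, hxz]
    field_simp
    ring
  · intro y hy; simp [hy]

/-- The inverse of the coordinate. -/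
noncomputable def pt (hZ : IsCoord p Z) (z : ℂ) : X := (hZ.surj z).choose

theorem pt_ne (hZ : IsCoord p Z) (z : ℂ) : hZ.pt z ≠ p := (hZ.surj z).choose_spec.1

theorem apply_pt (hZ : IsCoord p Z) (z : ℂ) : Z (hZ.pt z) = z := (hZ.surj z).choose_spec.2

theorem pt_apply (hZ : IsCoord p Z) {x : X} (hx : x ≠ p) : hZ.pt (Z x) = x :=
  hZ.inj _ _ (hZ.pt_ne _) hx (hZ.apply_pt _)

theorem pt_injective (hZ : IsCoord p Z) : Function.Injective hZ.pt :=
  Function.LeftInverse.injective hZ.apply_pt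

variable [IsManifold 𝓘(ℂ, ℂ) ω X]

theorem nhds_le_map (hZ : IsCoord p Z) {x : X} (hx : x ≠ p) : 𝓝 (Z x) ≤ Filter.map Z (𝓝 x) :=
  nhds_le_map_of_injOn_of_mdifferentiableAt (hZ.eventually_mdiff hx) (eventually_ne hx)
    fun y hy y' hy' h => hZ.inj y y' hy hy' h

theorem nhds_le_map_inv (hZ : IsCoord p Z) :
    𝓝 (0 : ℂ) ≤ Filter.map (fun y => -(Z y)⁻¹) (𝓝 p) := by
  obtain ⟨U, hU, hinj⟩ := hZ.exists_injOn_inv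
  have := nhds_le_map_of_injOn_of_mdifferentiableAt hZ.eventually_mdiff_inv hU hinj
  rwa [hZ.inv_pole] at this

theorem deriv_ne_zero (hZ : IsCoord p Z) {x y : X} (hy : y ∈ (chartAt ℂ x).source) (hyp : y ≠ p) :
    deriv (inChart Z x) (chartAt ℂ x y) ≠ 0 :=
  deriv_inChart_ne_zero hy (hZ.eventually_mdiff hyp) (eventually_ne hyp)
    fun y hy y' hy' h => hZ.inj y y' hy hy' h

theorem deriv_inv_ne_zero (hZ : IsCoord p Z) :
    deriv (inChart (fun y => -(Z y)⁻¹) p) (chartAt ℂ p p) ≠ 0 := by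
  obtain ⟨U, hU, hinj⟩ := hZ.exists_injOn_inv
  exact deriv_inChart_ne_zero (mem_chart_source ℂ p) hZ.eventually_mdiff_inv hU hinj

theorem continuous_pt (hZ : IsCoord p Z) : Continuous hZ.pt := by
  refine continuous_iff_continuousAt.2 fun z => ?_
  have h1 := hZ.nhds_le_map (hZ.pt_ne z)
  rw [hZ.apply_pt] at h1
  intro U hU
  have h2 : Z '' (U ∩ {p}ᶜ) ∈ 𝓝 z :=
    h1 (Filter.image_mem_map (Filter.inter_mem hU (eventually_ne (hZ.pt_ne z))))
  rw [Filter.mem_map]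
  refine Filter.mem_of_superset h2 ?_
  rintro _ ⟨x, ⟨hx, hxp⟩, rfl⟩
  show hZ.pt (Z x) ∈ U
  rwa [hZ.pt_apply hxp]

/-- The complement of a finite set is connected. -/
theorem isPreconnected_compl (hZ : IsCoord p Z) {M : Set X} (hM : M.Finite) :
    IsPreconnected Mᶜ := by
  have h1 : IsPreconnected (hZ.pt '' (Z '' M)ᶜ) :=
    ((hM.image Z).countable.isConnected_compl_of_one_lt_rank
      (by simp)).isPreconnected.image _ hZ.continuous_pt.continuousOn
  have h2 : ∀ y, y ∉ M → y ∈ closure (hZ.pt '' (Z '' M)ᶜ) := by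
    intro y hy
    rw [mem_closure_iff_frequently]
    have := nhdsNE_neBot y
    have h3 : ∀ᶠ y' in 𝓝[≠] y, y' ∈ hZ.pt '' (Z '' M)ᶜ := by
      have h4 : (M ∪ ({hZ.pt (Z p)} ∪ {p})).Finite :=
        hM.union ((Set.finite_singleton _).union (Set.finite_singleton _))
      filter_upwards [eventually_notMem h4 y] with y' hy'
      simp only [Set.mem_union, Set.mem_singleton_iff, not_or] at hy'
      refine ⟨Z y', ?_, hZ.pt_apply hy'.2.2⟩
      rintro ⟨q, hq, hqy⟩
      by_cases hqp : q = p
      · subst hqp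
        exact hy'.2.1 (by rw [hqy, hZ.pt_apply hy'.2.2])
      · exact hy'.1 (hZ.inj q y' hqp hy'.2.2 hqy ▸ hq)
    exact h3.frequently.filter_mono nhdsWithin_le_nhds
  refine h1.subset_closure ?_ h2
  rintro _ ⟨z, hz, rfl⟩ hM'
  exact hz ⟨_, hM', hZ.apply_pt z⟩

/-- Torsors under discrete groups on a sphere have sections. -/
theorem exists_section (hZ : IsCoord p Z) {G : Type*} [Group G] (c : X → X → G)
    (hc : IsLocalFamily c) : ∃ s : X → G, ∀ x, IsSectionAt c s x := by
  classical
  have hc' : IsLocalFamily (fun z w => c (hZ.pt z) (hZ.pt w)) := by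
    intro z
    filter_upwards [hZ.continuous_pt.continuousAt.eventually (hc (hZ.pt z))] with w ⟨k, hk⟩
    exact ⟨k, hZ.continuous_pt.continuousAt.eventually hk⟩
  obtain ⟨s, hs⟩ := hc'.exists_section
  have h1 : ∀ x, x ≠ p → IsSectionAt c (fun y => s (Z y)) x := by
    intro x hx
    obtain ⟨k, hk⟩ := hs (Z x)
    refine ⟨k, ?_⟩
    filter_upwards [(hZ.continuousAt hx).eventually hk, eventually_ne hx] with y hy hyp
    rw [hy, hZ.pt_apply hx, hZ.pt_apply hyp]
  obtain ⟨ρ, hρ, hball⟩ := Metric.eventually_nhds_iff_ball.1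
    ((eventually_inDomain (r := 1) (M := ∅) one_ne_zero p).and
      ((eventually_orbiChart_iff (r := 1) (M := ∅) one_ne_zero).2 (hc p)))
  set U := orbiChart 1 ∅ p '' (Metric.ball (0 : ℂ) ρ \ {0})
  have hU : IsPreconnected U := by
    refine (isPreconnected_punctured_ball hρ).image _ fun t ht => ?_
    exact (hball t ht.1).1.continuousAt.continuousWithinAt
  have hUp : ∀ y ∈ U, y ≠ p := by
    rintro _ ⟨t, ht, rfl⟩ h
    exact ht.2 (((hball t ht.1).1.orbiChart_eq_iff one_ne_zero).1 h)
  obtain ⟨k, hk⟩ := IsSectionAt.exists_const (c := c) (s := fun y => s (Z y)) (s' := c p) hU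
    (fun y hy => h1 y (hUp y hy)) (by
      rintro _ ⟨t, ht, rfl⟩
      exact (hball t ht.1).2)
  refine ⟨Function.update (fun y => s (Z y)) p (k * c p p), fun x => ?_⟩
  by_cases hx : x = p
  · subst hx
    refine ⟨k, (eventually_orbiChart_iff (r := 1) (M := ∅) one_ne_zero).1 ?_⟩
    filter_upwards [Metric.ball_mem_nhds (0 : ℂ) hρ] with t ht
    by_cases h0 : t = 0
    · subst h0; rw [orbiChart_zero one_ne_zero]; simp
    · have h2 : orbiChart 1 ∅ x t ∈ U := ⟨t, ⟨ht, h0⟩, rfl⟩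
      rw [Function.update_of_ne (hUp _ h2)]
      exact hk _ h2
  · obtain ⟨k', hk'⟩ := h1 x hx
    refine ⟨k', ?_⟩
    filter_upwards [hk', eventually_ne hx] with y hy hyp
    rw [Function.update_of_ne hyp]
    exact hy

end IsCoord

end Coordinates
end RSpin

namespace RSpin

set_option linter.unusedSectionVars false

/-! ### Construction of twisted spin bundles -/

theorem exists_analytic_slope {F : ℂ → ℂ} {a : ℂ} (hF : AnalyticAt ℂ F a) :
    ∃ u : ℂ → ℂ, AnalyticAt ℂ u a ∧ u a = deriv F a ∧ ∀ s, F s - F a = (s - a) * u s := by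
  obtain ⟨q, hq⟩ := hF
  refine ⟨dslope F a, hq.has_fpower_series_dslope_fslope.analyticAt, dslope_same F a, fun s => ?_⟩
  rw [← smul_eq_mul, sub_smul_dslope]

theorem differential_eq_sq_smul {X : Type*} [TopologicalSpace X] [ChartedSpace ℂ X]
    [IsManifold 𝓘(ℂ, ℂ) ω X] {F : X → ℂ} {y : X} (hF : MDifferentiableAt 𝓘(ℂ, ℂ) 𝓘(ℂ, ℂ) F y)
    (hy : F y ≠ 0) :
    differential F y = (F y ^ 2) • differential (fun y => -(F y)⁻¹) y := by
  have h2 : MDifferentiableAt 𝓘(ℂ, ℂ) 𝓘(ℂ, ℂ) (fun y => -(F y)⁻¹) y :=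
    mdifferentiableAt_comp (g := fun z => -(z)⁻¹) ((differentiableAt_inv hy).neg) hF
  have hs := mem_chart_source ℂ y
  rw [differential_eq hs hF, differential_eq hs h2, smul_smul]
  congr 1
  have h3 := (differentiableAt_inChart hs hF).hasDerivAt
  have h4 : inChart F y (chartAt ℂ y y) = F y := by simp [inChart]
  have h5 := (h3.inv (by rwa [h4])).neg.deriv
  have h6 : inChart (fun y => -(F y)⁻¹) y = -(inChart F y)⁻¹ := rfl
  rw [h6, h5, h4]
  field_simp

/-- Data defining a twisted spin bundle: a coordinate on the sphere without pole in `M`, the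
twists `N` and the degree. -/
structure ModelData (X : Type*) [TopologicalSpace X] [ChartedSpace ℂ X] (r : ℕ) (M : Set X) where
  /-- the pole of the coordinate -/
  p : X
  /-- the coordinate -/
  Z : X → ℂ
  isCoord : IsCoord p Z
  two_le : 2 ≤ r
  finite : M.Finite
  notMem : p ∉ M
  /-- the twists -/
  N : X → ℤ
  neg_one_le : ∀ x ∈ M, -1 ≤ N x
  le_sub_one : ∀ x ∈ M, N x ≤ r - 1
  /-- the degree -/
  d : ℤ
  sum_eq : ∑ x ∈ finite.toFinset, N x + 2 = -(r * d)

namespace ModelData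

variable {X : Type*} [TopologicalSpace X] [ChartedSpace ℂ X] {r : ℕ} {M : Set X}
  (D : ModelData X r M)

theorem r_ne_zero (D : ModelData X r M) : r ≠ 0 := by have := D.two_le; omega

/-- The coordinate at the pole. -/
noncomputable def V (y : X) : ℂ := -(D.Z y)⁻¹

open Classical in
/-- The multiplicities. -/
noncomputable def mult (x : X) : ℕ :=
  if x ∈ M then (if D.N x = r - 1 then 0 else (D.N x + 1).toNat) else 0

open Classical in
/-- The global meromorphic section in the local frame at `x`. -/
noncomputable def preFactor (x : X) (t : ℂ) : ℂ :=
  if x ∈ M then t ^ D.mult x else if x = D.p then D.V (orbiChart r M x t) ^ D.d else 1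

open Classical in
/-- The global meromorphic section in the local frame at `x`, made nonzero everywhere. -/
noncomputable def factor (x : X) (t : ℂ) : ℂ :=
  if D.preFactor x t = 0 then 1 else D.preFactor x t

theorem factor_ne_zero (x : X) (t : ℂ) : D.factor x t ≠ 0 := by
  unfold factor; split_ifs <;> simp_all

theorem V_pole : D.V D.p = 0 := by simp [V, D.isCoord.pole]

theorem factor_zero (x : X) : D.factor x 0 = 1 := by
  unfold factor
  split_ifs with h
  · rfl
  · unfold preFactor at h ⊢
    split_ifs at h ⊢ with h1 h2
    · by_cases hm : D.mult x = 0
      · simp [hm]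
      · simp [hm] at h
    · rw [orbiChart_zero D.r_ne_zero] at h ⊢
      subst h2
      by_cases hd : D.d = 0
      · simp [hd]
      · simp [V_pole, zero_zpow _ hd] at h
    · rfl

theorem preFactor_of_mem {x : X} (hx : x ∈ M) (t : ℂ) : D.preFactor x t = t ^ D.mult x := by
  simp [preFactor, hx]

theorem factor_of_mem {x : X} (hx : x ∈ M) {t : ℂ} (ht : t ≠ 0) :
    D.factor x t = t ^ D.mult x := by
  simp [factor, D.preFactor_of_mem hx, ht]

theorem factor_of_notMem {x : X} (hx : x ∉ M) (hp : x ≠ D.p) (t : ℂ) : D.factor x t = 1 := by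
  simp [factor, preFactor, hx, hp]

theorem factor_pole {t : ℂ} (ht : D.V (orbiChart r M D.p t) ≠ 0) :
    D.factor D.p t = D.V (orbiChart r M D.p t) ^ D.d := by
  simp [factor, preFactor, D.notMem, zpow_ne_zero _ ht]

theorem mult_lt (x : X) : D.mult x < isotropy r M x := by
  have := D.two_le
  unfold mult isotropy
  split_ifs with h h1
  · omega
  · have := D.neg_one_le x h
    have := D.le_sub_one x h
    omega
  · omega

variable [T1Space X] [IsManifold 𝓘(ℂ, ℂ) ω X]

theorem eventually_V_ne_zero : ∀ᶠ t in 𝓝[≠] (0 : ℂ), D.V (orbiChart r M D.p t) ≠ 0 := by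
  have h1 : ∀ᶠ y in 𝓝[≠] D.p, D.V y ≠ 0 := by
    filter_upwards [nhdsWithin_le_nhds D.isCoord.eventually_ne_zero, self_mem_nhdsWithin]
      with y hy hy'
    exact neg_ne_zero.2 (inv_ne_zero (hy hy'))
  exact (tendsto_punctured_orbiChart D.r_ne_zero D.p).eventually h1

theorem analyticAt_V : AnalyticAt ℂ (fun t => D.V (orbiChart r M D.p t)) 0 :=
  analyticAt_comp_orbiChart D.r_ne_zero D.isCoord.eventually_mdiff_inv

theorem eventually_analyticAt_factor (x : X) :
    ∀ᶠ t in 𝓝[≠] (0 : ℂ), AnalyticAt ℂ (fun t => (D.factor x t)⁻¹) t := by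
  by_cases hx : x ∈ M
  · filter_upwards [self_mem_nhdsWithin] with t ht
    have : AnalyticAt ℂ (fun t => (t ^ D.mult x)⁻¹) t :=
      (analyticAt_id.pow _).inv (pow_ne_zero _ ht)
    refine this.congr ?_
    filter_upwards [eventually_ne_nhds ht] with t' ht'
    rw [D.factor_of_mem hx ht']
  · by_cases hp : x = D.p
    · subst hp
      filter_upwards [D.eventually_V_ne_zero, nhdsWithin_le_nhds D.analyticAt_V.eventually_analyticAt]
        with t h1 h2
      have h3 : AnalyticAt ℂ (fun t => (D.V (orbiChart r M D.p t) ^ D.d)⁻¹) t :=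
        (h2.zpow h1).inv (zpow_ne_zero _ h1)
      refine h3.congr ?_
      filter_upwards [h2.continuousAt.eventually_ne h1] with t' ht'
      rw [D.factor_pole ht']
    · refine Filter.Eventually.of_forall fun t => ?_
      simp only [D.factor_of_notMem hx hp]
      exact analyticAt_const

/-- The orbifold line bundle. -/
noncomputable def lineBundle : OrbiLineBundle X r M where
  fiber _ := ℂ
  triv x t _ := LinearEquiv.smulOfNeZero ℂ ℂ (D.factor x t) (D.factor_ne_zero x t)
  mult := D.mult
  mult_lt := D.mult_lt
  equivariant x := by
    filter_upwards [self_mem_nhdsWithin] with t ht ζ hζ v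
    show D.factor x (ζ * t) * v = ζ ^ D.mult x * (D.factor x t * v)
    rw [← mul_assoc]
    congr 1
    by_cases hx : x ∈ M
    · have hζ0 : ζ ≠ 0 := by
        rintro rfl
        simp [isotropy_ne_zero D.r_ne_zero] at hζ
      rw [D.factor_of_mem hx ht, D.factor_of_mem hx (mul_ne_zero hζ0 ht), mul_pow]
    · rw [isotropy_of_notMem hx, pow_one] at hζ
      simp [hζ]
  compatible x := by
    filter_upwards [D.eventually_analyticAt_factor x, (tendsto_punctured_orbiChart (r := r)
      (M := M) D.r_ne_zero x).eventually (eventually_notMem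
        (D.finite.union (Set.finite_singleton D.p)) x)] with t₀ h1 h2
    rw [Set.mem_union, Set.mem_singleton_iff, not_or] at h2
    refine h1.congr (Filter.Eventually.of_forall fun t => ?_)
    show _ = D.factor _ _ * ((D.factor x t)⁻¹ * 1)
    rw [D.factor_of_notMem h2.1 h2.2, one_mul, mul_one]

/-- The coefficient of the meromorphic differential. -/
noncomputable def E (y : X) : ℂ := ∏ q ∈ D.finite.toFinset, (D.Z y - D.Z q) ^ D.N q

/-- The sum of the twists. -/
noncomputable def sumN : ℤ := ∑ x ∈ D.finite.toFinset, D.N x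

open Classical in
/-- The image under `τ` of the `r`-th power of the generator of the fibre. -/
noncomputable def η (y : X) : Cotangent y :=
  if y = D.p then ((-1 : ℂ) ^ D.sumN) • differential D.V y
  else D.E y • differential D.Z y

theorem differential_V {y : X} (hy : y ≠ D.p) (hz : D.Z y ≠ 0) :
    differential D.Z y = (D.V y ^ (-2 : ℤ)) • differential D.V y := by
  rw [differential_eq_sq_smul (D.isCoord.mdiff y hy) hz]
  congr 1
  rw [V, zpow_neg, zpow_ofNat, neg_sq, inv_pow, inv_inv]

theorem E_eq {y : X} (hV : D.V y ≠ 0) :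
    D.E y = (-1) ^ D.sumN * (∏ q ∈ D.finite.toFinset, (1 + D.V y * D.Z q) ^ D.N q) *
      D.V y ^ (-D.sumN) := by
  have h1 : ∀ (a : ℂ), a ≠ 0 → ∏ q ∈ D.finite.toFinset, a ^ D.N q = a ^ D.sumN := by
    intro a ha
    rw [sumN]
    generalize D.finite.toFinset = P
    classical
    induction P using Finset.induction_on with
    | empty => simp
    | insert q P hq ih => rw [Finset.prod_insert hq, Finset.sum_insert hq, ih, zpow_add₀ ha]
  have hZ : D.Z y ≠ 0 := by
    intro h; simp [V, h] at hV
  rw [zpow_neg, ← inv_zpow, ← h1 (-1) (by simp), ← h1 _ (inv_ne_zero hV), ← Finset.prod_mul_distrib,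
    ← Finset.prod_mul_distrib, E]
  refine Finset.prod_congr rfl fun q _ => ?_
  rw [← mul_zpow, ← mul_zpow]
  congr 1
  rw [V]
  field_simp
  ring

theorem N_eq_mult_add {x : X} (hx : x ∈ M) :
    D.N x = D.mult x + logOrder r M {x | x ∈ M ∧ D.N x = r - 1} x := by
  classical
  have := D.two_le
  have h1 := D.neg_one_le x hx
  unfold mult logOrder
  by_cases h : D.N x = r - 1
  · simp [hx, h]
  · simp only [hx, if_true, h, if_false, Set.mem_ofPred_eq, and_false]
    omega

theorem analyticAt_E_factor {x : X} (hx : x ≠ D.p) (P : Finset X) (hP : ∀ q ∈ P, q ∈ M ∧ q ≠ x) :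
    AnalyticAt ℂ (fun t => ∏ q ∈ P, (D.Z (orbiChart r M x t) - D.Z q) ^ D.N q) 0 ∧
      ∏ q ∈ P, (D.Z (orbiChart r M x 0) - D.Z q) ^ D.N q ≠ 0 := by
  have h1 : ∀ q ∈ P, D.Z (orbiChart r M x 0) - D.Z q ≠ 0 := by
    intro q hq h
    rw [orbiChart_zero D.r_ne_zero, sub_eq_zero] at h
    exact (hP q hq).2 (D.isCoord.inj q x (fun h' => D.notMem (h' ▸ (hP q hq).1)) hx h.symm)
  refine ⟨?_, Finset.prod_ne_zero_iff.2 fun q hq => zpow_ne_zero _ (h1 q hq)⟩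
  refine Finset.analyticAt_fun_prod _ fun q hq => ?_
  exact ((analyticAt_comp_orbiChart D.r_ne_zero (D.isCoord.eventually_mdiff hx)).sub
    analyticAt_const).zpow (h1 q hq)

/-- The local form of the meromorphic differential. -/
theorem exists_coeff (x : X) : ∃ g : ℂ → ℂ, AnalyticAt ℂ g 0 ∧ g 0 ≠ 0 ∧
    ∀ᶠ t in 𝓝 (0 : ℂ), orbiChart r M x t ∉ M → ((D.factor x t)⁻¹ ^ r) • D.η (orbiChart r M x t) =
      (g t * (t ^ isotropy r M x) ^ logOrder r M {x | x ∈ M ∧ D.N x = r - 1} x) •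
        dz x (orbiChart r M x t) := by
  classical
  have hr := D.r_ne_zero
  have hn := isotropy_ne_zero (M := M) hr x
  by_cases hp : x = D.p
  · subst hp
    have hcoord := D.isCoord
    have a1 : AnalyticAt ℂ (fun t : ℂ => deriv (inChart D.V D.p)
        (chartAt ℂ D.p D.p + t ^ isotropy r M D.p)) 0 :=
      analyticAt_comp_add_pow (analyticAt_inChart hcoord.eventually_mdiff_inv).deriv hn
    have a2 : AnalyticAt ℂ (fun t => ∏ q ∈ D.finite.toFinset,
        (1 + D.V (orbiChart r M D.p t) * D.Z q) ^ D.N q) 0 := by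
      refine Finset.analyticAt_fun_prod _ fun q hq => ?_
      refine (analyticAt_const.add (D.analyticAt_V.mul analyticAt_const)).zpow ?_
      simp [orbiChart_zero hr, V_pole]
    refine ⟨fun t => (-1) ^ D.sumN * (∏ q ∈ D.finite.toFinset,
        (1 + D.V (orbiChart r M D.p t) * D.Z q) ^ D.N q) * deriv (inChart D.V D.p)
        (chartAt ℂ D.p D.p + t ^ isotropy r M D.p), (analyticAt_const.mul a2).mul a1, ?_, ?_⟩
    · refine mul_ne_zero (mul_ne_zero (zpow_ne_zero _ (by simp)) ?_) ?_
      · simp [orbiChart_zero hr, V_pole]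
      · simp only [zero_pow hn, add_zero]
        exact hcoord.deriv_inv_ne_zero
    · have hL : logOrder r M {x | x ∈ M ∧ D.N x = r - 1} D.p = 0 := by
        simp [logOrder, D.notMem]
      filter_upwards [eventually_inDomain (M := M) hr D.p, eventually_nhdsWithin_iff.1
        D.eventually_V_ne_zero, (tendsto_orbiChart (M := M) hr D.p).eventually
          hcoord.eventually_mdiff_inv] with t h1 h2 h3 h4
      have h5 := differential_eq (F := D.V) h1.mem_source h3
      rw [h1.chart_eq] at h5
      rw [hL, zpow_zero, mul_one]
      by_cases h0 : t = 0
      · subst h0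
        have e : orbiChart r M D.p 0 = D.p := orbiChart_zero hr _
        rw [D.factor_zero, inv_one, one_pow, one_smul, η, if_pos e, h5, smul_smul]
        congr 1
        simp [e, V_pole]
      · have hV := h2 h0
        have hne : orbiChart r M D.p t ≠ D.p := fun h => h0 ((h1.orbiChart_eq_iff hr).1 h)
        have hz : D.Z (orbiChart r M D.p t) ≠ 0 := by
          intro h; simp [V, h] at hV
        rw [D.factor_pole hV, η, if_neg hne, D.differential_V hne hz, D.E_eq hV, h5, smul_smul,
          smul_smul, smul_smul]
        congr 1
        set v := D.V (orbiChart r M D.p t)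
        have e : ((v ^ D.d)⁻¹ ^ r) * v ^ (-D.sumN) * v ^ (-2 : ℤ) = 1 := by
          rw [← zpow_natCast, ← zpow_neg, ← zpow_mul, ← zpow_add₀ hV, ← zpow_add₀ hV]
          have := D.sum_eq
          have e2 : -D.d * (r : ℤ) + -D.sumN + -2 = 0 := by
            rw [sumN]; linarith
          rw [e2, zpow_zero]
        linear_combination ((-1) ^ D.sumN * (∏ q ∈ D.finite.toFinset, (1 + v * D.Z q) ^ D.N q) *
          deriv (inChart D.V D.p) (chartAt ℂ D.p D.p + t ^ isotropy r M D.p)) * e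
  · have hmd := D.isCoord.eventually_mdiff hp
    have a1 : AnalyticAt ℂ (fun t : ℂ => deriv (inChart D.Z x)
        (chartAt ℂ x x + t ^ isotropy r M x)) 0 :=
      analyticAt_comp_add_pow (analyticAt_inChart hmd).deriv hn
    have a0 : deriv (inChart D.Z x) (chartAt ℂ x x + 0 ^ isotropy r M x) ≠ 0 := by
      simpa [hn] using D.isCoord.deriv_ne_zero (mem_chart_source ℂ x) hp
    by_cases hx : x ∈ M
    · obtain ⟨u, hu, hu0, hus⟩ := exists_analytic_slope (analyticAt_inChart hmd)
      have hu0' : u (chartAt ℂ x x + 0 ^ isotropy r M x) ≠ 0 := by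
        simpa [hn, hu0] using a0
      obtain ⟨a2, a2'⟩ := D.analyticAt_E_factor hp (D.finite.toFinset.erase x) (fun q hq => by
        rw [Finset.mem_erase, Set.Finite.mem_toFinset] at hq
        exact ⟨hq.2, hq.1⟩)
      refine ⟨fun t => u (chartAt ℂ x x + t ^ isotropy r M x) ^ D.N x *
        (∏ q ∈ D.finite.toFinset.erase x, (D.Z (orbiChart r M x t) - D.Z q) ^ D.N q) *
        deriv (inChart D.Z x) (chartAt ℂ x x + t ^ isotropy r M x),
        (((analyticAt_comp_add_pow hu hn).zpow hu0').mul a2).mul a1,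
        mul_ne_zero (mul_ne_zero (zpow_ne_zero _ hu0') a2') a0, ?_⟩
      filter_upwards [eventually_inDomain (M := M) hr x, (tendsto_orbiChart (M := M) hr x).eventually
        hmd, (tendsto_orbiChart (M := M) hr x).eventually (IsCoord.eventually_ne hp)]
        with t h1 h3 h4 hM'
      have h0 : t ≠ 0 := by
        rintro rfl
        rw [orbiChart_zero hr] at hM'
        exact hM' hx
      have h5 := differential_eq (F := D.Z) h1.mem_source h3
      rw [h1.chart_eq] at h5
      rw [D.factor_of_mem hx h0, η, if_neg h4, h5, smul_smul, smul_smul, E,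
        ← Finset.mul_prod_erase _ _ ((Set.Finite.mem_toFinset D.finite).2 hx)]
      congr 1
      have h6 : D.Z (orbiChart r M x t) - D.Z x = t ^ isotropy r M x *
          u (chartAt ℂ x x + t ^ isotropy r M x) := by
        have := hus (chartAt ℂ x x + t ^ isotropy r M x)
        simp only [add_sub_cancel_left] at this
        rw [← this]
        simp [inChart, orbiChart]
      rw [h6, mul_zpow, isotropy_of_mem hx]
      have e : ((t ^ D.mult x)⁻¹ ^ r) * (t ^ r) ^ D.N x =
          (t ^ r) ^ logOrder r M {x | x ∈ M ∧ D.N x = r - 1} x := by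
        rw [D.N_eq_mult_add hx, zpow_add₀ (pow_ne_zero _ h0), inv_pow, ← pow_mul, zpow_natCast,
          ← pow_mul, mul_comm r, inv_mul_cancel_left₀ (pow_ne_zero _ h0)]
      rw [← e]
      ring
    · obtain ⟨a2, a2'⟩ := D.analyticAt_E_factor hp D.finite.toFinset (fun q hq => by
        rw [Set.Finite.mem_toFinset] at hq
        exact ⟨hq, fun h => hx (h ▸ hq)⟩)
      refine ⟨fun t => (∏ q ∈ D.finite.toFinset, (D.Z (orbiChart r M x t) - D.Z q) ^ D.N q) *
        deriv (inChart D.Z x) (chartAt ℂ x x + t ^ isotropy r M x), a2.mul a1,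
        mul_ne_zero a2' a0, ?_⟩
      filter_upwards [eventually_inDomain (M := M) hr x, (tendsto_orbiChart (M := M) hr x).eventually
        hmd, (tendsto_orbiChart (M := M) hr x).eventually (IsCoord.eventually_ne hp)]
        with t h1 h3 h4 hM'
      have h5 := differential_eq (F := D.Z) h1.mem_source h3
      rw [h1.chart_eq] at h5
      have hL : logOrder r M {x | x ∈ M ∧ D.N x = r - 1} x = 0 := by
        simp [logOrder, hx]
      rw [D.factor_of_notMem hx hp, η, if_neg h4, h5, smul_smul, smul_smul, hL, E]
      congr 1
      simp

/-- The twisted spin bundle. -/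
noncomputable def bundle : TwistedSpinBundle X r M where
  toOrbiLineBundle := D.lineBundle
  I₀ := {x | x ∈ M ∧ D.N x = r - 1}
  I₀_subset := fun x hx => ⟨hx.1, by
    show D.mult x = 0
    simp [mult, hx.2]⟩
  τ x _ := (PiTensorProduct.lift (MultilinearMap.mkPiAlgebra ℂ (Fin r) ℂ)).smulRight (D.η x)
  τ_iso x := by
    obtain ⟨g, hg, hg0, h⟩ := D.exists_coeff x
    refine ⟨g, hg, hg0, ?_⟩
    filter_upwards [h] with t ht hM'
    rw [← ht hM']
    have : (PiTensorProduct.lift (MultilinearMap.mkPiAlgebra ℂ (Fin r) ℂ))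
        (PiTensorProduct.tprod ℂ fun _ : Fin r => (D.factor x t)⁻¹ • (1 : ℂ)) =
        (D.factor x t)⁻¹ ^ r := by
      rw [PiTensorProduct.lift.tprod]
      simp
    exact congrArg (· • D.η (orbiChart r M x t)) this

theorem bundle_fiberCoord (y : X) (v : ℂ) : D.bundle.fiberCoord y v = v := by
  show D.factor y 0 * v = v
  rw [D.factor_zero, one_mul]

theorem bundle_frameCoeff (x : X) (t : ℂ) (y : X) :
    D.bundle.frameCoeff x t y = (D.factor x t)⁻¹ := by
  show D.factor y 0 * ((D.factor x t)⁻¹ * 1) = _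
  rw [D.factor_zero, one_mul, mul_one]

theorem bundle_τ {x : X} (hx : x ∉ M) (v : ℂ) :
    D.bundle.τ x hx (D.bundle.tpow (x := x) v) = v ^ r • D.η x := by
  have : (PiTensorProduct.lift (MultilinearMap.mkPiAlgebra ℂ (Fin r) ℂ))
      (PiTensorProduct.tprod ℂ fun _ : Fin r => v) = v ^ r := by
    rw [PiTensorProduct.lift.tprod]
    simp
  exact congrArg (· • D.η x) this

theorem bundle_twist {x : X} (hx : x ∈ M) : D.bundle.twist x = D.N x := by
  classical
  have h1 := D.N_eq_mult_add hx
  have h2 : D.bundle.mult x = D.mult x := rfl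
  rw [TwistedSpinBundle.twist, h1, h2, logOrder]
  have h3 : D.bundle.I₀ = {x | x ∈ M ∧ D.N x = r - 1} := rfl
  rw [h3]
  by_cases h : x ∈ {x | x ∈ M ∧ D.N x = r - 1}
  · simp only [h, if_true]; ring
  · simp only [h, if_false, hx, if_true]; ring

end ModelData
end RSpin

namespace RSpin

set_option linter.unusedSectionVars false

variable {X : Type*} [TopologicalSpace X] [ChartedSpace ℂ X] [IsManifold 𝓘(ℂ, ℂ) ω X]

/-! ### The closed case -/

theorem IsCoord.infinite {p : X} {Z : X → ℂ} [T1Space X] (hZ : IsCoord p Z) : Infinite X :=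
  Infinite.of_injective hZ.pt hZ.pt_injective

/-- There is a coordinate without pole in a given finite set. -/
theorem IsRiemannSphere.exists_coord_notMem [T1Space X] (h : IsRiemannSphere X) {M : Set X}
    (hM : M.Finite) : ∃ (p : X) (Z : X → ℂ), IsCoord p Z ∧ p ∉ M := by
  obtain ⟨p, Z, hZ⟩ := h.exists_coord
  have := hZ.infinite
  obtain ⟨q, hq⟩ := hM.infinite_compl.nonempty
  obtain ⟨Z', hZ'⟩ := hZ.exists_pole q
  exact ⟨q, Z', hZ', hq⟩

namespace TwistedSpinBundle

variable {r : ℕ} {M : Set X} {S S' : TwistedSpinBundle X r M}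

theorem mult_of_notMem {x : X} (hx : x ∉ M) : S.mult x = 0 := by
  have := S.mult_lt x
  rw [isotropy_of_notMem hx] at this
  omega

/-- The twists determine the multiplicities and the set `I₀`. -/
theorem mult_eq_of_twist (h : ∀ x ∈ M, S.twist x = S'.twist x) :
    S.mult = S'.mult ∧ S.I₀ = S'.I₀ := by
  have key : ∀ x, S.mult x = S'.mult x ∧ (x ∈ S.I₀ ↔ x ∈ S'.I₀) := by
    intro x
    by_cases hx : x ∈ M
    · have h1 := h x hx
      have h2 := S.mult_lt x
      have h3 := S'.mult_lt x
      rw [isotropy_of_mem hx] at h2 h3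
      have h4 : x ∈ S.I₀ → S.mult x = 0 := fun h => (S.I₀_subset h).2
      have h5 : x ∈ S'.I₀ → S'.mult x = 0 := fun h => (S'.I₀_subset h).2
      unfold twist at h1
      by_cases a : x ∈ S.I₀ <;> by_cases b : x ∈ S'.I₀
      · simp [a, b, h4 a, h5 b]
      · simp only [a, b, if_true, if_false, h4 a] at h1; omega
      · simp only [a, b, if_true, if_false, h5 b] at h1; omega
      · simp only [a, b, if_false] at h1
        simp only [a, b, iff_self, and_true]
        omega
    · refine ⟨by rw [mult_of_notMem hx, mult_of_notMem hx], ?_⟩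
      exact ⟨fun h => (hx (S.I₀_subset h).1).elim, fun h => (hx (S'.I₀_subset h).1).elim⟩
  exact ⟨funext fun x => (key x).1, Set.ext fun x => (key x).2⟩

theorem nonempty_iso_of_twist (hX : IsRiemannSphere X) (hM : M.Finite) (hr : 2 ≤ r)
    (h : ∀ x ∈ M, S.twist x = S'.twist x) : Nonempty (Iso S S') := by
  have := hX.t2Space
  obtain ⟨p, Z, hZ⟩ := hX.exists_coord
  obtain ⟨h1, h2⟩ := mult_eq_of_twist h
  exact nonempty_iso (by omega) hM h1 h2 fun c hc => hZ.exists_section c hc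

theorem Iso.exists_apply_eq (hX : IsRiemannSphere X) (hM : M.Finite) (hr : 2 ≤ r) (f : Iso S S) :
    ∃ ζ : ℂ, ζ ^ r = 1 ∧ ∀ x v, f.toEquiv x v = ζ • v := by
  have := hX.t2Space
  have := hX.connectedSpace
  obtain ⟨ζ, h1, h2⟩ := f.exists_scalar hM (by omega)
  exact ⟨ζ, h1, fun x v => Iso.apply_eq_smul (h2 x) v⟩

theorem exists_iso_apply_eq (hr : r ≠ 0) {ζ : ℂ} (hζ : ζ ^ r = 1) :
    ∃ f : Iso S S, ∀ x v, f.toEquiv x v = ζ • v :=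
  ⟨(Iso.refl S).rescale ζ hr hζ, fun x v => Iso.apply_eq_smul (by
    simp [Iso.rescale, Iso.refl]) v⟩

/-- The coordinate on the fibre at a marked point of twist `r - 1`, as a linear equivalence. -/
noncomputable def poleEquiv (S : TwistedSpinBundle X r M) (p : X) : S.PoleFiber p ≃ₗ[ℂ] ℂ :=
  (TensorProduct.congr (S.fiberCoord p) (LinearEquiv.ofBijective
    (dz p p).toLinearMap ⟨fun u v h => by
      have h' : dz p p u = dz p p v := h
      rwa [dz_self, dz_self] at h', fun z => ⟨z, dz_self p z⟩⟩)).trans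
    (TensorProduct.lid ℂ ℂ)

theorem poleEquiv_apply (p : X) (v : S.PoleFiber p) : S.poleEquiv p v = S.poleCoord p v := rfl

theorem residuePow_symm (p : X) (z : ℂ) :
    S.residuePow p ((S.poleEquiv p).symm z) = z ^ r * S.leadCoeff p := by
  rw [residuePow, ← poleEquiv_apply, LinearEquiv.apply_symm_apply]

theorem residuePow_smul (p : X) (c : ℂ) (v : S.PoleFiber p) :
    S.residuePow p (c • v) = c ^ r * S.residuePow p v := by
  rw [residuePow, residuePow, ← poleEquiv_apply, map_smul, smul_eq_mul, mul_pow, mul_assoc]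
  rfl

theorem exists_eq_smul (p : X) {v : S.PoleFiber p} (hv : v ≠ 0) (u : S.PoleFiber p) :
    ∃ c : ℂ, u = c • v := by
  have h : S.poleEquiv p v ≠ 0 := by simpa using hv
  refine ⟨S.poleEquiv p u / S.poleEquiv p v, (S.poleEquiv p).injective ?_⟩
  rw [map_smul, smul_eq_mul, div_mul_cancel₀ _ h]

theorem poleMap_eq_smul {f : Iso S S} {ζ : ℂ} (h : ∀ x v, f.toEquiv x v = ζ • v) (p : X)
    (v : S.PoleFiber p) : f.poleMap p v = ζ • v := by
  have h1 : (f.toEquiv p).toLinearMap = ζ • LinearMap.id := LinearMap.ext fun v => h p v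
  rw [Iso.poleMap, h1, TensorProduct.map_smul_left, TensorProduct.map_id]
  rfl

end TwistedSpinBundle

/-- A root of unity which is a positive real number is `1`. -/
theorem eq_one_of_pow_eq_one_of_pos {ζ : ℂ} {r : ℕ} (hr : r ≠ 0) (h : ζ ^ r = 1) {c : ℝ}
    (hc : 0 < c) (hζ : ζ = c) : ζ = 1 := by
  subst hζ
  have h1 : c ^ r = 1 := by exact_mod_cast h
  rw [(pow_eq_one_iff_of_nonneg hc.le hr).1 h1, Complex.ofReal_one]

theorem exists_root_of_pow_pos {β : ℂ} {r : ℕ} (hr : r ≠ 0) {s : ℝ} (hs : 0 < s)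
    (h : β ^ r = s) : ∃ (ζ : ℂ) (c : ℝ), ζ ^ r = 1 ∧ 0 < c ∧ β = c * ζ := by
  have hβ : β ≠ 0 := by
    rintro rfl
    rw [zero_pow hr] at h
    exact hs.ne (by exact_mod_cast h)
  have hn : ((‖β‖ : ℝ) : ℂ) ≠ 0 := by exact_mod_cast (norm_pos_iff.2 hβ).ne'
  refine ⟨β / ‖β‖, ‖β‖, ?_, norm_pos_iff.2 hβ, by field_simp⟩
  have h2 : ‖β‖ ^ r = s := by
    rw [← norm_pow, h, Complex.norm_real, Real.norm_of_nonneg hs.le]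
  rw [div_pow, h, ← Complex.ofReal_pow, h2, div_self]
  exact_mod_cast hs.ne'

namespace MarkedSphere

variable {I : Type*} [Fintype I] (C : MarkedSphere X I)

theorem M_finite : C.M.Finite := Set.finite_range C.z

theorem exists_spin {r : ℕ} (hr : 2 ≤ r) (a : I → ℤ) (ha : ∀ i, -1 ≤ a i ∧ a i ≤ r - 1)
    (ha' : ∀ i j, a i = -1 → a j = -1 → i = j) (hsum : (r : ℤ) ∣ (∑ i, a i) - (r - 2)) :
    ∃ S : SphereSpin C r, S.HasTwists a := by
  classical
  have := C.sphere.t2Space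
  obtain ⟨p, Z, hZ, hp⟩ := C.sphere.exists_coord_notMem C.M_finite
  obtain ⟨e, he⟩ := hsum
  have hN : ∀ i, (∑ j, if C.z j = C.z i then a j else 0) = a i := by
    intro i
    simp [C.z_injective.eq_iff]
  let D : ModelData X r C.M :=
    { p := p
      Z := Z
      isCoord := hZ
      two_le := hr
      finite := C.M_finite
      notMem := hp
      N := fun x => ∑ j, if C.z j = x then a j else 0
      neg_one_le := by rintro _ ⟨i, rfl⟩; rw [hN]; exact (ha i).1
      le_sub_one := by rintro _ ⟨i, rfl⟩; rw [hN]; exact (ha i).2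
      d := -e - 1
      sum_eq := by
        have h1 : C.M_finite.toFinset = Finset.univ.map ⟨C.z, C.z_injective⟩ := by
          ext x; simp [M]
        rw [h1, Finset.sum_map]
        simp only [Function.Embedding.coeFn_mk, hN]
        linarith }
  have htw : ∀ i, D.bundle.twist (C.z i) = a i := fun i => by
    rw [D.bundle_twist ⟨i, rfl⟩]; exact hN i
  refine ⟨{ toTwistedSpinBundle := D.bundle, atMostOne := ?_ }, htw⟩
  rintro _ ⟨i, rfl⟩ _ ⟨j, rfl⟩ h1 h2 h3 h4
  have h5 := htw i
  have h6 := htw j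
  rw [TwistedSpinBundle.twist, h1, if_neg h3] at h5
  rw [TwistedSpinBundle.twist, h2, if_neg h4] at h6
  rw [ha' i j (by omega) (by omega)]

theorem nonempty_iso {r : ℕ} (hr : 2 ≤ r) {a : I → ℤ} {S S' : SphereSpin C r}
    (hS : S.HasTwists a) (hS' : S'.HasTwists a) : Nonempty (S.Iso S') := by
  refine TwistedSpinBundle.nonempty_iso_of_twist C.sphere C.M_finite hr ?_
  rintro _ ⟨i, rfl⟩
  rw [hS i, hS' i]

variable {C} {r : ℕ}

theorem exists_grading (hr : 2 ≤ r) {S : SphereSpin C r} {i : I} (h1 : C.mark i = none)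
    (h2 : ∀ j, j ≠ i → C.mark j ≠ none) (h3 : ∀ j, S.twist (C.z j) = -1 → j = i) :
    Nonempty (S.Grading i) := by
  have hr0 : r ≠ 0 := by omega
  set e := S.poleEquiv (C.z i)
  obtain ⟨b, hb⟩ := IsAlgClosed.exists_pow_nat_eq (Complex.I / S.leadCoeff (C.z i))
    (Nat.pos_of_ne_zero hr0)
  have hL := S.leadCoeff_ne_zero (C.z i)
  have hbI : b ^ r * S.leadCoeff (C.z i) = Complex.I := by rw [hb, div_mul_cancel₀ _ hL]
  have hb0 : b ≠ 0 := by
    rintro rfl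
    rw [zero_pow hr0, zero_mul] at hbI
    exact Complex.I_ne_zero hbI.symm
  have hres : ∀ c : ℂ, S.residuePow (C.z i) (e.symm (c * b)) = c ^ r * Complex.I := fun c => by
    rw [S.residuePow_symm, mul_pow, mul_assoc, hbI]
  have hv : ∀ v, ∃ c, v = e.symm (c * b) := fun v => ⟨e v / b, by
    rw [div_mul_cancel₀ _ hb0, LinearEquiv.symm_apply_apply]⟩
  let ι : S.PoleFiber (C.z i) →ₛₗ[starRingEnd ℂ] S.PoleFiber (C.z i) :=
    { toFun := fun v => e.symm ((starRingEnd ℂ) (e v / b) * b)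
      map_add' := fun u v => by simp [add_div, add_mul]
      map_smul' := fun c v => by
        rw [map_smul, smul_eq_mul, mul_div_assoc, map_mul (starRingEnd ℂ), mul_assoc,
          ← smul_eq_mul, map_smul] }
  have hι : ∀ c, ι (e.symm (c * b)) = e.symm ((starRingEnd ℂ) c * b) := fun c => by
    show e.symm _ = _
    rw [LinearEquiv.apply_symm_apply, mul_div_cancel_right₀ _ hb0]
  refine ⟨⟨h1, h2, h3, fun _ => ι, ?_, ?_, ?_, fun _ => {u | ∃ c : ℝ, 0 < c ∧ u = (c : ℂ) • e.symm b},
    ?_, ?_⟩⟩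
  · intro _ v
    obtain ⟨c, rfl⟩ := hv v
    rw [hι, hι, Complex.conj_conj]
  · intro _ v
    obtain ⟨c, rfl⟩ := hv v
    rw [hι, hres, hres, map_mul, Complex.conj_I, map_pow, mul_neg, neg_neg]
  · intro _ s hs
    refine ⟨e.symm (((s ^ (1 / r : ℝ) : ℝ) : ℂ) * b), ?_, ?_⟩
    · rw [hι, Complex.conj_ofReal]
    · rw [hres, ← Complex.ofReal_pow, ← Real.rpow_natCast, ← Real.rpow_mul hs.le,
        one_div_mul_cancel (Nat.cast_ne_zero.2 hr0), Real.rpow_one]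
  · intro _
    refine ⟨e.symm b, by simpa using hb0, ?_, rfl⟩
    simpa using hι 1
  · rintro _ v ⟨c, hc, rfl⟩
    refine ⟨c ^ r, pow_pos hc r, ?_⟩
    rw [← map_smul, smul_eq_mul, hres, Complex.ofReal_pow]

theorem exists_grading_iso (hr : 2 ≤ r) {S : SphereSpin C r} {i : I} (G G' : S.Grading i) :
    ∃ f : S.Iso S, G.IsIso G' f := by
  have hr0 : r ≠ 0 := by omega
  by_cases h : S.twist (C.z i) = r - 1
  swap
  · exact ⟨TwistedSpinBundle.Iso.refl _, fun h' => (h h').elim⟩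
  obtain ⟨v, hv0, hv, hpos⟩ := G.pos_ray h
  obtain ⟨v', hv0', hv', hpos'⟩ := G'.pos_ray h
  obtain ⟨s, hs, hsv⟩ := G.residue_pos h v (by rw [hpos]; exact ⟨1, one_pos, by simp⟩)
  obtain ⟨s', hs', hsv'⟩ := G'.residue_pos h v' (by rw [hpos']; exact ⟨1, one_pos, by simp⟩)
  obtain ⟨β, rfl⟩ := S.exists_eq_smul (C.z i) hv0 v'
  have h1 : β ^ r = ((s' / s : ℝ) : ℂ) := by
    rw [S.residuePow_smul, hsv, ← mul_assoc] at hsv'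
    have h2 := mul_right_cancel₀ Complex.I_ne_zero hsv'
    have h3 : (s : ℂ) ≠ 0 := by exact_mod_cast hs.ne'
    push_cast
    rw [← h2, mul_div_cancel_right₀ _ h3]
  obtain ⟨ζ, c, hζ, hc, rfl⟩ := exists_root_of_pow_pos hr0 (div_pos hs' hs) h1
  obtain ⟨f, hf⟩ := TwistedSpinBundle.exists_iso_apply_eq (S := S.toTwistedSpinBundle) hr0 hζ
  have hf' := TwistedSpinBundle.poleMap_eq_smul hf (C.z i)
  have hc0 : (c : ℂ) ≠ 0 := by exact_mod_cast hc.ne'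
  have hζv : G'.inv h (ζ • v) = ζ • v := by
    have h2 : ζ • v = ((c⁻¹ : ℝ) : ℂ) • ((c : ℂ) * ζ) • v := by
      rw [smul_smul, ← mul_assoc]
      push_cast
      rw [inv_mul_cancel₀ hc0, one_mul]
    rw [h2, map_smulₛₗ, hv', Complex.conj_ofReal]
  refine ⟨f, fun _ _ => ⟨fun u => ?_, ?_⟩⟩
  · obtain ⟨d, rfl⟩ := S.exists_eq_smul (C.z i) hv0 u
    rw [hf', hf', map_smulₛₗ, hv, smul_comm ζ d v, map_smulₛₗ, hζv, smul_comm]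
  · rw [hpos, hpos']
    ext u
    simp only [Set.mem_image, Set.mem_ofPred_eq]
    constructor
    · rintro ⟨_, ⟨d, hd, rfl⟩, rfl⟩
      refine ⟨d / c, div_pos hd hc, ?_⟩
      rw [hf', smul_smul, smul_smul]
      push_cast
      congr 1
      field_simp
    · rintro ⟨d, hd, rfl⟩
      refine ⟨((d * c : ℝ) : ℂ) • v, ⟨d * c, mul_pos hd hc, rfl⟩, ?_⟩
      rw [hf', smul_smul, smul_smul]
      push_cast
      congr 1
      ring

theorem grading_rigid (hr : 2 ≤ r) {S : SphereSpin C r} {i : I} (h : S.twist (C.z i) = r - 1)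
    (G : S.Grading i) (f : S.Iso S) (hf : G.IsIso G f) (x : X) (v : S.fiber x) :
    f.toEquiv x v = v := by
  have hr0 : r ≠ 0 := by omega
  obtain ⟨ζ, hζ, hfζ⟩ := TwistedSpinBundle.Iso.exists_apply_eq C.sphere C.M_finite hr f
  obtain ⟨u, hu0, -, hpos⟩ := G.pos_ray h
  have h1 : f.poleMap (C.z i) u ∈ G.pos h := by
    rw [← (hf h h).2]
    exact ⟨u, by rw [hpos]; exact ⟨1, one_pos, by simp⟩, rfl⟩
  rw [TwistedSpinBundle.poleMap_eq_smul hfζ, hpos] at h1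
  obtain ⟨c, hc, h2⟩ := h1
  have h3 : S.poleEquiv (C.z i) u ≠ 0 := by simpa using hu0
  have h4 := congrArg (S.poleEquiv (C.z i)) h2
  rw [map_smul, map_smul] at h4
  rw [hfζ, eq_one_of_pow_eq_one_of_pos hr0 hζ hc (mul_right_cancel₀ h3 h4), one_smul]

end MarkedSphere
end RSpin

namespace RSpin

set_option linter.unusedSectionVars false

/-! ### Antiholomorphic involutions -/

section Antiholomorphic

variable {X : Type*} [TopologicalSpace X] [ChartedSpace ℂ X] [IsManifold 𝓘(ℂ, ℂ) ω X]
  {φ : X → X}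

theorem mdifferentiableAt_of_inChart {F : X → ℂ} {x : X}
    (hF : DifferentiableAt ℂ (inChart F x) (chartAt ℂ x x)) :
    MDifferentiableAt 𝓘(ℂ, ℂ) 𝓘(ℂ, ℂ) F x := by
  have h1 : F =ᶠ[𝓝 x] inChart F x ∘ chartAt ℂ x := by
    filter_upwards [eventually_mem_source x] with y hy
    simp [inChart, hy]
  refine MDifferentiableAt.congr_of_eventuallyEq ?_ h1
  exact MDifferentiableAt.comp x (mdifferentiableAt_iff_differentiableAt.2 hF)
    (mdifferentiableAt_chartAt (mem_chart_source ℂ x))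

theorem differential_apply {F : X → ℂ} {x : X} (hF : MDifferentiableAt 𝓘(ℂ, ℂ) 𝓘(ℂ, ℂ) F x)
    (u : ℂ) : differential F x u = deriv (inChart F x) (chartAt ℂ x x) * u := by
  rw [differential_eq (mem_chart_source ℂ x) hF]
  exact congrArg (deriv (inChart F x) (chartAt ℂ x x) * ·) (dz_self x u)

/-- The expression of `φ` in the charts at `x` and `φ x`, followed by conjugation. -/
noncomputable def antiChart (φ : X → X) (x : X) (s : ℂ) : ℂ :=
  (starRingEnd ℂ) (chartAt ℂ (φ x) (φ ((chartAt ℂ x).symm s)))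

namespace IsAntiholomorphic

theorem analyticAt (h : IsAntiholomorphic φ) (x : X) :
    AnalyticAt ℂ (antiChart φ x) (chartAt ℂ x x) := h.2 x

theorem antiChart_self (x : X) :
    antiChart φ x (chartAt ℂ x x) = (starRingEnd ℂ) (chartAt ℂ (φ x) (φ x)) := by
  simp [antiChart]

theorem tendsto_symm (x : X) :
    Filter.Tendsto (chartAt ℂ x).symm (𝓝 (chartAt ℂ x x)) (𝓝 x) := by
  simpa [ContinuousAt] using (chartAt ℂ x).continuousAt_symm (mem_chart_target ℂ x)

theorem eventually_mem (h : IsAntiholomorphic φ) (x : X) :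
    ∀ᶠ s in 𝓝 (chartAt ℂ x x), φ ((chartAt ℂ x).symm s) ∈ (chartAt ℂ (φ x)).source :=
  (h.1.continuousAt.tendsto.comp (tendsto_symm x)).eventually (eventually_mem_source (φ x))

theorem deriv_ne_zero (h : IsAntiholomorphic φ) (hφ : Function.Injective φ) (x : X) :
    deriv (antiChart φ x) (chartAt ℂ x x) ≠ 0 := by
  refine deriv_ne_zero_of_injOn (h.analyticAt x) (Filter.inter_mem (h.eventually_mem x)
    ((chartAt ℂ x).open_target.mem_nhds (mem_chart_target ℂ x))) ?_
  rintro s ⟨hs, hs'⟩ t ⟨ht, ht'⟩ hst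
  exact (chartAt ℂ x).symm.injOn hs' ht' (hφ ((chartAt ℂ (φ x)).injOn hs ht
    ((starRingEnd ℂ).injective hst)))

/-- The expression in a chart of the conjugate of the pull back of a function. -/
theorem inChart_conj_comp (h : IsAntiholomorphic φ) (F : X → ℂ) (x : X) :
    inChart (fun y => (starRingEnd ℂ) (F (φ y))) x =ᶠ[𝓝 (chartAt ℂ x x)]
      ((starRingEnd ℂ) ∘ inChart F (φ x) ∘ (starRingEnd ℂ)) ∘ antiChart φ x := by
  filter_upwards [h.eventually_mem x] with s hs
  simp [inChart, antiChart, hs]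

theorem hasDerivAt_conj_comp (h : IsAntiholomorphic φ) {F : X → ℂ} {x : X}
    (hF : MDifferentiableAt 𝓘(ℂ, ℂ) 𝓘(ℂ, ℂ) F (φ x)) :
    HasDerivAt (inChart (fun y => (starRingEnd ℂ) (F (φ y))) x)
      ((starRingEnd ℂ) (deriv (inChart F (φ x)) (chartAt ℂ (φ x) (φ x))) *
        deriv (antiChart φ x) (chartAt ℂ x x)) (chartAt ℂ x x) := by
  have h1 := (differentiableAt_inChart (mem_chart_source ℂ (φ x)) hF).hasDerivAt.conj_conj
  have h2 := (h.analyticAt x).differentiableAt.hasDerivAt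
  refine HasDerivAt.congr_of_eventuallyEq ?_ (h.inChart_conj_comp F x)
  refine HasDerivAt.comp _ ?_ h2
  rw [antiChart_self]
  exact h1

theorem mdifferentiableAt_conj_comp (h : IsAntiholomorphic φ) {F : X → ℂ} {x : X}
    (hF : MDifferentiableAt 𝓘(ℂ, ℂ) 𝓘(ℂ, ℂ) F (φ x)) :
    MDifferentiableAt 𝓘(ℂ, ℂ) 𝓘(ℂ, ℂ) (fun y => (starRingEnd ℂ) (F (φ y))) x :=
  mdifferentiableAt_of_inChart (h.hasDerivAt_conj_comp hF).differentiableAt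

theorem hasMFDerivAt (h : IsAntiholomorphic φ) (x : X) :
    HasMFDerivAt 𝓘(ℝ, ℂ) 𝓘(ℝ, ℂ) φ x
      (Complex.conjCLE.toContinuousLinearMap.comp
        ((ContinuousLinearMap.toSpanSingleton ℂ
          (deriv (antiChart φ x) (chartAt ℂ x x))).restrictScalars ℝ)) := by
  refine ⟨h.1.continuousAt, ?_⟩
  have h1 : HasFDerivAt (antiChart φ x) (ContinuousLinearMap.toSpanSingleton ℂ
      (deriv (antiChart φ x) (chartAt ℂ x x))) (chartAt ℂ x x) :=
    (h.analyticAt x).differentiableAt.hasDerivAt.hasFDerivAt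
  have h2 := Complex.conjCLE.toContinuousLinearMap.hasFDerivAt.comp (chartAt ℂ x x)
    (h1.restrictScalars ℝ)
  have h3 : writtenInExtChartAt 𝓘(ℝ, ℂ) 𝓘(ℝ, ℂ) x φ =
      Complex.conjCLE.toContinuousLinearMap ∘ antiChart φ x := by
    funext s
    simp [antiChart, writtenInExtChartAt]
  rw [h3]
  have h4 : Set.range 𝓘(ℝ, ℂ) = Set.univ := by simp
  rw [h4]
  exact h2.hasFDerivWithinAt

theorem tangentMapAt_apply (h : IsAntiholomorphic φ) (x : X) (u : ℂ) :
    tangentMapAt φ x (φ x) u =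
      (starRingEnd ℂ) (deriv (antiChart φ x) (chartAt ℂ x x) * u) := by
  unfold tangentMapAt
  rw [(h.hasMFDerivAt x).mfderiv]
  change (starRingEnd ℂ) (u • deriv (antiChart φ x) (chartAt ℂ x x)) = _
  rw [smul_eq_mul, mul_comm]

theorem differential_conj_comp (h : IsAntiholomorphic φ) {F : X → ℂ} {x : X}
    (hF : MDifferentiableAt 𝓘(ℂ, ℂ) 𝓘(ℂ, ℂ) F (φ x)) (u : ℂ) :
    differential (fun y => (starRingEnd ℂ) (F (φ y))) x u =
      (starRingEnd ℂ) (differential F (φ x) (tangentMapAt φ x (φ x) u)) := by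
  have h1 : (tangentMapAt φ x (φ x) u : ℂ) =
    (starRingEnd ℂ) (deriv (antiChart φ x) (chartAt ℂ x x) * u) := h.tangentMapAt_apply x u
  have h2 := differential_apply hF (tangentMapAt φ x (φ x) u : ℂ)
  refine (differential_apply (h.mdifferentiableAt_conj_comp hF) u).trans
    (Eq.trans ?_ (congrArg (starRingEnd ℂ) h2).symm)
  rw [(h.hasDerivAt_conj_comp hF).deriv, h1]
  simp only [map_mul, Complex.conj_conj]
  ring

/-- The lift of `φ` to uniformizing charts. -/
theorem exists_lift (h : IsAntiholomorphic φ) (hφ : Function.Injective φ) {r : ℕ} (hr : r ≠ 0)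
    {M : Set X} (x : X) (hM : isotropy r M (φ x) = isotropy r M x) :
    ∃ ψ q : ℂ → ℂ, AnalyticAt ℂ q 0 ∧ q 0 ≠ 0 ∧ (∀ t, (starRingEnd ℂ) (ψ t) = t * q t) ∧
      ∀ᶠ t in 𝓝 (0 : ℂ), orbiChart r M (φ x) (ψ t) = φ (orbiChart r M x t) := by
  set n := isotropy r M x with hn
  have hn0 : n ≠ 0 := isotropy_ne_zero hr x
  set s₀ := chartAt ℂ x x with hs₀
  obtain ⟨w, hw, hw0, hslope⟩ := exists_analytic_slope (h.analyticAt x)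
  have hw1 : w s₀ ≠ 0 := by rw [hw0]; exact h.deriv_ne_zero hφ x
  obtain ⟨ρ, hρ, hρ0, hρn⟩ := exists_analytic_root hn0 hw1
  have hwt : AnalyticAt ℂ (fun t => w (s₀ + t ^ n)) 0 := analyticAt_comp_add_pow hw hn0
  have hq : AnalyticAt ℂ (fun t => ρ (w (s₀ + t ^ n))) 0 := by
    refine AnalyticAt.fun_comp (g := ρ) ?_ hwt
    simpa [hn0] using hρ
  refine ⟨fun t => (starRingEnd ℂ) (t * ρ (w (s₀ + t ^ n))), _, hq, by simpa [hn0] using hρ0,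
    fun t => by simp, ?_⟩
  have ht : Filter.Tendsto (fun t : ℂ => s₀ + t ^ n) (𝓝 0) (𝓝 s₀) := by
    have : ContinuousAt (fun t : ℂ => s₀ + t ^ n) 0 := by fun_prop
    simpa [ContinuousAt, hn0] using this
  filter_upwards [hwt.continuousAt.eventually_ne (by simpa [hn0] using hw1),
    ht.eventually (h.eventually_mem x)] with t h1 h2
  have h3 : ((starRingEnd ℂ) (t * ρ (w (s₀ + t ^ n)))) ^ n =
      (starRingEnd ℂ) (t ^ n * w (s₀ + t ^ n)) := by
    rw [← map_pow, mul_pow, hρn _ h1]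
  have h4 : t ^ n * w (s₀ + t ^ n) = antiChart φ x (s₀ + t ^ n) - antiChart φ x s₀ := by
    rw [hslope]; ring
  unfold orbiChart
  rw [hM, ← hn, h3, h4, map_sub, hs₀, antiChart_self, Complex.conj_conj, antiChart,
    Complex.conj_conj, add_sub_cancel, (chartAt ℂ (φ x)).left_inv h2]

end IsAntiholomorphic

end Antiholomorphic
end RSpin

namespace RSpin

set_option linter.unusedSectionVars false

/-! ### Real coordinates on disks -/

/-- An entire function with at most linear growth is affine. -/
theorem exists_affine_of_linear_growth {g : ℂ → ℂ} (hg : Differentiable ℂ g) {K R : ℝ}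
    (h : ∀ z, R ≤ ‖z‖ → ‖g z‖ ≤ K * ‖z‖) : ∃ a b : ℂ, ∀ z, g z = a * z + b := by
  have h1 : Differentiable ℂ (dslope g 0) := by
    rw [← differentiableOn_univ, Complex.differentiableOn_dslope Filter.univ_mem]
    exact hg.differentiableOn
  obtain ⟨K', hK'⟩ := (isCompact_closedBall (0 : ℂ) (max R 1)).exists_bound_of_continuousOn
    h1.continuous.continuousOn
  have h2 : ∀ z, ‖dslope g 0 z‖ ≤ max K' (K + ‖g 0‖) := by
    intro z
    by_cases hz : ‖z‖ ≤ max R 1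
    · exact (hK' z (by simpa using hz)).trans (le_max_left _ _)
    · have hz1 : max R 1 ≤ ‖z‖ := (not_le.1 hz).le
      have hz2 : 1 ≤ ‖z‖ := (le_max_right _ _).trans hz1
      have hz0 : z ≠ 0 := by rintro rfl; simp at hz2; linarith
      refine le_trans ?_ (le_max_right _ _)
      rw [dslope_of_ne _ hz0, slope_def_field, norm_div, sub_zero, div_le_iff₀ (by linarith)]
      have := h z ((le_max_left _ _).trans hz1)
      have h3 := norm_sub_le (g z) (g 0)
      nlinarith [norm_nonneg (g 0)]
  obtain ⟨a, ha⟩ := h1.exists_eq_const_of_bounded (isBounded_iff_forall_norm_le.2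
    ⟨_, by rintro _ ⟨z, rfl⟩; exact h2 z⟩)
  refine ⟨a, g 0, fun z => ?_⟩
  have := sub_smul_dslope g 0 z
  rw [ha] at this
  simp only [Function.const_apply, sub_zero, smul_eq_mul] at this
  rw [mul_comm, this]; ring

section Coord

variable {X : Type*} [TopologicalSpace X] [ChartedSpace ℂ X] [T1Space X] {p : X} {Z : X → ℂ}
  [IsManifold 𝓘(ℂ, ℂ) ω X]

namespace IsCoord

theorem differentiableAt_comp_pt (hZ : IsCoord p Z) {F : X → ℂ} {z : ℂ}
    (hF : MDifferentiableAt 𝓘(ℂ, ℂ) 𝓘(ℂ, ℂ) F (hZ.pt z)) :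
    DifferentiableAt ℂ (fun w => F (hZ.pt w)) z := by
  set x := hZ.pt z with hx
  have hxs := mem_chart_source ℂ x
  have hmem : ∀ᶠ w in 𝓝 z, hZ.pt w ∈ (chartAt ℂ x).source :=
    hZ.continuous_pt.continuousAt.eventually (eventually_mem_source x)
  have h1 : HasDerivAt (fun w => chartAt ℂ x (hZ.pt w))
      (deriv (inChart Z x) (chartAt ℂ x x))⁻¹ z := by
    refine HasDerivAt.of_local_left_inverse (f := inChart Z x) ?_ ?_
      (hZ.deriv_ne_zero hxs (hZ.pt_ne z)) ?_
    · exact ContinuousAt.comp (f := hZ.pt) ((chartAt ℂ x).continuousAt hxs)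
        hZ.continuous_pt.continuousAt
    · exact (differentiableAt_inChart hxs (hZ.mdiff x (hZ.pt_ne z))).hasDerivAt
    · filter_upwards [hmem] with w hw
      simp [inChart, hw, hZ.apply_pt]
  have h2 : (fun w => F (hZ.pt w)) =ᶠ[𝓝 z] fun w => inChart F x (chartAt ℂ x (hZ.pt w)) := by
    filter_upwards [hmem] with w hw
    simp [inChart, hw]
  refine DifferentiableAt.congr_of_eventuallyEq ?_ h2
  exact DifferentiableAt.comp (f := fun w => chartAt ℂ x (hZ.pt w)) z (differentiableAt_inChart hxs hF) h1.differentiableAt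

theorem tendsto_pt_cobounded (hZ : IsCoord p Z) :
    Filter.Tendsto hZ.pt (Bornology.cobounded ℂ) (𝓝 p) := by
  intro U hU
  have h1 : (fun y => -(Z y)⁻¹) '' U ∈ 𝓝 (0 : ℂ) :=
    hZ.nhds_le_map_inv (Filter.image_mem_map hU)
  have h2 : Filter.Tendsto (fun z : ℂ => -z⁻¹) (Bornology.cobounded ℂ) (𝓝 0) := by
    simpa using Filter.tendsto_inv₀_cobounded.neg (α := ℂ)
  rw [Filter.mem_map]
  filter_upwards [h2 h1, Bornology.eventually_ne_cobounded (0 : ℂ)] with z hz hz0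
  obtain ⟨y, hy, hyz⟩ := hz
  have h3 : Z y = z := by simpa using hyz
  have hyp : y ≠ p := by rintro rfl; rw [hZ.pole] at h3; exact hz0 h3.symm
  have : hZ.pt z = y := by rw [← h3, hZ.pt_apply hyp]
  simpa [this] using hy

end IsCoord

open Asymptotics in
theorem IsAntiholomorphic.exists_affine {φ : X → X} (hφ : IsAntiholomorphic φ)
    (hφφ : ∀ x, φ (φ x) = x) (hZ : IsCoord p Z) (hp : φ p = p) :
    ∃ a b : ℂ, ∀ y, y ≠ p → (starRingEnd ℂ) (Z (φ y)) = a * Z y + b := by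
  have hne : ∀ y, y ≠ p → φ y ≠ p := fun y hy h => hy (by rw [← hφφ y, h, hp])
  have h1 : Differentiable ℂ (fun z => (starRingEnd ℂ) (Z (φ (hZ.pt z)))) := fun z =>
    hZ.differentiableAt_comp_pt (F := fun y => (starRingEnd ℂ) (Z (φ y)))
      (hφ.mdifferentiableAt_conj_comp (hZ.mdiff _ (hne _ (hZ.pt_ne z))))
  set W : X → ℂ := fun y => -(Z y)⁻¹ with hW
  have hWd : MDifferentiableAt 𝓘(ℂ, ℂ) 𝓘(ℂ, ℂ) W (φ p) := by rw [hp]; exact hZ.mdiff_inv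
  have e1 : HasDerivAt (inChart W p) (deriv (inChart W p) (chartAt ℂ p p)) (chartAt ℂ p p) :=
    (differentiableAt_inChart (mem_chart_source ℂ p) hZ.mdiff_inv).hasDerivAt
  have e2 := hφ.hasDerivAt_conj_comp hWd
  have h2 : W =O[𝓝 p] (fun y => (starRingEnd ℂ) (W (φ y))) := by
    have e3 : inChart W p =O[𝓝 (chartAt ℂ p p)]
        inChart (fun y => (starRingEnd ℂ) (W (φ y))) p := by
      have t1 := e1.isBigO_sub
      have t2 := (HasDerivAtFilter.isTheta_sub e2 (by
        refine mul_ne_zero ?_ (hφ.deriv_ne_zero (Function.Involutive.injective hφφ) p)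
        rw [map_ne_zero, hp]
        exact hZ.deriv_inv_ne_zero)).2.comp_tendsto
          (Filter.tendsto_id.prodMk (Filter.tendsto_pure_pure (fun _ => chartAt ℂ p p) ()
            |>.comp Filter.tendsto_const_pure))
      have s1 : inChart W p (chartAt ℂ p p) = 0 := by simp [inChart, hW, hZ.pole]
      have s2 : inChart (fun y => (starRingEnd ℂ) (W (φ y))) p (chartAt ℂ p p) = 0 := by
        simp [inChart, hW, hZ.pole, hp]
      simp only [s1, s2, sub_zero, Function.comp_def, id] at t1 t2
      exact t1.trans t2
    have e4 := e3.comp_tendsto ((chartAt ℂ p).continuousAt (mem_chart_source ℂ p)).tendsto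
    refine e4.congr' ?_ ?_ <;>
    · filter_upwards [eventually_mem_source p] with y hy
      simp [inChart, hy]
  obtain ⟨K, hK⟩ := (h2.comp_tendsto hZ.tendsto_pt_cobounded).bound
  have hK' := hK.and (Bornology.eventually_ne_cobounded (0 : ℂ))
  rw [← comap_norm_atTop, Filter.eventually_comap] at hK'
  obtain ⟨R, hR⟩ := Filter.eventually_atTop.1 hK'
  obtain ⟨a, b, hab⟩ := exists_affine_of_linear_growth h1 (K := K) (R := R) (fun z hz => by
    obtain ⟨h3, h4⟩ := hR ‖z‖ hz z rfl
    simp only [Function.comp, hW, hZ.apply_pt, norm_neg, norm_inv, RCLike.norm_conj] at h3 ⊢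
    have h5 : 0 < ‖z‖ := norm_pos_iff.2 h4
    by_cases h6 : ‖Z (φ (hZ.pt z))‖ = 0
    · rw [h6] at h3 ⊢
      simp at h3
      exact absurd h3 h4
    · have h7 : 0 < ‖Z (φ (hZ.pt z))‖ := lt_of_le_of_ne (norm_nonneg _) (Ne.symm h6)
      rwa [← div_eq_mul_inv, le_div_iff₀ h7, ← div_eq_inv_mul, div_le_iff₀ h5] at h3)
  refine ⟨a, b, fun y hy => ?_⟩
  have := hab (Z y)
  rwa [hZ.pt_apply hy] at this

/-- A coordinate with pole at a given fixed point, for which the involution is the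
conjugation. -/
theorem IsAntiholomorphic.exists_conj {φ : X → X} (hφ : IsAntiholomorphic φ)
    (hφφ : ∀ x, φ (φ x) = x) (hZ : IsCoord p Z) (hp : φ p = p) :
    ∃ Z', IsCoord p Z' ∧ ∀ y, y ≠ p → Z' (φ y) = (starRingEnd ℂ) (Z' y) := by
  have hne : ∀ y, y ≠ p → φ y ≠ p := fun y hy h => hy (by rw [← hφφ y, h, hp])
  obtain ⟨A, B, hAB⟩ := hφ.exists_affine hφφ hZ hp
  have h1 : ∀ z : ℂ, z = (starRingEnd ℂ) A * (A * z + B) + (starRingEnd ℂ) B := by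
    intro z
    have e1 := hAB _ (hZ.pt_ne z)
    have e2 := hAB _ (hne _ (hZ.pt_ne z))
    rw [hφφ, hZ.apply_pt] at e2
    rw [hZ.apply_pt] at e1
    have := congrArg (starRingEnd ℂ) e2
    rw [Complex.conj_conj] at this
    rw [← e1]
    simpa using this
  have h2 := h1 0
  have h3 : (starRingEnd ℂ) A * A = 1 := by linear_combination h2 - h1 1
  obtain ⟨m, hm⟩ := IsAlgClosed.exists_pow_nat_eq A (n := 2) (by norm_num)
  have hm0 : m ≠ 0 := by rintro rfl; rw [← hm] at h3; simp at h3
  have h4 : (starRingEnd ℂ) m * m = 1 := by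
    have h5 : ((starRingEnd ℂ) m * m) ^ 2 = 1 := by rw [mul_pow, ← map_pow, hm, h3]
    rw [mul_comm, Complex.mul_conj] at h5 ⊢
    norm_cast at h5 ⊢
    have := Complex.normSq_nonneg m
    nlinarith
  have h5 : m * (starRingEnd ℂ) A = (starRingEnd ℂ) m := by
    rw [← hm, map_pow]
    linear_combination (starRingEnd ℂ) m * h4
  obtain ⟨Z', hZ', hZ'Z⟩ := hZ.exists_affine hm0 (-m * (starRingEnd ℂ) B / 2)
  refine ⟨Z', hZ', fun y hy => ?_⟩
  rw [hZ'Z y hy, hZ'Z _ (hne y hy)]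
  have e1 := congrArg (starRingEnd ℂ) (hAB y hy)
  rw [Complex.conj_conj] at e1
  rw [e1]
  simp only [map_add, map_mul, map_neg, map_div₀, Complex.conj_conj, map_ofNat]
  rw [← h5]
  linear_combination -(m / 2) * h2

end Coord

section Disk

variable {X : Type*} [TopologicalSpace X] [ChartedSpace ℂ X] {I B : Type*}

/-- A coordinate on a disk, with pole at a boundary point which is not marked, mapping the
disk to the upper half plane. -/
structure MarkedDisk.IsRealCoord (C : MarkedDisk X I B) (p : X) (Z : X → ℂ) : Prop
    extends IsCoord p Z where
  φ_pole : C.φ p = p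
  pole_notMem : p ∉ C.M
  conj : ∀ y, y ≠ p → Z (C.φ y) = (starRingEnd ℂ) (Z y)
  mem_half : ∀ y, y ≠ p → (y ∈ C.half ↔ 0 ≤ (Z y).im)

namespace MarkedDisk

theorem IsRealCoord.φ_ne {C : MarkedDisk X I B} {p : X} {Z : X → ℂ} (hZ : C.IsRealCoord p Z)
    {y : X} (hy : y ≠ p) : C.φ y ≠ p := fun h => hy (by rw [← C.φ_φ y, h, hZ.φ_pole])

variable (C : MarkedDisk X I B)

theorem φ_injective : Function.Injective C.φ := Function.Involutive.injective C.φ_φ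

theorem φ_image_half : C.φ '' C.half = C.φ ⁻¹' C.half :=
  congrFun (Function.Involutive.image_eq_preimage_symm C.φ_φ) _

theorem M_finite [Finite I] [Finite B] : C.M.Finite :=
  ((Set.finite_range _).union (Set.finite_range _)).union (Set.finite_range _)

theorem φ_mem_M {x : X} (hx : x ∈ C.M) : C.φ x ∈ C.M := by
  rcases hx with (⟨i, rfl⟩ | ⟨i, rfl⟩) | ⟨j, rfl⟩
  · exact Or.inl (Or.inr ⟨i, rfl⟩)
  · exact Or.inl (Or.inl ⟨i, (C.φ_φ _).symm⟩)
  · exact Or.inr ⟨j, (C.x_fix j).symm⟩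

theorem φ_mem_M_iff {x : X} : C.φ x ∈ C.M ↔ x ∈ C.M :=
  ⟨fun h => by simpa [C.φ_φ] using C.φ_mem_M h, C.φ_mem_M⟩

theorem isotropy_φ (r : ℕ) (x : X) : isotropy r C.M (C.φ x) = isotropy r C.M x := by
  by_cases hx : x ∈ C.M
  · rw [isotropy_of_mem hx, isotropy_of_mem (C.φ_mem_M hx)]
  · rw [isotropy_of_notMem hx, isotropy_of_notMem (C.φ_mem_M_iff.not.2 hx)]

theorem mem_half_of_fix {x : X} (hx : C.φ x = x) : x ∈ C.half :=
  (C.half_inter.symm.subset hx).1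

theorem fix_of_mem {x : X} (hx : x ∈ C.half) (hx' : C.φ x ∈ C.half) : C.φ x = x :=
  C.half_inter.subset ⟨hx, ⟨_, hx', C.φ_φ x⟩⟩

theorem mem_half_or (x : X) : x ∈ C.half ∨ C.φ x ∈ C.half := by
  have : x ∈ C.half ∪ C.φ '' C.half := by simp [C.half_union]
  rwa [φ_image_half] at this

theorem exists_fix : ∃ p, C.φ p = p := by
  have := C.sphere.connectedSpace
  obtain ⟨x₀⟩ := (inferInstance : Nonempty X)
  have h1 : ∃ x, x ∈ C.half := by
    rcases C.mem_half_or x₀ with h | h <;> exact ⟨_, h⟩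
  obtain ⟨x, hx⟩ := h1
  obtain ⟨y, -, hy, hy'⟩ := isPreconnected_closed_iff.1 (isPreconnected_univ (α := X))
    C.half (C.φ ⁻¹' C.half) C.half_closed (C.half_closed.preimage C.φ_anti.1)
    (fun x _ => C.mem_half_or x) ⟨x, trivial, hx⟩ ⟨C.φ x, trivial, by simpa [C.φ_φ] using hx⟩
  exact ⟨y, C.fix_of_mem hy hy'⟩

variable [IsManifold 𝓘(ℂ, ℂ) ω X]

theorem exists_isRealCoord_of_fix {p : X} (hp : C.φ p = p) (hpM : p ∉ C.M) :
    ∃ Z, C.IsRealCoord p Z := by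
  have := C.sphere.t2Space
  have hne : ∀ y, y ≠ p → C.φ y ≠ p := fun y hy h => hy (by rw [← C.φ_φ y, h, hp])
  obtain ⟨q, Z₀, hZ₀⟩ := C.sphere.exists_coord
  obtain ⟨Z₁, hZ₁⟩ := hZ₀.exists_pole p
  obtain ⟨Z, hZ, hconj⟩ := C.φ_anti.exists_conj C.φ_φ hZ₁ hp
  have key : ∀ Z', IsCoord p Z' → (∀ y, y ≠ p → Z' (C.φ y) = (starRingEnd ℂ) (Z' y)) →
      (∀ y, y ≠ p → 0 < (Z' y).im → y ∈ C.half) → C.IsRealCoord p Z' := by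
    intro Z' h1 h2 h3
    refine ⟨h1, hp, hpM, h2, fun y hy => ⟨fun h => ?_, fun h => ?_⟩⟩
    · by_contra h4
      have h5 : C.φ y ∈ C.half := h3 _ (hne y hy) (by rw [h2 y hy, Complex.conj_im]; linarith)
      have h6 := h2 y hy
      rw [C.fix_of_mem h h5] at h6
      have := congrArg Complex.im h6
      rw [Complex.conj_im] at this
      linarith
    · rcases h.lt_or_eq with h4 | h4
      · exact h3 y hy h4
      · refine C.mem_half_of_fix (h1.inj _ _ (hne y hy) hy ?_)
        rw [h2 y hy, Complex.conj_eq_iff_im, h4]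
  have hH : IsPreconnected (hZ.pt '' {z : ℂ | 0 < z.im}) :=
    (convex_halfSpace_im_gt 0).isPreconnected.image _ hZ.continuous_pt.continuousOn
  by_cases hcase : ∃ y, y ≠ p ∧ 0 < (Z y).im ∧ y ∉ C.half
  · obtain ⟨y, hy, hy0, hyh⟩ := hcase
    have h1 : ∀ y, y ≠ p → 0 < (Z y).im → C.φ y ∈ C.half := by
      intro y' hy' hy'0
      by_contra h2
      obtain ⟨w, ⟨z, hz, rfl⟩, hw, hw'⟩ := isPreconnected_closed_iff.1 hH
        C.half (C.φ ⁻¹' C.half) C.half_closed (C.half_closed.preimage C.φ_anti.1)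
        (fun x _ => C.mem_half_or x)
        ⟨y', ⟨Z y', hy'0, hZ.pt_apply hy'⟩, (C.mem_half_or y').resolve_right h2⟩
        ⟨y, ⟨Z y, hy0, hZ.pt_apply hy⟩, (C.mem_half_or y).resolve_left hyh⟩
      have h3 := hconj _ (hZ.pt_ne z)
      rw [C.fix_of_mem hw hw', hZ.apply_pt] at h3
      have := congrArg Complex.im h3
      rw [Complex.conj_im] at this
      have hz' : 0 < z.im := hz
      linarith
    obtain ⟨Z', hZ', hZ'Z⟩ := hZ.exists_affine (a := -1) (by simp) 0
    refine ⟨Z', key Z' hZ' ?_ ?_⟩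
    · intro y hy
      rw [hZ'Z y hy, hZ'Z _ (hne y hy), hconj y hy]; simp
    · intro y hy h2
      rw [hZ'Z y hy] at h2
      have := h1 _ (hne y hy) (by
        rw [hconj y hy, Complex.conj_im]; simpa using h2)
      rwa [C.φ_φ] at this
  · push Not at hcase
    exact ⟨Z, key Z hZ hconj hcase⟩

theorem exists_isRealCoord [Finite I] [Finite B] : ∃ p Z, C.IsRealCoord p Z := by
  have := C.sphere.t2Space
  obtain ⟨p₀, hp₀⟩ := C.exists_fix
  obtain ⟨q, Z₀, hZ₀⟩ := C.sphere.exists_coord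
  obtain ⟨Z₁, hZ₁⟩ := hZ₀.exists_pole p₀
  obtain ⟨Z, hZ, hconj⟩ := C.φ_anti.exists_conj C.φ_φ hZ₁ hp₀
  have h1 : (Set.range fun s : ℝ => hZ.pt (s : ℂ)).Infinite :=
    Set.infinite_range_of_injective (hZ.pt_injective.comp Complex.ofReal_injective)
  obtain ⟨_, ⟨s, rfl⟩, hs⟩ := (h1.sdiff C.M_finite).nonempty
  have h2 : C.φ (hZ.pt s) = hZ.pt s := by
    refine hZ.inj _ _ (fun h => hZ.pt_ne s ?_) (hZ.pt_ne _) ?_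
    · rw [← C.φ_φ (hZ.pt s), h, hp₀]
    · rw [hconj _ (hZ.pt_ne _), hZ.apply_pt, Complex.conj_ofReal]
  obtain ⟨Z', hZ'⟩ := C.exists_isRealCoord_of_fix h2 hs
  exact ⟨_, Z', hZ'⟩

end MarkedDisk

end Disk
end RSpin

namespace RSpin

set_option linter.unusedSectionVars false

/-! ### Positive cotangent vectors on the boundary of a disk -/

section Positive

variable {X : Type*} [TopologicalSpace X] [ChartedSpace ℂ X] [IsManifold 𝓘(ℂ, ℂ) ω X]
  {I B : Type*} {C : MarkedDisk X I B} {p q : X} {Z : X → ℂ}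

/-- `F` is a holomorphic coordinate near `q`, mapping the disk to the upper half plane. -/
structure MarkedDisk.IsBoundaryCoord (C : MarkedDisk X I B) (q : X) (F : X → ℂ) : Prop where
  mdiff : MDifferentiableAt 𝓘(ℂ, ℂ) 𝓘(ℂ, ℂ) F q
  deriv_ne_zero : deriv (inChart F q) (chartAt ℂ q q) ≠ 0
  conj : ∀ᶠ y in 𝓝 q, (starRingEnd ℂ) (F (C.φ y)) = F y
  mem_half : ∀ᶠ y in 𝓝 q, y ∈ C.half ↔ 0 ≤ (F y).im

theorem MarkedDisk.IsRealCoord.isBoundaryCoord [T1Space X] (hZ : C.IsRealCoord p Z)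
    (hqp : q ≠ p) : C.IsBoundaryCoord q Z where
  mdiff := hZ.mdiff q hqp
  deriv_ne_zero := hZ.toIsCoord.deriv_ne_zero (mem_chart_source ℂ q) hqp
  conj := by
    filter_upwards [IsCoord.eventually_ne hqp] with y hy
    rw [hZ.conj y hy, Complex.conj_conj]
  mem_half := by
    filter_upwards [IsCoord.eventually_ne hqp] with y hy using hZ.mem_half y hy

theorem MarkedDisk.IsRealCoord.isBoundaryCoord_pole [T1Space X] (hZ : C.IsRealCoord p Z) :
    C.IsBoundaryCoord p (fun y => -(Z y)⁻¹) where
  mdiff := hZ.mdiff_inv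
  deriv_ne_zero := hZ.toIsCoord.deriv_inv_ne_zero
  conj := by
    refine Filter.Eventually.of_forall fun y => ?_
    by_cases hy : y = p
    · simp [hy, hZ.φ_pole, hZ.pole]
    · simp [hZ.conj y hy]
  mem_half := by
    filter_upwards [hZ.toIsCoord.eventually_ne_zero] with y hy
    by_cases hyp : y = p
    · simp [hyp, hZ.pole, C.mem_half_of_fix hZ.φ_pole]
    · rw [hZ.mem_half y hyp, Complex.neg_im, Complex.inv_im, neg_div, neg_neg]
      have := Complex.normSq_pos.2 (hy hyp)
      constructor
      · intro h; positivity
      · intro h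
        by_contra h'
        have := div_neg_of_neg_of_pos (not_le.1 h') this
        linarith

theorem IsAntiholomorphic.differential_conj_comp' {φ : X → X} (h : IsAntiholomorphic φ)
    {F : X → ℂ} {x y : X} (hy : φ x = y) (hF : MDifferentiableAt 𝓘(ℂ, ℂ) 𝓘(ℂ, ℂ) F y) (u : ℂ) :
    differential (fun y => (starRingEnd ℂ) (F (φ y))) x u =
      (starRingEnd ℂ) (differential F y (tangentMapAt φ x y u)) := by
  subst hy
  exact h.differential_conj_comp hF u

theorem differential_congr {F G : X → ℂ} {x : X} (h : F =ᶠ[𝓝 x] G) :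
    differential F x = differential G x := h.mfderiv_eq

namespace MarkedDisk.IsBoundaryCoord

variable {F : X → ℂ}

theorem differential_ne_zero (hF : C.IsBoundaryCoord q F) : differential F q ≠ 0 := by
  rw [differential_eq (mem_chart_source ℂ q) hF.mdiff]
  exact smul_ne_zero hF.deriv_ne_zero (dz_ne_zero (mem_chart_source ℂ q))

theorem conj_differential (hF : C.IsBoundaryCoord q F) (hq : C.φ q = q) (u : ℂ) :
    (starRingEnd ℂ) (differential F q (tangentMapAt C.φ q q u)) = differential F q u := by
  rw [← C.φ_anti.differential_conj_comp' hq hF.mdiff u, differential_congr hF.conj]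

theorem tangentMapAt_eq_iff (hF : C.IsBoundaryCoord q F) (hq : C.φ q = q)
    (u : TangentSpace 𝓘(ℂ, ℂ) q) :
    tangentMapAt C.φ q q u = u ↔ (differential F q u).im = 0 := by
  have h1 := hF.conj_differential hq u
  rw [← Complex.conj_eq_iff_im]
  constructor
  · intro h
    rwa [h] at h1
  · intro h
    have h2 : differential F q (tangentMapAt C.φ q q u) = differential F q u := by
      rw [← Complex.conj_conj (differential F q (tangentMapAt C.φ q q u)), h1, h]
    have h3 : ∀ a b : ℂ, differential F q a = differential F q b → a = b := by
      intro a b hab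
      have := (clm_apply_eq_zero_iff (ξ := differential F q) hF.differential_ne_zero (a - b)).1
        ((map_sub (differential F q) a b).trans (sub_eq_zero.2 hab))
      exact sub_eq_zero.1 this
    exact h3 _ _ h2

theorem im_eq_zero (hF : C.IsBoundaryCoord q F) (hq : C.φ q = q) : (F q).im = 0 := by
  have := hF.conj.self_of_nhds
  rwa [hq, Complex.conj_eq_iff_im] at this

theorem isPosTangent_iff (hF : C.IsBoundaryCoord q F) (hq : C.φ q = q) (u : ℂ) :
    C.IsPosTangent q u ↔ 0 < (differential F q u).re ∧ (differential F q u).im = 0 := by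
  refine Iff.trans (and_congr Iff.rfl (and_congr (hF.tangentMapAt_eq_iff hq u) Iff.rfl)) ?_
  change (u ≠ (0 : ℂ) ∧ (differential F q u).im = 0 ∧ ∀ᶠ s : ℝ in 𝓝[>] 0,
    (chartAt ℂ q).symm (chartAt ℂ q q + (s : ℂ) * (Complex.I * u)) ∈ C.half) ↔ _
  have hD : differential F q u = deriv (inChart F q) (chartAt ℂ q q) * u :=
    differential_apply hF.mdiff u
  set a := deriv (inChart F q) (chartAt ℂ q q) with ha
  set c₀ := chartAt ℂ q q
  have hda : HasDerivAt (inChart F q) a c₀ :=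
    (differentiableAt_inChart (mem_chart_source ℂ q) hF.mdiff).hasDerivAt
  have hline : HasDerivAt (fun s : ℝ => c₀ + (s : ℂ) * (Complex.I * u)) (Complex.I * u) 0 := by
    have := ((Complex.ofRealCLM.hasDerivAt (x := (0 : ℝ))).mul_const (Complex.I * u)).const_add c₀
    simpa using this
  have hcomp : HasDerivAt (fun s : ℝ => inChart F q (c₀ + (s : ℂ) * (Complex.I * u)))
      (a * (Complex.I * u)) 0 := by
    refine HasDerivAt.comp_of_eq (h₂ := inChart F q)
      (h := fun s : ℝ => c₀ + (s : ℂ) * (Complex.I * u)) 0 hda hline ?_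
    simp
  have him : HasDerivAt (fun s : ℝ => (inChart F q (c₀ + (s : ℂ) * (Complex.I * u))).im)
      (a * u).re 0 := by
    have := Complex.imCLM.hasFDerivAt.comp_hasDerivAt (0 : ℝ) hcomp
    have e : Complex.imCLM (a * (Complex.I * u)) = (a * u).re := by
      simp; ring
    rw [e] at this
    exact this
  have hzero : (inChart F q (c₀ + ((0 : ℝ) : ℂ) * (Complex.I * u))).im = 0 := by
    simpa [inChart, c₀] using hF.im_eq_zero hq
  have hslope := hasDerivAt_iff_tendsto_slope.1 him
  have hright : Filter.Tendsto (slope (fun s : ℝ =>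
      (inChart F q (c₀ + (s : ℂ) * (Complex.I * u))).im) 0) (𝓝[>] 0) (𝓝 (a * u).re) :=
    hslope.mono_left (nhdsWithin_mono _ fun s hs => ne_of_gt hs)
  have htend : Filter.Tendsto (fun s : ℝ => (chartAt ℂ q).symm (c₀ + (s : ℂ) * (Complex.I * u)))
      (𝓝[>] 0) (𝓝 q) := by
    refine (IsAntiholomorphic.tendsto_symm q).comp ?_
    have := hline.continuousAt.tendsto
    simp only [Complex.ofReal_zero, zero_mul, add_zero] at this
    exact this.mono_left nhdsWithin_le_nhds
  have hhalf := htend.eventually hF.mem_half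
  rw [hD]
  constructor
  · rintro ⟨hu, hre, hin⟩
    refine ⟨?_, hre⟩
    have hne : (a * u).re ≠ 0 := by
      intro h
      have : a * u = 0 := Complex.ext h hre
      rcases mul_eq_zero.1 this with h | h
      · exact hF.deriv_ne_zero h
      · exact hu h
    by_contra hneg
    have hlt : (a * u).re < 0 := lt_of_le_of_ne (not_lt.1 hneg) hne
    obtain ⟨s, h1, h2, h3, h4⟩ := (hin.and (hhalf.and ((hright.eventually (gt_mem_nhds hlt)).and
      self_mem_nhdsWithin))).exists
    have h5 := h2.1 h1
    rw [slope_def_field, hzero, sub_zero, sub_zero] at h3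
    have : 0 ≤ (inChart F q (c₀ + (s : ℂ) * (Complex.I * u))).im / s :=
      div_nonneg h5 (le_of_lt h4)
    linarith
  · rintro ⟨hpos, hre⟩
    refine ⟨?_, hre, ?_⟩
    · rintro rfl
      simp at hpos
    · filter_upwards [hhalf, hright.eventually (lt_mem_nhds hpos), self_mem_nhdsWithin]
        with s h1 h2 h3
      refine h1.2 ?_
      rw [slope_def_field, hzero, sub_zero, sub_zero] at h2
      have h3' : (0 : ℝ) < s := h3
      exact (by simpa using (div_pos_iff_of_pos_right h3').1 h2 :
        0 < (inChart F q (c₀ + (s : ℂ) * (Complex.I * u))).im).le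

theorem exists_isPosTangent (hF : C.IsBoundaryCoord q F) (hq : C.φ q = q) :
    ∃ u : ℂ, C.IsPosTangent q u ∧ differential F q u = (1 : ℂ) := by
  have ha := hF.deriv_ne_zero
  have h1 : differential F q ((deriv (inChart F q) (chartAt ℂ q q))⁻¹ : ℂ) = (1 : ℂ) :=
    (differential_apply hF.mdiff _).trans (mul_inv_cancel₀ ha)
  refine ⟨_, (hF.isPosTangent_iff hq _).2 ?_, h1⟩
  rw [h1]
  simp

theorem isPos_smul_iff (hF : C.IsBoundaryCoord q F) (hq : C.φ q = q) (c : ℂ) :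
    C.IsPos q (c • differential F q) ↔ 0 < c.re ∧ c.im = 0 := by
  constructor
  · intro h
    obtain ⟨u, hu, hu1⟩ := hF.exists_isPosTangent hq
    have h2 : (c • differential F q) u = c := by
      change c * differential F q u = c
      rw [hu1, mul_one]
    have := h u hu
    rwa [h2] at this
  · intro h u hu
    obtain ⟨h1, h2⟩ := (hF.isPosTangent_iff hq u).1 hu
    change 0 < (c * differential F q u).re ∧ (c * differential F q u).im = 0
    rw [Complex.mul_re, Complex.mul_im, h2, h.2]
    simp [h.1, h1]

end MarkedDisk.IsBoundaryCoord

namespace MarkedDisk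

theorem IsPos.smul {ξ : Cotangent q} (h : C.IsPos q ξ) {s : ℝ} (hs : 0 < s) :
    C.IsPos q ((s : ℂ) • ξ) := by
  intro u hu
  obtain ⟨h1, h2⟩ := h u hu
  change 0 < ((s : ℂ) * ξ u).re ∧ ((s : ℂ) * ξ u).im = 0
  simp [h1, h2, hs]

variable [Finite I] [Finite B]

theorem exists_isBoundaryCoord (C : MarkedDisk X I B) (q : X) :
    ∃ F, C.IsBoundaryCoord q F := by
  have := C.sphere.t2Space
  obtain ⟨p, Z, hZ⟩ := C.exists_isRealCoord
  by_cases h : q = p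
  · subst h; exact ⟨_, hZ.isBoundaryCoord_pole⟩
  · exact ⟨_, hZ.isBoundaryCoord h⟩

theorem IsPos.ne_zero (hq : C.φ q = q) {ξ : Cotangent q} (h : C.IsPos q ξ) : ξ ≠ 0 := by
  rintro rfl
  obtain ⟨F, hF⟩ := C.exists_isBoundaryCoord q
  obtain ⟨u, hu, -⟩ := hF.exists_isPosTangent hq
  have h0 : 0 < (0 : ℂ).re := (h u hu).1
  simp at h0

theorem IsPos.exists_eq_smul (hq : C.φ q = q) {ξ ξ' : Cotangent q} (h : C.IsPos q ξ)
    (h' : C.IsPos q ξ') : ∃ s : ℝ, 0 < s ∧ ξ = (s : ℂ) • ξ' := by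
  obtain ⟨F, hF⟩ := C.exists_isBoundaryCoord q
  obtain ⟨c, rfl⟩ := clm_exists_smul (ξ := differential F q) hF.differential_ne_zero ξ
  obtain ⟨c', rfl⟩ := clm_exists_smul (ξ := differential F q) hF.differential_ne_zero ξ'
  obtain ⟨h1, h2⟩ := (hF.isPos_smul_iff hq c).1 h
  obtain ⟨h1', h2'⟩ := (hF.isPos_smul_iff hq c').1 h'
  refine ⟨c.re / c'.re, div_pos h1 h1', ?_⟩
  have e : c = ((c.re / c'.re : ℝ) : ℂ) * c' := by
    apply Complex.ext
    · simp [h2']; field_simp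
    · simp [h2, h2']
  exact (congrArg (fun a : ℂ => a • differential F q) e).trans
    (smul_smul ((c.re / c'.re : ℝ) : ℂ) c' (differential F q)).symm

/-- A continuous positive section of the cotangent bundle over the boundary. -/
theorem exists_isPos_form (C : MarkedDisk X I B) :
    ∃ η : ∀ y : X, Cotangent y, ∀ q, C.φ q = q → C.IsPos q (η q) ∧
      ∃ h : X → ℂ, ContinuousAt h q ∧ h q ≠ 0 ∧ ∀ᶠ y in 𝓝 q, η y = h y • dz q y := by
  classical
  have := C.sphere.t2Space
  obtain ⟨p, Z, hZ⟩ := C.exists_isRealCoord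
  set V : X → ℂ := fun y => -(Z y)⁻¹ with hV
  have hreal : ∀ z : ℂ, z.im = 0 → 0 < ((1 + z ^ 2)⁻¹).re ∧ ((1 + z ^ 2)⁻¹).im = 0 := by
    intro z hz
    have e : (1 + z ^ 2)⁻¹ = (((1 + z.re ^ 2)⁻¹ : ℝ) : ℂ) := by
      have : z = (z.re : ℂ) := Complex.ext rfl (by simp [hz])
      rw [this]; push_cast; simp
    rw [e]
    refine ⟨?_, Complex.ofReal_im _⟩
    rw [Complex.ofReal_re]
    positivity
  have hcont : ∀ (q : X) (F : X → ℂ), C.φ q = q → C.IsBoundaryCoord q F →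
      (∀ᶠ y in 𝓝 q, MDifferentiableAt 𝓘(ℂ, ℂ) 𝓘(ℂ, ℂ) F y) →
      C.IsPos q ((1 + F q ^ 2)⁻¹ • differential F q) ∧ ∃ h : X → ℂ, ContinuousAt h q ∧ h q ≠ 0 ∧
      ∀ᶠ y in 𝓝 q, (1 + F y ^ 2)⁻¹ • differential F y = h y • dz q y := by
    intro q F hq hF hmd
    have h0 := hreal (F q) (hF.im_eq_zero hq)
    have h1 : (1 + F q ^ 2)⁻¹ ≠ 0 := by
      intro h; rw [h] at h0; simp at h0
    refine ⟨(hF.isPos_smul_iff hq _).2 h0, fun y => (1 + F y ^ 2)⁻¹ *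
      deriv (inChart F q) (chartAt ℂ q y), ?_, mul_ne_zero h1 hF.deriv_ne_zero, ?_⟩
    · refine ContinuousAt.mul ?_ ?_
      · exact (continuousAt_const.add (hmd.self_of_nhds.continuousAt.pow 2)).inv₀
          fun h' : 1 + F q ^ 2 = 0 => h1 (by rw [h', inv_zero])
      · exact ContinuousAt.comp (g := deriv (inChart F q))
          (analyticAt_inChart hmd).deriv.continuousAt
          ((chartAt ℂ q).continuousAt (mem_chart_source ℂ q))
    · filter_upwards [hmd, eventually_mem_source q] with y hy hys
      rw [differential_eq hys hy, smul_smul]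
  refine ⟨fun y => if y = p then differential V y else (1 + Z y ^ 2)⁻¹ • differential Z y,
    fun q hq => ?_⟩
  by_cases hqp : q = p
  · subst hqp
    obtain ⟨h1, h, h2, h3, h4⟩ := hcont q V hq hZ.isBoundaryCoord_pole
      hZ.toIsCoord.eventually_mdiff_inv
    have hV0 : V q = 0 := by simp [hV, hZ.pole]
    rw [hV0] at h1
    refine ⟨by simpa using h1, h, h2, h3, ?_⟩
    filter_upwards [h4, hZ.toIsCoord.eventually_ne_zero, hZ.toIsCoord.eventually_mdiff_inv]
      with y hy hy0 hmd
    by_cases hyq : y = q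
    · subst hyq
      rw [← hy, if_pos rfl, hV0]; simp
    · have hZ0 := hy0 hyq
      rw [if_neg hyq, ← hy, differential_eq_sq_smul (hZ.mdiff y hyq) hZ0, smul_smul]
      congr 1
      by_cases hc : 1 + Z y ^ 2 = 0
      · have : 1 + V y ^ 2 = 0 := by
          simp only [hV]; field_simp; linear_combination hc
        rw [this, hc]; simp
      · have : 1 + V y ^ 2 ≠ 0 := by
          simp only [hV]; intro h; apply hc; field_simp at h; linear_combination h
        field_simp
        simp only [hV]
        field_simp
        ring
  · obtain ⟨h1, h, h2, h3, h4⟩ := hcont q Z hq (hZ.isBoundaryCoord hqp)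
      (hZ.toIsCoord.eventually_mdiff hqp)
    refine ⟨by simpa [hqp] using h1, h, h2, h3, ?_⟩
    filter_upwards [h4, IsCoord.eventually_ne hqp] with y hy hyp
    rw [if_neg hyp, hy]

end MarkedDisk

end Positive
end RSpin

namespace RSpin

set_option linter.unusedSectionVars false

/-! ### Liftings and isomorphisms -/

section Isomorphisms

variable {X : Type*} [TopologicalSpace X] [ChartedSpace ℂ X] [IsManifold 𝓘(ℂ, ℂ) ω X]
  {r : ℕ} {M : Set X} {S S' S'' : TwistedSpinBundle X r M}

namespace TwistedSpinBundle.Iso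

theorem symm_scalar (f : Iso S S') (y : X) : f.symm.scalar y = (f.scalar y)⁻¹ := by
  simp [symm]

theorem trans_scalar (f : Iso S S') (g : Iso S' S'') (y : X) :
    (f.trans g).scalar y = f.scalar y * g.scalar y := by
  simp [trans]

theorem symm_apply_apply (f : Iso S S') (y : X) (v : S.fiber y) :
    f.symm.toEquiv y (f.toEquiv y v) = v := by
  apply (S.fiberCoord y).injective
  rw [fiberCoord_apply, fiberCoord_apply, symm_scalar, inv_mul_cancel_left₀ (f.scalar_ne_zero y)]

theorem apply_symm_apply (f : Iso S S') (y : X) (v : S'.fiber y) :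
    f.toEquiv y (f.symm.toEquiv y v) = v := by
  apply (S'.fiberCoord y).injective
  rw [fiberCoord_apply, fiberCoord_apply, symm_scalar, mul_inv_cancel_left₀ (f.scalar_ne_zero y)]

theorem trans_apply (f : Iso S S') (g : Iso S' S'') (y : X) (v : S.fiber y) :
    (f.trans g).toEquiv y v = g.toEquiv y (f.toEquiv y v) := by
  apply (S''.fiberCoord y).injective
  rw [fiberCoord_apply, fiberCoord_apply, fiberCoord_apply, trans_scalar]
  ring

/-- The isomorphism in the frames at `x`. -/
noncomputable def frameScalar (f : Iso S S') (x : X) (t : ℂ) : ℂ :=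
  S'.triv x t (orbiChart r M x t) (f.toEquiv (orbiChart r M x t) (S.frame x t))

theorem analyticAt_frameScalar (f : Iso S S') (x : X) : AnalyticAt ℂ (f.frameScalar x) 0 :=
  f.holomorphic x

theorem frameScalar_ne_zero (f : Iso S S') (x : X) (t : ℂ) : f.frameScalar x t ≠ 0 := by
  simp [frameScalar, OrbiLineBundle.frame]

theorem apply_frame (f : Iso S S') (x : X) (t : ℂ) :
    f.toEquiv (orbiChart r M x t) (S.frame x t) = f.frameScalar x t • S'.frame x t := by
  apply (S'.triv x t _).injective
  simp [frameScalar, OrbiLineBundle.frame]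

theorem triv_apply (f : Iso S S') {x : X} {t : ℂ} {y : X} (h : orbiChart r M x t = y)
    (v : S.fiber y) : S'.triv x t y (f.toEquiv y v) = f.frameScalar x t * S.triv x t y v := by
  subst h
  have : v = S.triv x t _ v • S.frame x t := by
    apply (S.triv x t _).injective
    simp [OrbiLineBundle.frame]
  conv_lhs => rw [this]
  rw [map_smul, map_smul, smul_eq_mul, mul_comm, frameScalar]

end TwistedSpinBundle.Iso

variable {I B : Type*} {C : MarkedDisk X I B}

namespace DiskSpin

/-- The inverse isomorphism. -/
noncomputable def Iso.symm {S S' : DiskSpin C r} (f : Iso S S') : Iso S' S where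
  toIso := f.toIso.symm
  comm_inv x y h hx v := by
    apply (f.toEquiv y).injective
    rw [f.toIso.apply_symm_apply, f.comm_inv, f.toIso.apply_symm_apply]

/-- The composition of isomorphisms. -/
noncomputable def Iso.trans {S S' S'' : DiskSpin C r} (f : Iso S S') (g : Iso S' S'') :
    Iso S S'' where
  toIso := f.toIso.trans g.toIso
  comm_inv x y h hx v := by
    rw [f.toIso.trans_apply, f.toIso.trans_apply, f.comm_inv, g.comm_inv]

variable {S S' : DiskSpin C r} {v v' v'' : ∀ x, S.fiber x} {p : X}

theorem EquivS.symm (h : S.EquivS v v') : S.EquivS v' v := by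
  obtain ⟨c, hc, h⟩ := h
  refine ⟨fun x => (c x)⁻¹, hc.inv₀ fun x hx => (h x hx).1.ne', fun x hx => ?_⟩
  obtain ⟨h1, h2⟩ := h x hx
  refine ⟨inv_pos.2 h1, ?_⟩
  rw [h2, smul_smul, ← Complex.ofReal_mul, inv_mul_cancel₀ h1.ne', Complex.ofReal_one, one_smul]

theorem EquivS.trans (h : S.EquivS v v') (h' : S.EquivS v' v'') : S.EquivS v v'' := by
  obtain ⟨c, hc, h⟩ := h
  obtain ⟨c', hc', h'⟩ := h'
  refine ⟨fun x => c x * c' x, hc.mul hc', fun x hx => ⟨mul_pos (h x hx).1 (h' x hx).1, ?_⟩⟩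
  rw [(h x hx).2, (h' x hx).2, smul_smul, ← Complex.ofReal_mul]

theorem EquivS.illegalS_iff (h : S.EquivS v v') : S.IllegalS v p ↔ S.IllegalS v' p :=
  ⟨fun ⟨w, h1, h2, h3⟩ => ⟨w, h1, h2.trans h, h3⟩,
    fun ⟨w, h1, h2, h3⟩ => ⟨w, h1, h2.trans h.symm, h3⟩⟩

theorem EquivS.map (f : Iso S S') (h : S.EquivS v v') :
    S'.EquivS (fun x => f.toEquiv x (v x)) (fun x => f.toEquiv x (v' x)) := by
  obtain ⟨c, hc, h⟩ := h
  refine ⟨c, hc, fun x hx => ⟨(h x hx).1, ?_⟩⟩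
  change f.toEquiv x (v x) = (c x : ℂ) • f.toEquiv x (v' x)
  rw [(h x hx).2, map_smul]

theorem IsLiftingS.map (f : Iso S S') (h : S.IsLiftingS v) :
    S'.IsLiftingS (fun x => f.toEquiv x (v x)) where
  continuous x hx := by
    have h1 : ContinuousAt (fun y => f.frameScalar x (coord x y)) x := by
      refine ContinuousAt.comp (g := f.frameScalar x) ?_
        (continuousAt_coord (mem_chart_source ℂ x))
      rw [coord_self]
      exact (f.analyticAt_frameScalar x).continuousAt
    refine (h1.continuousWithinAt.mul (h.continuous x hx)).congr_of_eventuallyEq ?_ ?_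
    · filter_upwards [nhdsWithin_le_nhds (eventually_mem_source x)] with y hy
      exact f.triv_apply (orbiChart_coord hx.2 hy) _
    · exact f.triv_apply (orbiChart_coord hx.2 (mem_chart_source ℂ x)) _
  invariant x hx := by rw [← f.comm_inv, h.invariant x hx]
  positive x hx := by
    have := h.positive x hx
    rwa [← f.comm_τ] at this

theorem IllegalS.map (f : Iso S S') (hm : S.mult p = S'.mult p) (h : S.IllegalS v p) :
    S'.IllegalS (fun x => f.toEquiv x (v x)) p := by
  obtain ⟨v', h1, h2, h, h₀, h3, h4, h5⟩ := h
  refine ⟨_, h1.map f, h2.map f, fun t => h t * f.frameScalar p t, h₀ * f.frameScalar p 0,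
    mul_ne_zero h3 (f.frameScalar_ne_zero p 0), h4.mul
      ((f.analyticAt_frameScalar p).continuousAt.tendsto.mono_left nhdsWithin_le_nhds), ?_⟩
  filter_upwards [h5] with t ht
  rw [ht, map_smul, f.apply_frame, smul_smul, hm]
  congr 1
  ring

theorem illegalS_map_iff (f : Iso S S') (hm : S.mult p = S'.mult p) :
    S'.IllegalS (fun x => f.toEquiv x (v x)) p ↔ S.IllegalS v p := by
  refine ⟨fun h => ?_, fun h => h.map f hm⟩
  have := h.map f.symm hm.symm
  have e : (fun x => f.symm.toEquiv x (f.toEquiv x (v x))) = v :=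
    funext fun x => f.toIso.symm_apply_apply x (v x)
  rwa [e] at this

theorem IsLiftingS.ne_zero [Finite I] [Finite B] (hr : r ≠ 0) (h : S.IsLiftingS v) {x : X}
    (hx : x ∈ C.A) : v x ≠ 0 := by
  intro h0
  have := (h.positive x hx).ne_zero hx.1
  rw [S.τ_tpow, h0, map_zero, zero_pow hr, zero_mul] at this
  exact this (zero_smul ℂ (dz x x : ℂ →L[ℂ] ℂ))

/-- Two liftings differ by a real function whose `r`-th power is positive. -/
theorem IsLiftingS.exists_ratio [Finite I] [Finite B] (hr : r ≠ 0) (h : S.IsLiftingS v)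
    (h' : S.IsLiftingS v') : ∃ c : X → ℝ, ContinuousOn c C.A ∧
      ∀ x ∈ C.A, 0 < c x ^ r ∧ v x = (c x : ℂ) • v' x := by
  set k : X → ℂ := fun x => S.fiberCoord x (v x) / S.fiberCoord x (v' x) with hk
  have hk1 : ∀ x ∈ C.A, v x = k x • v' x := by
    intro x hx
    have h0 : S.fiberCoord x (v' x) ≠ 0 := by
      simpa using h'.ne_zero hr hx
    apply (S.fiberCoord x).injective
    rw [map_smul, smul_eq_mul, hk, div_mul_cancel₀ _ h0]
  have hk2 : ∀ x ∈ C.A, ((k x).re : ℂ) = k x := by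
    intro x hx
    rw [← Complex.conj_eq_iff_re]
    have h1 := h.invariant x hx
    rw [hk1 x hx, LinearMap.map_smulₛₗ, h'.invariant x hx] at h1
    exact smul_left_injective ℂ (h'.ne_zero hr hx) h1
  refine ⟨fun x => (k x).re, fun x hx => ?_, fun x hx => ⟨?_, by rw [hk2 x hx, hk1 x hx]⟩⟩
  · have h0 : S.triv x (coord x x) x (v' x) ≠ 0 := by
      simpa using h'.ne_zero hr hx
    have h1 := (h.continuous x hx).div (h'.continuous x hx) h0
    have h2 : ContinuousWithinAt k C.A x := by
      have e : ∀ y ∈ C.A, k y = S.triv x (coord x y) y (v y) / S.triv x (coord x y) y (v' y) := by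
        intro y hy
        have h3 : S.triv x (coord x y) y (v' y) ≠ 0 := by
          simpa using h'.ne_zero hr hy
        rw [eq_div_iff h3, ← smul_eq_mul, ← map_smul, ← hk1 y hy]
      exact h1.congr e (e x hx)
    exact Complex.continuous_re.continuousAt.comp_continuousWithinAt h2
  · obtain ⟨s, hs, hs'⟩ := (h.positive x hx).exists_eq_smul hx.1 (h'.positive x hx)
    rw [hk1 x hx, S.tpow_smul, map_smul] at hs'
    have h1 := smul_cotangent_inj ((h'.positive x hx).ne_zero hx.1) hs'
    rw [← hk2 x hx] at h1
    have h2 : (k x).re ^ r = s := by exact_mod_cast h1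
    rw [h2]; exact hs

theorem IsLiftingS.smul (h : S.IsLiftingS v) {c : X → ℝ} (hc : ContinuousOn c C.A)
    (hpos : ∀ x ∈ C.A, 0 < c x ^ r) : S.IsLiftingS (fun x => (c x : ℂ) • v x) where
  continuous x hx := by
    simp only [map_smul, smul_eq_mul]
    exact (Complex.continuous_ofReal.continuousAt.comp_continuousWithinAt (hc x hx)).mul
      (h.continuous x hx)
  invariant x hx := by
    rw [LinearMap.map_smulₛₗ, h.invariant x hx, Complex.conj_ofReal]
  positive x hx := by
    rw [S.tpow_smul, map_smul, ← Complex.ofReal_pow]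
    exact (h.positive x hx).smul (hpos x hx)

end DiskSpin

theorem eventually_punctured_iff (hr : r ≠ 0) {p : X} (hp : p ∉ C.A) {P : X → Prop} :
    (∀ᶠ t in 𝓝[DiskSpin.punctured C r p] 0, P (orbiChart r C.M p t)) ↔ ∀ᶠ y in 𝓝[C.A] p, P y := by
  rw [eventually_nhdsWithin_iff, eventually_nhdsWithin_iff, ← eventually_orbiChart_iff (M := C.M) hr]
  refine Filter.eventually_congr (Filter.Eventually.of_forall fun t => ?_)
  refine ⟨fun h hA => h ⟨?_, hA⟩, fun h hA => h hA.2⟩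
  rintro rfl
  rw [orbiChart_zero hr] at hA
  exact hp hA

end Isomorphisms
end RSpin

namespace RSpin

set_option linter.unusedSectionVars false

/-! ### A spin structure on a disk -/

section DiskModel

variable {X : Type*} [TopologicalSpace X] [ChartedSpace ℂ X] {r : ℕ} {I B : Type*}

/-- Data defining a twisted spin structure on a disk. -/
structure DiskData (C : MarkedDisk X I B) (r : ℕ) extends ModelData X r C.M where
  real : C.IsRealCoord p Z
  N_φ : ∀ x ∈ C.M, N (C.φ x) = N x
  N_nonneg : ∀ x ∈ C.M, 0 ≤ N x

/-- The complex conjugation as a semilinear map. -/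
noncomputable def conjMap : ℂ →ₛₗ[starRingEnd ℂ] ℂ where
  toFun := starRingEnd ℂ
  map_add' := map_add _
  map_smul' c v := map_mul _ c v

namespace DiskData

variable {C : MarkedDisk X I B} (D : DiskData C r)

theorem φ_eq_pole_iff (x : X) : C.φ x = D.p ↔ x = D.p :=
  ⟨fun h => by rw [← C.φ_φ x, h, D.real.φ_pole], fun h => by rw [h, D.real.φ_pole]⟩

theorem Z_φ (y : X) : D.Z (C.φ y) = (starRingEnd ℂ) (D.Z y) := by
  by_cases hy : y = D.p
  · simp [hy, D.real.φ_pole, D.isCoord.pole]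
  · exact D.real.conj y hy

theorem V_φ (y : X) : D.V (C.φ y) = (starRingEnd ℂ) (D.V y) := by
  simp [ModelData.V, D.Z_φ]

theorem E_φ (y : X) : D.E (C.φ y) = (starRingEnd ℂ) (D.E y) := by
  unfold ModelData.E
  rw [map_prod]
  refine Finset.prod_nbij' C.φ C.φ ?_ ?_ (fun x _ => C.φ_φ x) (fun x _ => C.φ_φ x) ?_
  · intro x hx
    simpa using C.φ_mem_M (by simpa using hx)
  · intro x hx
    simpa using C.φ_mem_M (by simpa using hx)
  · intro x hx
    rw [map_zpow₀, map_sub, ← D.Z_φ (C.φ x), ← D.Z_φ y, D.N_φ x (by simpa using hx), C.φ_φ]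

theorem mult_φ (x : X) : D.mult (C.φ x) = D.mult x := by
  unfold ModelData.mult
  by_cases hx : x ∈ C.M
  · rw [if_pos hx, if_pos (C.φ_mem_M hx), D.N_φ x hx]
  · rw [if_neg hx, if_neg (C.φ_mem_M_iff.not.2 hx)]

theorem mult_eq_zero_iff {x : X} (hx : x ∈ C.M) : D.mult x = 0 ↔ D.N x = r - 1 := by
  have := D.N_nonneg x hx
  unfold ModelData.mult
  rw [if_pos hx]
  split_ifs with h
  · simp [h]
  · simp only [h, iff_false]; omega

theorem factor_φ {x : X} (hx : x ∉ C.M) {t t' : ℂ}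
    (h : orbiChart r C.M (C.φ x) t' = C.φ (orbiChart r C.M x t)) :
    D.factor (C.φ x) t' = (starRingEnd ℂ) (D.factor x t) := by
  have h1 : D.preFactor (C.φ x) t' = (starRingEnd ℂ) (D.preFactor x t) := by
    unfold ModelData.preFactor
    rw [if_neg hx, if_neg (C.φ_mem_M_iff.not.2 hx), h, D.V_φ]
    by_cases hp : x = D.p
    · rw [if_pos hp, if_pos ((D.φ_eq_pole_iff x).2 hp), map_zpow₀]
    · rw [if_neg hp, if_neg ((D.φ_eq_pole_iff x).not.2 hp), map_one]
  unfold ModelData.factor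
  rw [h1]
  by_cases h0 : D.preFactor x t = 0
  · simp [h0]
  · rw [if_neg h0, if_neg (by simpa using h0)]

variable [T1Space X] [IsManifold 𝓘(ℂ, ℂ) ω X]

theorem differential_Z_φ {x y : X} (hy : C.φ x = y) (hx : x ≠ D.p) (u : ℂ) :
    differential D.Z y (tangentMapAt C.φ x y u) = (starRingEnd ℂ) (differential D.Z x u) := by
  have hyp : y ≠ D.p := fun h => hx ((D.φ_eq_pole_iff x).1 (hy.trans h))
  have h1 := C.φ_anti.differential_conj_comp' hy (D.isCoord.mdiff y hyp) u
  have h2 : (fun y => (starRingEnd ℂ) (D.Z (C.φ y))) = D.Z := by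
    funext y; rw [D.Z_φ, Complex.conj_conj]
  rw [h2] at h1
  rw [h1]
  exact (Complex.conj_conj _).symm

theorem η_φ {x y : X} (hy : C.φ x = y) (u : ℂ) :
    D.η y (tangentMapAt C.φ x y u) = (starRingEnd ℂ) (D.η x u) := by
  by_cases hx : x = D.p
  · have hyp : y = D.p := by rw [← hy, hx, D.real.φ_pole]
    subst hx hyp
    have h1 := D.real.isBoundaryCoord_pole.conj_differential hy u
    unfold ModelData.η
    rw [if_pos rfl]
    change (-1) ^ D.sumN * differential D.V D.p (tangentMapAt C.φ D.p D.p u) =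
      (starRingEnd ℂ) ((-1) ^ D.sumN * differential D.V D.p u)
    rw [map_mul, map_zpow₀, map_neg, map_one]
    congr 1
    have h2 := congrArg (starRingEnd ℂ) h1
    rw [Complex.conj_conj] at h2
    exact h2
  · have hyp : y ≠ D.p := fun h => hx ((D.φ_eq_pole_iff x).1 (hy.trans h))
    unfold ModelData.η
    rw [if_neg hx, if_neg hyp]
    change D.E y * differential D.Z y (tangentMapAt C.φ x y u) =
      (starRingEnd ℂ) (D.E x * differential D.Z x u)
    rw [D.differential_Z_φ hy hx, map_mul, ← hy, D.E_φ]

theorem bundle_τ_φ {x y : X} (h : C.φ x = y) (hx : x ∉ C.M) (hy : y ∉ C.M) (v u : ℂ) :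
    D.bundle.τ y hy (D.bundle.tpow (x := y) ((starRingEnd ℂ) v)) (tangentMapAt C.φ x y u) =
      (starRingEnd ℂ) (D.bundle.τ x hx (D.bundle.tpow (x := x) v) u) := by
  have h1 : (D.bundle.τ y hy (D.bundle.tpow (x := y) ((starRingEnd ℂ) v)))
      (tangentMapAt C.φ x y u) = ((starRingEnd ℂ) v) ^ r * D.η y (tangentMapAt C.φ x y u) := by
    rw [D.bundle_τ hy ((starRingEnd ℂ) v)]; rfl
  have h2 : (D.bundle.τ x hx (D.bundle.tpow (x := x) v)) u = v ^ r * D.η x u := by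
    rw [D.bundle_τ hx v]; rfl
  refine h1.trans (Eq.trans ?_ (congrArg (starRingEnd ℂ) h2).symm)
  rw [map_mul, map_pow]
  exact congrArg _ (D.η_φ h u)

/-- The spin structure on the disk. -/
noncomputable def spin : DiskSpin C r where
  toTwistedSpinBundle := D.bundle
  I₀_eq := by
    ext x
    exact and_congr_right fun hx => (D.mult_eq_zero_iff hx).symm
  inv _ _ _ _ := conjMap
  inv_inv _ _ _ _ _ _ := fun v : ℂ => Complex.conj_conj v
  inv_anti x := by
    obtain ⟨ψ, q, hq, hq0, hψ, hlift⟩ := C.φ_anti.exists_lift C.φ_injective D.r_ne_zero x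
      (C.isotropy_φ r x)
    have hψ0 : ψ 0 = 0 := by
      have := hψ 0
      rw [zero_mul] at this
      simpa using this
    have ha : AnalyticAt ℂ (fun t => (starRingEnd ℂ) (ψ t)) 0 := by
      simp only [hψ]
      exact analyticAt_id.mul hq
    by_cases hx : x ∈ C.M
    · refine ⟨ψ, fun t => q t ^ D.mult x, ha, hψ0, hlift, hq.pow _, pow_ne_zero _ hq0, ?_⟩
      filter_upwards [hq.continuousAt.eventually_ne hq0] with t hqt hM
      have ht : t ≠ 0 := by
        rintro rfl
        rw [orbiChart_zero D.r_ne_zero] at hM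
        exact hM hx
      have hψt : ψ t = (starRingEnd ℂ) (t * q t) := by rw [← hψ, Complex.conj_conj]
      have hψ1 : ψ t ≠ 0 := by
        rw [hψt]; simpa using ⟨ht, hqt⟩
      change D.factor (C.φ x) (ψ t) * (starRingEnd ℂ) ((D.factor x t)⁻¹ * 1) = _
      rw [D.factor_of_mem hx ht, D.factor_of_mem (C.φ_mem_M hx) hψ1, D.mult_φ, hψt]
      have h1 : (starRingEnd ℂ) t ≠ 0 := by simpa using ht
      simp only [map_mul, map_pow, map_inv₀, map_one, mul_pow]
      field_simp
    · refine ⟨ψ, fun _ => 1, ha, hψ0, hlift, analyticAt_const, one_ne_zero, ?_⟩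
      filter_upwards [hlift] with t ht hM
      change D.factor (C.φ x) (ψ t) * (starRingEnd ℂ) ((D.factor x t)⁻¹ * 1) = _
      rw [D.factor_φ hx ht, mul_one, ← map_mul, mul_inv_cancel₀ (D.factor_ne_zero x t)]
  inv_τ x y h hx hy v u := D.bundle_τ_φ h hx hy v u

end DiskData

end DiskModel
end RSpin

namespace RSpin

set_option linter.unusedSectionVars false

/-! ### Signs of functions on the boundary of a disk -/

theorem _root_.IsPreconnected.mul_pos {α : Type*} [TopologicalSpace α] {s : Set α}
    (hs : IsPreconnected s) {c : α → ℝ} (hc : ContinuousOn c s) (h0 : ∀ x ∈ s, c x ≠ 0)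
    {x y : α} (hx : x ∈ s) (hy : y ∈ s) : 0 < c x * c y := by
  have key : ∀ {x y : α}, x ∈ s → y ∈ s → c x < 0 → ¬ 0 < c y := by
    intro x y hx hy h1 h2
    obtain ⟨z, hz, hz0⟩ := hs.intermediate_value hx hy hc
      (show (0 : ℝ) ∈ Set.Icc _ _ from ⟨h1.le, h2.le⟩)
    exact h0 z hz hz0
  rcases lt_or_gt_of_ne (h0 x hx) with h1 | h1 <;> rcases lt_or_gt_of_ne (h0 y hy) with h2 | h2
  · exact mul_pos_of_neg_of_neg h1 h2
  · exact absurd h2 (key hx hy h1)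
  · exact absurd h1 (key hy hx h2)
  · exact _root_.mul_pos h1 h2

/-- A function of locally constant sign on punctured neighbourhoods has constant sign. -/
theorem exists_eventually_mul_pos {f : ℝ → ℝ}
    (h : ∀ s₀, ∃ ε : ℝ, ε ≠ 0 ∧ ∀ᶠ s in 𝓝[≠] s₀, 0 < ε * f s) :
    ∃ ε : ℝ, ε ≠ 0 ∧ ∀ s₀, ∀ᶠ s in 𝓝[≠] s₀, 0 < ε * f s := by
  have hopen : ∀ ε : ℝ, IsOpen {s₀ | ∀ᶠ s in 𝓝[≠] s₀, 0 < ε * f s} := by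
    intro ε
    refine isOpen_iff_mem_nhds.2 fun s₀ hs₀ => ?_
    have h1 : ∀ᶠ s in 𝓝[≠] s₀, ∀ᶠ s' in 𝓝[≠] s, 0 < ε * f s' := by
      have h2 := eventually_eventually_nhdsWithin.2 (show ∀ᶠ s in 𝓝[≠] s₀, 0 < ε * f s from hs₀)
      filter_upwards [h2, self_mem_nhdsWithin] with s hs hne
      rw [nhdsWithin_eq_nhds.2 (isOpen_compl_singleton.mem_nhds hne)] at hs
      exact nhdsWithin_le_nhds hs
    rw [eventually_nhdsWithin_iff] at h1
    filter_upwards [h1] with s hs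
    by_cases hss : s = s₀
    · rw [hss]; exact hs₀
    · exact hs hss
  have hcases : ∀ s₀, s₀ ∈ {s₀ | ∀ᶠ s in 𝓝[≠] s₀, 0 < (1 : ℝ) * f s} ∪
      {s₀ | ∀ᶠ s in 𝓝[≠] s₀, 0 < (-1 : ℝ) * f s} := by
    intro s₀
    obtain ⟨ε, hε, hs⟩ := h s₀
    rcases lt_or_gt_of_ne hε with h1 | h1
    · right
      filter_upwards [hs] with s hs
      have := neg_of_mul_pos_right hs h1.le
      linarith
    · left
      filter_upwards [hs] with s hs
      have := pos_of_mul_pos_right hs h1.le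
      linarith
  by_cases hall : ∀ s₀, ∀ᶠ s in 𝓝[≠] s₀, 0 < (1 : ℝ) * f s
  · exact ⟨1, one_ne_zero, hall⟩
  · refine ⟨-1, by norm_num, fun s₁ => ?_⟩
    by_contra h1
    push Not at hall
    obtain ⟨s₂, hs₂⟩ := hall
    obtain ⟨s, -, hs, hs'⟩ := isPreconnected_univ (α := ℝ) _ _ (hopen 1) (hopen (-1))
      (fun s _ => hcases s) ⟨s₁, trivial, (hcases s₁).resolve_right h1⟩
      ⟨s₂, trivial, (hcases s₂).resolve_left (by simpa using hs₂)⟩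
    have hs1 : ∀ᶠ s' in 𝓝[≠] s, 0 < (1 : ℝ) * f s' := hs
    have hs2 : ∀ᶠ s' in 𝓝[≠] s, 0 < (-1 : ℝ) * f s' := hs'
    obtain ⟨s', h3, h4⟩ := (hs1.and hs2).exists
    linarith

section Boundary

variable {X : Type*} [TopologicalSpace X] [ChartedSpace ℂ X] {I B : Type*} {C : MarkedDisk X I B}
  {p : X} {Z : X → ℂ} [T1Space X]

namespace MarkedDisk

theorem mem_M_of_fix {x : X} (hx : C.φ x = x) : x ∈ C.M ↔ ∃ j, C.x j = x := by
  refine ⟨?_, fun h => Or.inr h⟩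
  rintro ((⟨i, rfl⟩ | ⟨i, rfl⟩) | h)
  · exact absurd hx (C.z_ne i)
  · rw [C.φ_φ] at hx
    exact absurd hx.symm (C.z_ne i)
  · exact h

theorem x_mem_M (j : B) : C.x j ∈ C.M := Or.inr ⟨j, rfl⟩

theorem x_notMem_A (j : B) : C.x j ∉ C.A := fun h => h.2 (C.x_mem_M j)

namespace IsRealCoord

theorem pole_mem_A (hZ : C.IsRealCoord p Z) : p ∈ C.A := ⟨hZ.φ_pole, hZ.pole_notMem⟩

theorem x_ne_pole (hZ : C.IsRealCoord p Z) (j : B) : C.x j ≠ p := fun h => hZ.pole_notMem (h ▸ C.x_mem_M j)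

theorem ofReal_re (hZ : C.IsRealCoord p Z) {y : X} (hy : C.φ y = y) : ((Z y).re : ℂ) = Z y := by
  by_cases hyp : y = p
  · simp [hyp, hZ.pole]
  · rw [← Complex.conj_eq_iff_re, ← hZ.conj y hyp, hy]

theorem pt_re (hZ : C.IsRealCoord p Z) {y : X} (hy : C.φ y = y) (hyp : y ≠ p) : hZ.pt ((Z y).re : ℂ) = y := by
  rw [hZ.ofReal_re hy, hZ.pt_apply hyp]

theorem φ_pt (hZ : C.IsRealCoord p Z) (s : ℝ) : C.φ (hZ.pt s) = hZ.pt s := by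
  refine hZ.inj _ _ (hZ.φ_ne (hZ.pt_ne _)) (hZ.pt_ne _) ?_
  rw [hZ.conj _ (hZ.pt_ne _), hZ.apply_pt, Complex.conj_ofReal]

theorem pt_mem_A_iff (hZ : C.IsRealCoord p Z) (s : ℝ) : hZ.pt s ∈ C.A ↔ ∀ j, s ≠ (Z (C.x j)).re := by
  have : hZ.pt s ∈ C.A ↔ hZ.pt s ∉ C.M := ⟨fun h => h.2, fun h => ⟨hZ.φ_pt s, h⟩⟩
  rw [this, mem_M_of_fix (hZ.φ_pt s), not_exists]
  refine forall_congr' fun j => not_congr ⟨fun h => ?_, fun h => ?_⟩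
  · rw [h, hZ.apply_pt, Complex.ofReal_re]
  · rw [h, hZ.pt_re (C.x_fix j) (hZ.x_ne_pole j)]

theorem re_ne_of_mem_A (hZ : C.IsRealCoord p Z) {y : X} (hy : y ∈ C.A) (hyp : y ≠ p) (j : B) :
    (Z y).re ≠ (Z (C.x j)).re := by
  have h1 : hZ.pt ((Z y).re : ℂ) ∈ C.A := by rwa [hZ.pt_re hy.1 hyp]
  exact (hZ.pt_mem_A_iff _).1 h1 j

theorem tendsto_re (hZ : C.IsRealCoord p Z) (j : B) : Filter.Tendsto (fun y => (Z y).re) (𝓝[C.A] (C.x j))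
    (𝓝[≠] (Z (C.x j)).re) := by
  refine tendsto_nhdsWithin_iff.2 ⟨?_, ?_⟩
  · exact (Complex.continuous_re.continuousAt.comp
      (hZ.toIsCoord.continuousAt (hZ.x_ne_pole j))).tendsto.mono_left nhdsWithin_le_nhds
  · filter_upwards [nhdsWithin_le_nhds (IsCoord.eventually_ne (hZ.x_ne_pole j)),
      self_mem_nhdsWithin] with y hy hyA
    exact hZ.re_ne_of_mem_A hyA hy j

variable [Finite B]

theorem eventually_pt_mem_A (hZ : C.IsRealCoord p Z) (s₀ : ℝ) : ∀ᶠ s : ℝ in 𝓝[≠] s₀, hZ.pt s ∈ C.A := by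
  have h1 : (Set.range fun j => (Z (C.x j)).re).Finite := Set.finite_range _
  filter_upwards [eventually_notMem h1 s₀] with s hs
  exact (hZ.pt_mem_A_iff s).2 fun j h => hs ⟨j, h.symm⟩

theorem eventually_atTop_pt_mem_A (hZ : C.IsRealCoord p Z) : ∀ᶠ s : ℝ in Filter.atTop, hZ.pt s ∈ C.A := by
  have h1 : (Set.range fun j => (Z (C.x j)).re).Finite := Set.finite_range _
  obtain ⟨b, hb⟩ := h1.bddAbove
  filter_upwards [Filter.eventually_gt_atTop b] with s hs
  exact (hZ.pt_mem_A_iff s).2 fun j h => by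
    have := hb ⟨j, rfl⟩
    simp only at this
    linarith

variable [IsManifold 𝓘(ℂ, ℂ) ω X]

theorem tendsto_pt (hZ : C.IsRealCoord p Z) (s₀ : ℝ) : Filter.Tendsto (fun s : ℝ => hZ.pt s) (𝓝[≠] s₀)
    (𝓝[C.A] (hZ.pt s₀)) :=
  tendsto_nhdsWithin_iff.2 ⟨(hZ.continuous_pt.comp Complex.continuous_ofReal).continuousAt.tendsto.mono_left
    nhdsWithin_le_nhds, hZ.eventually_pt_mem_A s₀⟩

theorem tendsto_pt_atTop (hZ : C.IsRealCoord p Z) : Filter.Tendsto (fun s : ℝ => hZ.pt s) Filter.atTop (𝓝[C.A] p) := by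
  refine tendsto_nhdsWithin_iff.2 ⟨?_, hZ.eventually_atTop_pt_mem_A⟩
  refine hZ.tendsto_pt_cobounded.comp ?_
  rw [← tendsto_norm_atTop_iff_cobounded]
  simpa using Filter.tendsto_abs_atTop_atTop

/-- A nonvanishing continuous function on the boundary, of constant sign near the marked points,
has constant sign. -/
theorem exists_mul_pos (hZ : C.IsRealCoord p Z) {c : X → ℝ} (hc : ContinuousOn c C.A) (h0 : ∀ x ∈ C.A, c x ≠ 0)
    (h : ∀ j, ∃ ε : ℝ, ε ≠ 0 ∧ ∀ᶠ y in 𝓝[C.A] (C.x j), 0 < ε * c y) :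
    ∃ ε : ℝ, ε ≠ 0 ∧ ∀ x ∈ C.A, 0 < ε * c x := by
  have hA : ∀ x ∈ C.A, ∀ᶠ y in 𝓝[C.A] x, 0 < c x * c y := by
    intro x hx
    have h1 : Filter.Tendsto (fun y => c x * c y) (𝓝[C.A] x) (𝓝 (c x * c x)) :=
      Filter.Tendsto.const_mul _ (hc x hx)
    exact h1.eventually (lt_mem_nhds (mul_self_pos.2 (h0 x hx)))
  obtain ⟨ε, hε, hall⟩ := exists_eventually_mul_pos (f := fun s : ℝ => c (hZ.pt s)) (by
    intro s₀
    by_cases hs₀ : hZ.pt s₀ ∈ C.A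
    · exact ⟨c (hZ.pt s₀), h0 _ hs₀, (hZ.tendsto_pt s₀).eventually (hA _ hs₀)⟩
    · rw [hZ.pt_mem_A_iff] at hs₀
      push Not at hs₀
      obtain ⟨j, hj⟩ := hs₀
      obtain ⟨ε, hε, hev⟩ := h j
      refine ⟨ε, hε, (hZ.tendsto_pt s₀).eventually (p := fun y => 0 < ε * c y) ?_⟩
      rwa [hj, hZ.pt_re (C.x_fix j) (hZ.x_ne_pole j)])
  have hsign : ∀ a b : ℝ, 0 < ε * a → 0 < b * a → 0 < ε * b := by
    intro a b h1 h2
    have h3 : 0 < (ε * b) * (a * a) := by nlinarith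
    exact pos_of_mul_pos_left h3 (mul_self_nonneg a)
  have hfin : ∀ x ∈ C.A, x ≠ p → 0 < ε * c x := by
    intro x hx hxp
    have h1 := hA x hx
    have h2 := hZ.tendsto_pt (Z x).re
    rw [hZ.pt_re hx.1 hxp] at h2
    obtain ⟨s, h3, h4⟩ := ((hall (Z x).re).and (h2.eventually h1)).exists
    exact hsign _ _ h3 h4
  refine ⟨ε, hε, fun x hx => ?_⟩
  by_cases hxp : x = p
  · subst hxp
    obtain ⟨s, h3, h4⟩ := ((hZ.tendsto_pt_atTop.eventually (hA x hx)).and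
      hZ.eventually_atTop_pt_mem_A).exists
    exact hsign _ _ (hfin _ h4 (hZ.pt_ne _)) h3
  · exact hfin x hx hxp

/-- The two one-sided signs at a boundary marked point. -/
theorem exists_mul_pos_or (hZ : C.IsRealCoord p Z) {c : X → ℝ} (hc : ContinuousOn c C.A) (h0 : ∀ x ∈ C.A, c x ≠ 0) (j : B) :
    (∃ ε : ℝ, ε ≠ 0 ∧ ∀ᶠ y in 𝓝[C.A] (C.x j), 0 < ε * c y) ∨
    (∃ ε : ℝ, ε ≠ 0 ∧ ∀ᶠ y in 𝓝[C.A] (C.x j), 0 < ε * (c y * ((Z y).re - (Z (C.x j)).re))) := by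
  set s₀ := (Z (C.x j)).re with hs₀
  obtain ⟨δ, hδ, hball⟩ := Metric.mem_nhdsWithin_iff.1 (hZ.eventually_pt_mem_A s₀)
  have hint : ∀ a b : ℝ, s₀ - δ ≤ a → b ≤ s₀ + δ → s₀ ∉ Set.Ioo a b →
      ∀ s ∈ Set.Ioo a b, ∀ s' ∈ Set.Ioo a b, 0 < c (hZ.pt s) * c (hZ.pt s') := by
    intro a b ha hb hab s hs s' hs'
    have hsub : ∀ s ∈ Set.Ioo a b, hZ.pt (s : ℝ) ∈ C.A := by
      intro s hs
      refine hball ⟨?_, fun h => hab ?_⟩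
      · rw [Metric.mem_ball, Real.dist_eq, abs_lt]
        exact ⟨by linarith [hs.1], by linarith [hs.2]⟩
      · rw [Set.mem_singleton_iff] at h
        exact h ▸ hs
    exact isPreconnected_Ioo.mul_pos (c := fun s : ℝ => c (hZ.pt s))
      (hc.comp (hZ.continuous_pt.comp Complex.continuous_ofReal).continuousOn hsub)
      (fun s hs => h0 _ (hsub s hs)) hs hs'
  have hmem : ∀ s : ℝ, s₀ - δ < s → s < s₀ + δ → s ≠ s₀ → hZ.pt (s : ℝ) ∈ C.A := by
    intro s h1 h2 h3
    refine hball ⟨?_, h3⟩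
    rw [Metric.mem_ball, Real.dist_eq, abs_lt]
    exact ⟨by linarith, by linarith⟩
  set ε₁ := c (hZ.pt ((s₀ + δ / 2 : ℝ) : ℂ)) with hε₁
  set ε₂ := c (hZ.pt ((s₀ - δ / 2 : ℝ) : ℂ)) with hε₂
  have h1 : ε₁ ≠ 0 := h0 _ (hmem _ (by linarith) (by linarith) (by linarith))
  have h2 : ε₂ ≠ 0 := h0 _ (hmem _ (by linarith) (by linarith) (by linarith))
  have hev : ∀ᶠ y in 𝓝[C.A] (C.x j), (s₀ < (Z y).re → 0 < ε₁ * c y) ∧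
      ((Z y).re < s₀ → 0 < ε₂ * c y) ∧ (Z y).re ≠ s₀ := by
    have h3 := hZ.tendsto_re j
    rw [← hs₀] at h3
    filter_upwards [h3.eventually (nhdsWithin_le_nhds (Ioo_mem_nhds (by linarith : s₀ - δ < s₀)
      (by linarith : s₀ < s₀ + δ))), h3.eventually self_mem_nhdsWithin, self_mem_nhdsWithin,
      nhdsWithin_le_nhds (IsCoord.eventually_ne (hZ.x_ne_pole j))] with y h4 h5 h6 h7
    have h8 := hZ.pt_re h6.1 h7
    refine ⟨fun h9 => ?_, fun h9 => ?_, h5⟩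
    · have := hint s₀ (s₀ + δ) (by linarith) le_rfl (by simp) (s₀ + δ / 2)
        ⟨by linarith, by linarith⟩ (Z y).re ⟨h9, h4.2⟩
      rwa [h8] at this
    · have := hint (s₀ - δ) s₀ le_rfl (by linarith) (by simp) (s₀ - δ / 2)
        ⟨by linarith, by linarith⟩ (Z y).re ⟨h4.1, h9⟩
      rwa [h8] at this
  rcases lt_or_gt_of_ne (mul_ne_zero h1 h2) with h3 | h3
  · right
    refine ⟨ε₁, h1, ?_⟩
    filter_upwards [hev] with y ⟨h4, h5, h6⟩
    rcases lt_or_gt_of_ne h6 with h7 | h7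
    · have h8 := h5 h7
      have h9 : ε₁ * c y < 0 := by
        by_contra h10
        have : 0 ≤ (ε₁ * ε₂) * (c y * c y) := by nlinarith [not_lt.1 h10]
        have hc0 : 0 < c y * c y := mul_self_pos.2 (by rintro h; simp [h] at h8)
        nlinarith
      nlinarith
    · have h8 := h4 h7
      rw [← mul_assoc]
      exact mul_pos h8 (by linarith)
  · left
    refine ⟨ε₁, h1, ?_⟩
    filter_upwards [hev] with y ⟨h4, h5, h6⟩
    rcases lt_or_gt_of_ne h6 with h7 | h7
    · have h8 := h5 h7
      by_contra h10
      have : (ε₁ * c y) * (ε₂ * c y) ≤ 0 := by nlinarith [not_lt.1 h10]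
      have hc0 : 0 < c y * c y := mul_self_pos.2 (by rintro h; simp [h] at h8)
      nlinarith
    · exact h4 h7

end IsRealCoord

end MarkedDisk

end Boundary
end RSpin

namespace RSpin

set_option linter.unusedSectionVars false

/-! ### The lifting of the spin structure on a disk -/

theorem continuousAt_div_abs {α : Type*} [TopologicalSpace α] {f : α → ℝ} {x : α}
    (hf : ContinuousAt f x) (h : f x ≠ 0) : ContinuousAt (fun y => f y / |f y|) x :=
  hf.div hf.abs (abs_ne_zero.2 h)

theorem div_abs_ne_zero {a : ℝ} (h : a ≠ 0) : a / |a| ≠ 0 := div_ne_zero h (abs_ne_zero.2 h)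

theorem div_abs_mul_self {a : ℝ} (h : a ≠ 0) : (a / |a|) * (a / |a|) = 1 := by
  have := abs_ne_zero.2 h
  field_simp
  exact (sq_abs a).symm

theorem div_abs_pow_mul_zpow_pos {a : ℝ} (h : a ≠ 0) {m : ℕ} {n : ℤ} (hmn : Even ((m : ℤ) + n)) :
    0 < (a / |a|) ^ m * a ^ n := by
  have e : a = (a / |a|) * |a| := by
    have := abs_ne_zero.2 h
    field_simp
  have h0 := div_abs_ne_zero h
  have h1 : (a / |a|) ^ m * a ^ n = (a / |a|) ^ ((m : ℤ) + n) * |a| ^ n := by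
    conv_lhs => rw [e]
    rw [abs_mul, abs_abs, abs_div, abs_abs, div_self (abs_ne_zero.2 h), one_mul]
    have e2 : a / |a| * |a| / |a| = a / |a| := by
      have := abs_ne_zero.2 h
      field_simp
    rw [e2, mul_zpow, ← mul_assoc, zpow_add₀ h0, zpow_natCast]
  rw [h1]
  exact mul_pos (hmn.zpow_pos h0) (zpow_pos (abs_pos.2 h) _)

section MarkedPoints

variable {X : Type*} [TopologicalSpace X] [ChartedSpace ℂ X] {I B : Type*}

namespace MarkedDisk

variable (C : MarkedDisk X I B)

/-- All marked points. -/
def point : (I ⊕ I) ⊕ B → X := Sum.elim (Sum.elim C.z fun i => C.φ (C.z i)) C.x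

theorem point_injective : Function.Injective C.point := by
  have h1 : ∀ i i', C.z i ≠ C.φ (C.z i') := by
    intro i i' h
    exact C.z_ne i' (C.fix_of_mem (C.z_mem i') (h ▸ C.z_mem i))
  have h2 : ∀ i j, C.z i ≠ C.x j := fun i j h => C.z_ne i (by rw [h, C.x_fix])
  have h3 : ∀ i j, C.φ (C.z i) ≠ C.x j := fun i j h => C.z_ne i (by
    rw [h, ← C.x_fix j, ← h, C.φ_φ])
  rintro ((i | i) | j) ((i' | i') | j') h
  · exact congrArg (fun i => Sum.inl (Sum.inl i)) (C.z_injective h)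
  · exact absurd h (h1 i i')
  · exact absurd h (h2 i j')
  · exact absurd h.symm (h1 i' i)
  · exact congrArg (fun i => Sum.inl (Sum.inr i)) (C.z_injective (C.φ_injective h))
  · exact absurd h (h3 i j')
  · exact absurd h.symm (h2 i' j)
  · exact absurd h.symm (h3 i' j)
  · exact congrArg Sum.inr (C.x_injective h)

theorem range_point : Set.range C.point = C.M := by
  simp [point, MarkedDisk.M, Set.Sum.elim_range]

theorem z_mem_M (i : I) : C.z i ∈ C.M := Or.inl (Or.inl ⟨i, rfl⟩)

@[to_additive]
theorem prod_M [Fintype I] [Fintype B] {G : Type*} [CommMonoid G] (hM : C.M.Finite) (f : X → G) :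
    ∏ x ∈ hM.toFinset, f x = (∏ i, f (C.z i) * f (C.φ (C.z i))) * ∏ j, f (C.x j) := by
  classical
  have h : hM.toFinset = Finset.univ.image C.point := by
    ext x
    simp [← C.range_point]
  rw [h, Finset.prod_image fun _ _ _ _ h => C.point_injective h, Fintype.prod_sum_type,
    Fintype.prod_sum_type, Finset.prod_mul_distrib]
  rfl

end MarkedDisk

end MarkedPoints

section ModelLifting

variable {X : Type*} [TopologicalSpace X] [ChartedSpace ℂ X] {r : ℕ} {I B : Type*}
  {C : MarkedDisk X I B}

namespace DiskData

variable (D : DiskData C r) (L : Finset B)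

/-- The position of a boundary point with respect to the `j`-th marked boundary point. -/
noncomputable def offset (j : B) (y : X) : ℝ := (D.Z y).re - (D.Z (C.x j)).re

open Classical in
/-- A section on the boundary changing sign at the points with label in `L`. -/
noncomputable def sec (y : X) : ℝ :=
  if y = D.p then (-1) ^ D.d
  else (∏ j ∈ L, D.offset j y / |D.offset j y|) * Real.sqrt (1 + (D.Z y).re ^ 2) ^ D.d

theorem sec_pole : D.sec L D.p = (-1) ^ D.d := if_pos rfl

theorem sec_of_ne {y : X} (hy : y ≠ D.p) : D.sec L y =
    (∏ j ∈ L, D.offset j y / |D.offset j y|) * Real.sqrt (1 + (D.Z y).re ^ 2) ^ D.d := if_neg hy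

theorem sqrt_pos (s : ℝ) : 0 < Real.sqrt (1 + s ^ 2) := Real.sqrt_pos.2 (by positivity)

variable [T1Space X]

theorem offset_ne_zero {y : X} (hy : y ∈ C.A) (hyp : y ≠ D.p) (j : B) : D.offset j y ≠ 0 :=
  sub_ne_zero.2 (D.real.re_ne_of_mem_A hy hyp j)

theorem sec_ne_zero {y : X} (hy : y ∈ C.A) : D.sec L y ≠ 0 := by
  by_cases hyp : y = D.p
  · subst hyp
    rw [sec_pole]
    exact zpow_ne_zero _ (by norm_num)
  · rw [D.sec_of_ne L hyp]
    exact mul_ne_zero (Finset.prod_ne_zero_iff.2 fun j _ =>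
      div_abs_ne_zero (D.offset_ne_zero hy hyp j)) (zpow_ne_zero _ (sqrt_pos _).ne')

theorem continuousAt_re {q : X} (hq : q ≠ D.p) : ContinuousAt (fun y => (D.Z y).re) q :=
  Complex.continuous_re.continuousAt.comp (D.isCoord.continuousAt hq)

theorem continuousAt_offset {q : X} (hq : q ≠ D.p) (j : B) : ContinuousAt (D.offset j) q :=
  (D.continuousAt_re hq).sub continuousAt_const

theorem continuousAt_sqrt_zpow {q : X} (hq : q ≠ D.p) :
    ContinuousAt (fun y => Real.sqrt (1 + (D.Z y).re ^ 2) ^ D.d) q := by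
  refine ContinuousAt.zpow₀ ?_ _ (Or.inl (sqrt_pos _).ne')
  exact Real.continuous_sqrt.continuousAt.comp
    (continuousAt_const.add ((D.continuousAt_re hq).pow 2))

theorem continuousAt_sec {q : X} (hq : q ∈ C.A) (hqp : q ≠ D.p) : ContinuousAt (D.sec L) q := by
  have h1 : ContinuousAt (fun y => (∏ j ∈ L, D.offset j y / |D.offset j y|) *
      Real.sqrt (1 + (D.Z y).re ^ 2) ^ D.d) q := by
    refine ContinuousAt.mul ?_ (D.continuousAt_sqrt_zpow hqp)
    exact tendsto_finsetProd _ fun j _ =>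
      continuousAt_div_abs (D.continuousAt_offset hqp j) (D.offset_ne_zero hq hqp j)
  refine h1.congr ?_
  filter_upwards [IsCoord.eventually_ne hqp] with y hy
  rw [D.sec_of_ne L hy]

theorem prod_div_abs_eq {s : ℝ} {z : B → ℝ} (hs : s ≠ 0) (hz : ∀ j, 0 < 1 + -s⁻¹ * z j) :
    ∏ j ∈ L, (s - z j) / |s - z j| = (s / |s|) ^ L.card := by
  rw [← Finset.prod_const]
  refine Finset.prod_congr rfl fun j _ => ?_
  have h : s - z j = s * (1 + -s⁻¹ * z j) := by field_simp; ring
  rw [h, abs_mul, abs_of_pos (hz j), mul_div_mul_right _ _ (hz j).ne']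

theorem zpow_mul_eq {s : ℝ} (hs : s ≠ 0) {m : ℕ} {d : ℤ} (hm : Even ((m : ℤ) - d)) :
    (-s⁻¹) ^ d * ((s / |s|) ^ m * Real.sqrt (1 + s ^ 2) ^ d) =
      (-1) ^ d * Real.sqrt (1 + (-s⁻¹) ^ 2) ^ d := by
  have h0 := div_abs_ne_zero hs
  have ha := abs_ne_zero.2 hs
  have h1 : (s / |s|) ^ m = (s / |s|) ^ d := by
    obtain ⟨k, hk⟩ := hm
    have e : (m : ℤ) = d + 2 * k := by omega
    rw [← zpow_natCast, e, zpow_add₀ h0, zpow_mul, zpow_ofNat, sq, div_abs_mul_self hs, one_zpow,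
      mul_one]
  have h2 : Real.sqrt (1 + s ^ 2) = |s| * Real.sqrt (1 + (-s⁻¹) ^ 2) := by
    rw [← Real.sqrt_sq_eq_abs, ← Real.sqrt_mul (sq_nonneg s)]
    congr 1
    field_simp
    ring
  rw [h1, h2, ← mul_zpow, ← mul_zpow, ← mul_zpow]
  congr 1
  field_simp

theorem continuousWithinAt_factor_mul_sec [IsManifold 𝓘(ℂ, ℂ) ω X] [Finite B]
    (hL : Even ((L.card : ℤ) - D.d)) :
    ContinuousWithinAt (fun y => D.factor D.p (coord D.p y) * (D.sec L y : ℂ)) C.A D.p := by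
  have hV : ContinuousAt (fun y => (D.V y).re) D.p :=
    Complex.continuous_re.continuousAt.comp D.isCoord.continuousAt_inv
  have h1 : ContinuousAt (fun y => ((((-1) ^ D.d * Real.sqrt (1 + (D.V y).re ^ 2) ^ D.d : ℝ)) : ℂ))
      D.p := by
    refine Complex.continuous_ofReal.continuousAt.comp (continuousAt_const.mul ?_)
    refine ContinuousAt.zpow₀ ?_ _ (Or.inl (sqrt_pos _).ne')
    exact Real.continuous_sqrt.continuousAt.comp (continuousAt_const.add (hV.pow 2))
  have h2 : ∀ᶠ y in 𝓝 D.p, ∀ j, 0 < 1 + (D.V y).re * (D.Z (C.x j)).re := by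
    refine Filter.eventually_all.2 fun j => ?_
    have h3 : ContinuousAt (fun y => 1 + (D.V y).re * (D.Z (C.x j)).re) D.p :=
      continuousAt_const.add (hV.mul continuousAt_const)
    refine h3.eventually (lt_mem_nhds ?_)
    change 0 < 1 + (D.V D.p).re * _
    rw [D.V_pole]
    simp
  have h4 : D.factor D.p (coord D.p D.p) * (D.sec L D.p : ℂ) =
      (((-1) ^ D.d * Real.sqrt (1 + (D.V D.p).re ^ 2) ^ D.d : ℝ) : ℂ) := by
    rw [coord_self, D.factor_zero, D.sec_pole, D.V_pole]
    simp
  refine h1.continuousWithinAt.congr_of_eventuallyEq ?_ h4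
  filter_upwards [nhdsWithin_le_nhds h2, nhdsWithin_le_nhds D.isCoord.eventually_ne_zero,
    nhdsWithin_le_nhds (eventually_mem_source D.p), self_mem_nhdsWithin] with y h5 h6 h7 hyA
  by_cases hyp : y = D.p
  · subst hyp; exact h4
  · have hZ0 := h6 hyp
    have hre := D.real.ofReal_re hyA.1
    set s := (D.Z y).re with hs
    have hs0 : s ≠ 0 := by
      intro h
      rw [h] at hre
      exact hZ0 hre.symm
    have hVy : D.V y = ((-s⁻¹ : ℝ) : ℂ) := by
      rw [ModelData.V, ← hre]; push_cast; rfl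
    have hVre : (D.V y).re = -s⁻¹ := by rw [hVy, Complex.ofReal_re]
    have horb : orbiChart r C.M D.p (coord D.p y) = y := orbiChart_coord D.notMem h7
    rw [D.factor_pole (by rw [horb, hVy]; simpa using hs0), horb, hVy, D.sec_of_ne L hyp,
      ← Complex.ofReal_zpow, ← Complex.ofReal_mul]
    congr 1
    rw [Complex.ofReal_re, ← zpow_mul_eq hs0 hL, ← prod_div_abs_eq L (z := fun j => (D.Z (C.x j)).re)
      hs0 (fun j => by have := h5 j; rwa [hVre] at this)]
    rfl

theorem E_eq_ofReal [Fintype I] [Fintype B] {y : X} (hy : C.φ y = y) :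
    D.E y = (((∏ i, Complex.normSq (D.Z y - D.Z (C.z i)) ^ D.N (C.z i)) *
      ∏ j, D.offset j y ^ D.N (C.x j) : ℝ) : ℂ) := by
  unfold ModelData.E
  rw [C.prod_M D.finite]
  push_cast
  congr 1
  · refine Finset.prod_congr rfl fun i _ => ?_
    rw [D.N_φ _ (C.z_mem_M i), ← mul_zpow, ← Complex.mul_conj, map_sub,
      ← D.Z_φ, ← D.Z_φ, hy]
  · refine Finset.prod_congr rfl fun j _ => ?_
    rw [offset]
    push_cast
    rw [D.real.ofReal_re hy, D.real.ofReal_re (C.x_fix j)]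

theorem sec_pow_mul_E_pos [Fintype I] [Fintype B] [DecidableEq B]
    (hpar : ∀ j, Even (((if j ∈ L then r else 0 : ℕ) : ℤ) + D.N (C.x j))) {y : X} (hy : y ∈ C.A)
    (hyp : y ≠ D.p) : ∃ s : ℝ, 0 < s ∧ (D.sec L y : ℂ) ^ r * D.E y = s := by
  refine ⟨_, ?_, by rw [D.E_eq_ofReal hy.1, ← Complex.ofReal_pow, ← Complex.ofReal_mul]⟩
  have h1 : ∏ j ∈ L, (D.offset j y / |D.offset j y|) ^ r =
      ∏ j, (D.offset j y / |D.offset j y|) ^ (if j ∈ L then r else 0) := by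
    rw [← Finset.prod_subset (Finset.subset_univ L) fun j _ hj => by simp [hj]]
    exact Finset.prod_congr rfl fun j hj => by simp [hj]
  rw [D.sec_of_ne L hyp, mul_pow, ← Finset.prod_pow, h1]
  have e : ∀ a b c d : ℝ, a * b * (c * d) = (b * c) * (a * d) := fun a b c d => by ring
  rw [e, ← Finset.prod_mul_distrib]
  refine mul_pos (mul_pos (pow_pos (zpow_pos (sqrt_pos _) _) _) ?_) ?_
  · refine Finset.prod_pos fun i _ => zpow_pos (Complex.normSq_pos.2 (sub_ne_zero.2 fun h => ?_)) _
    have h2 := D.isCoord.inj _ _ hyp (fun h3 => D.notMem (h3 ▸ C.z_mem_M i)) h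
    exact hy.2 (h2 ▸ C.z_mem_M i)
  · exact Finset.prod_pos fun j _ => div_abs_pow_mul_zpow_pos (D.offset_ne_zero hy hyp j) (hpar j)

variable [IsManifold 𝓘(ℂ, ℂ) ω X]

theorem isLiftingS_sec [Fintype I] [Fintype B] [DecidableEq B]
    (hpar : ∀ j, Even (((if j ∈ L then r else 0 : ℕ) : ℤ) + D.N (C.x j)))
    (hL : Even ((L.card : ℤ) - D.d)) :
    D.spin.IsLiftingS (fun x => (D.sec L x : ℂ)) where
  continuous x hx := by
    change ContinuousWithinAt (fun y => D.factor x (coord x y) * (D.sec L y : ℂ)) C.A x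
    by_cases hxp : x = D.p
    · subst hxp
      exact D.continuousWithinAt_factor_mul_sec L hL
    · simp only [D.factor_of_notMem hx.2 hxp, one_mul]
      exact (Complex.continuous_ofReal.continuousAt.comp
        (D.continuousAt_sec L hx hxp)).continuousWithinAt
  invariant x hx := Complex.conj_ofReal _
  positive x hx := by
    have h1 : D.bundle.τ x hx.2 (D.bundle.tpow (x := x) (D.sec L x : ℂ)) =
      (D.sec L x : ℂ) ^ r • D.η x := D.bundle_τ hx.2 _
    suffices h : C.IsPos x ((D.sec L x : ℂ) ^ r • D.η x) from h1 ▸ h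
    by_cases hxp : x = D.p
    · subst hxp
      unfold ModelData.η
      rw [if_pos rfl, smul_smul, sec_pole]
      refine (D.real.isBoundaryCoord_pole.isPos_smul_iff hx.1 _).2 ?_
      have e : (((-1 : ℝ) ^ D.d : ℝ) : ℂ) ^ r * (-1) ^ D.sumN = 1 := by
        have h2 : D.d * (r : ℤ) + D.sumN = 2 * (-1) := by
          have := D.sum_eq
          rw [ModelData.sumN]; linarith
        rw [Complex.ofReal_zpow, ← zpow_natCast, ← zpow_mul]
        push_cast
        rw [← zpow_add₀ (by norm_num), h2, zpow_mul]
        norm_num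
      rw [e]
      simp
    · obtain ⟨s, hs, hs'⟩ := D.sec_pow_mul_E_pos L hpar hx hxp
      unfold ModelData.η
      rw [if_neg hxp, smul_smul, hs']
      refine ((D.real.isBoundaryCoord hxp).isPos_smul_iff hx.1 _).2 ?_
      simpa using hs

end DiskData

end ModelLifting
end RSpin

namespace RSpin

set_option linter.unusedSectionVars false

/-! ### Legal points of liftings of the spin structure on a disk -/

section ModelLegal

variable {X : Type*} [TopologicalSpace X] [ChartedSpace ℂ X] {r : ℕ} {I B : Type*}
  {C : MarkedDisk X I B}

namespace DiskData

variable (D : DiskData C r) (L : Finset B) [T1Space X] [IsManifold 𝓘(ℂ, ℂ) ω X]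

theorem smul_frame {x : X} (hx : x ∈ C.M) {t : ℂ} (ht : t ≠ 0) (h : ℂ) :
    (h * t ^ D.spin.mult x) • D.spin.frame x t = h := by
  change h * t ^ D.mult x * ((D.factor x t)⁻¹ * 1) = h
  rw [D.factor_of_mem hx ht]
  have := pow_ne_zero (D.mult x) ht
  field_simp

theorem pos_of_illegalS {v : X → ℝ} {j : B}
    (h : D.spin.IllegalS (fun x => (v x : ℂ)) (C.x j)) :
    ∃ ε : ℝ, ε ≠ 0 ∧ ∀ᶠ y in 𝓝[C.A] (C.x j), 0 < ε * v y := by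
  obtain ⟨v', -, ⟨k, -, hk⟩, h, h₀, hh₀, hlim, hev⟩ := h
  have hval : ∀ᶠ t in 𝓝[DiskSpin.punctured C r (C.x j)] 0,
      0 < k (orbiChart r C.M (C.x j) t) ∧ h t =
        ((k (orbiChart r C.M (C.x j) t) * v (orbiChart r C.M (C.x j) t) : ℝ) : ℂ) := by
    filter_upwards [hev, self_mem_nhdsWithin] with t h1 h2
    obtain ⟨h3, h4⟩ := hk _ h2.2
    refine ⟨h3, ?_⟩
    rw [D.smul_frame (C.x_mem_M j) h2.1, h4] at h1
    rw [Complex.ofReal_mul]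
    exact h1.symm
  by_cases hre : h₀.re = 0
  · have him : h₀.im ≠ 0 := fun him => hh₀ (Complex.ext hre him)
    have h1 : ∀ᶠ t in 𝓝[DiskSpin.punctured C r (C.x j)] 0, (h t).im ≠ 0 :=
      ((Complex.continuous_im.tendsto h₀).comp hlim).eventually_ne him
    refine ⟨1, one_ne_zero, (eventually_punctured_iff D.r_ne_zero (C.x_notMem_A j)).1 ?_⟩
    filter_upwards [hval, h1] with t h2 h3
    rw [h2.2, Complex.ofReal_im] at h3
    exact absurd rfl h3
  · have h1 : ∀ᶠ t in 𝓝[DiskSpin.punctured C r (C.x j)] 0, 0 < h₀.re * (h t).re :=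
      (((Complex.continuous_re.tendsto h₀).comp hlim).const_mul h₀.re).eventually
        (lt_mem_nhds (mul_self_pos.2 hre))
    refine ⟨h₀.re, hre, (eventually_punctured_iff D.r_ne_zero (C.x_notMem_A j)).1 ?_⟩
    filter_upwards [hval, h1] with t h2 h3
    rw [h2.2, Complex.ofReal_re] at h3
    have h4 : 0 < k (orbiChart r C.M (C.x j) t) *
        (h₀.re * v (orbiChart r C.M (C.x j) t)) := by linarith
    exact pos_of_mul_pos_right h4 h2.1.le

theorem abs_sec {y : X} (hy : y ∈ C.A) (hyp : y ≠ D.p) :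
    |D.sec L y| = Real.sqrt (1 + (D.Z y).re ^ 2) ^ D.d := by
  rw [D.sec_of_ne L hyp, abs_mul, abs_of_pos (zpow_pos (sqrt_pos _) _), Finset.abs_prod,
    Finset.prod_eq_one, one_mul]
  intro j _
  have := abs_ne_zero.2 (D.offset_ne_zero hy hyp j)
  rw [abs_div, abs_abs, div_self this]

theorem illegalS_of_pos (hlift : D.spin.IsLiftingS (fun x => (D.sec L x : ℂ))) {c : X → ℝ}
    (hc : ContinuousOn c C.A) (hpos : ∀ x ∈ C.A, 0 < c x ^ r) {j : B} {ε : ℝ}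
    (h : ∀ᶠ y in 𝓝[C.A] (C.x j), 0 < ε * (c y * D.sec L y)) :
    D.spin.IllegalS (fun x => (c x : ℂ) • (D.sec L x : ℂ)) (C.x j) := by
  have hc0 : ∀ x ∈ C.A, c x ≠ 0 := by
    intro x hx h0
    have := hpos x hx
    rw [h0, zero_pow D.r_ne_zero] at this
    exact lt_irrefl _ this
  have hi : ContinuousOn (fun x => |c x|⁻¹) C.A :=
    hc.abs.inv₀ fun x hx => abs_ne_zero.2 (hc0 x hx)
  refine ⟨_, (hlift.smul (c := fun x => |c x|⁻¹ * c x) (hi.mul hc) fun x hx => ?_),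
    ⟨fun x => |c x|⁻¹, hi, fun x hx => ⟨inv_pos.2 (abs_pos.2 (hc0 x hx)), ?_⟩⟩, ?_⟩
  · rw [mul_pow]
    exact mul_pos (pow_pos (inv_pos.2 (abs_pos.2 (hc0 x hx))) _) (hpos x hx)
  · change ((|c x|⁻¹ * c x : ℝ) : ℂ) * (D.sec L x : ℂ) =
      ((|c x|⁻¹ : ℝ) : ℂ) * ((c x : ℂ) * (D.sec L x : ℂ))
    push_cast
    ring
  · have hne := D.real.x_ne_pole j
    by_cases hε : ε = 0
    · refine ⟨fun _ => 1, 1, one_ne_zero, tendsto_const_nhds, ?_⟩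
      have h1 := (eventually_punctured_iff (C := C) D.r_ne_zero (C.x_notMem_A j)).2 h
      filter_upwards [h1] with t h2
      rw [hε, zero_mul] at h2
      exact absurd h2 (lt_irrefl _)
    have hcont : ContinuousAt (fun y => ((ε / |ε| * Real.sqrt (1 + (D.Z y).re ^ 2) ^ D.d : ℝ) : ℂ))
        (C.x j) := Complex.continuous_ofReal.continuousAt.comp
          (continuousAt_const.mul (D.continuousAt_sqrt_zpow hne))
    refine ⟨fun t => ((ε / |ε| * Real.sqrt (1 + (D.Z (orbiChart r C.M (C.x j) t)).re ^ 2) ^ D.d : ℝ) : ℂ),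
      _, ?_, (hcont.tendsto.comp (tendsto_orbiChart D.r_ne_zero _)).mono_left nhdsWithin_le_nhds,
      ?_⟩
    · simp only [ne_eq, Complex.ofReal_eq_zero]
      exact mul_ne_zero (div_abs_ne_zero hε) (zpow_pos (sqrt_pos _) _).ne'
    · have h1 := (eventually_punctured_iff (C := C) D.r_ne_zero (C.x_notMem_A j)).2 h
      have h2 := (tendsto_orbiChart (M := C.M) D.r_ne_zero (C.x j)).eventually
        (IsCoord.eventually_ne hne)
      filter_upwards [h1, nhdsWithin_le_nhds h2, self_mem_nhdsWithin] with t h3 h4 h5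
      rw [D.smul_frame (C.x_mem_M j) h5.1, ← D.abs_sec L h5.2 h4]
      set y := orbiChart r C.M (C.x j) t
      change ((|c y|⁻¹ * c y : ℝ) : ℂ) * (D.sec L y : ℂ) = ((ε / |ε| * |D.sec L y| : ℝ) : ℂ)
      rw [← Complex.ofReal_mul]
      congr 1
      have e1 : 0 < |ε| := abs_pos.2 hε
      have e2 : 0 < |c y| := abs_pos.2 (hc0 y h5.2)
      have e3 : |ε| * (|c y| * |D.sec L y|) = ε * (c y * D.sec L y) := by
        rw [← abs_mul, ← abs_mul, abs_of_pos h3]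
      have e4 := sq_abs ε
      have e5 := sq_abs (D.sec L y)
      field_simp
      have e6 : |D.sec L y| ≠ 0 := abs_ne_zero.2 (D.sec_ne_zero L h5.2)
      have e7 : |D.sec L y| * (ε * |D.sec L y| * |c y| * |ε|) =
        |D.sec L y| * (c y * D.sec L y * |ε| * |ε|) := by
        have : ε ^ 2 * (c y * D.sec L y * |D.sec L y|) = |ε| ^ 2 * (c y * D.sec L y * |D.sec L y|) := by
          rw [e4]
        linear_combination ε * |D.sec L y| * e3 + this
      have := mul_left_cancel₀ e6 e7
      have e8 := mul_right_cancel₀ e1.ne' (this.trans (by ring :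
        _ = (c y * D.sec L y * |ε|) * |ε|))
      linarith

theorem exists_sec_mul_pos [DecidableEq B] (j : B) : ∃ ε : ℝ, ε ≠ 0 ∧ ∀ᶠ y in 𝓝[C.A] (C.x j),
    0 < ε * (D.sec L y * (if j ∈ L then D.offset j y else 1)) := by
  have hne := D.real.x_ne_pole j
  have hoff : ∀ i ∈ L.erase j, D.offset i (C.x j) ≠ 0 := by
    intro i hi h
    have h1 := sub_eq_zero.1 h
    have h2 : D.Z (C.x j) = D.Z (C.x i) := by
      rw [← D.real.ofReal_re (C.x_fix j), ← D.real.ofReal_re (C.x_fix i), h1]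
    exact Finset.ne_of_mem_erase hi
      (C.x_injective (D.isCoord.inj _ _ hne (D.real.x_ne_pole i) h2)).symm
  set g : X → ℝ := fun y => ∏ i ∈ L.erase j, D.offset i y / |D.offset i y| with hg
  have hg0 : g (C.x j) ≠ 0 := Finset.prod_ne_zero_iff.2 fun i hi => div_abs_ne_zero (hoff i hi)
  have hgc : ContinuousAt g (C.x j) := tendsto_finsetProd _ fun i hi =>
    continuousAt_div_abs (D.continuousAt_offset hne i) (hoff i hi)
  have h1 : ∀ᶠ y in 𝓝 (C.x j), 0 < g (C.x j) * g y :=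
    (hgc.tendsto.const_mul (g (C.x j))).eventually (lt_mem_nhds (mul_self_pos.2 hg0))
  refine ⟨g (C.x j), hg0, ?_⟩
  filter_upwards [nhdsWithin_le_nhds h1, nhdsWithin_le_nhds (IsCoord.eventually_ne hne),
    self_mem_nhdsWithin] with y h2 h3 h4
  have h5 : 0 < Real.sqrt (1 + (D.Z y).re ^ 2) ^ D.d := zpow_pos (sqrt_pos _) _
  rw [D.sec_of_ne L h3]
  split_ifs with hj
  · rw [← Finset.mul_prod_erase L _ hj]
    have h6 : 0 < |D.offset j y| := abs_pos.2 (D.offset_ne_zero h4 h3 j)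
    have h7 : D.offset j y / |D.offset j y| * D.offset j y = |D.offset j y| := by
      rw [div_mul_eq_mul_div, ← sq, ← sq_abs, sq, mul_div_assoc, div_self h6.ne', mul_one]
    have e : ∀ g₀ q o P R : ℝ, g₀ * (q * P * R * o) = (g₀ * P) * (q * o) * R := by
      intros; ring
    rw [e, h7]
    exact mul_pos (mul_pos h2 h6) h5
  · have e : (∏ i ∈ L, D.offset i y / |D.offset i y|) = g y := by
      rw [hg]; simp only [Finset.erase_eq_of_notMem hj]
    rw [e, mul_one, ← mul_assoc]
    positivity

theorem illegalS_smul_sec_iff [DecidableEq B]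
    (hlift : D.spin.IsLiftingS (fun x => (D.sec L x : ℂ)))
    {c : X → ℝ} (hc : ContinuousOn c C.A) (hpos : ∀ x ∈ C.A, 0 < c x ^ r) (j : B) :
    D.spin.IllegalS (fun x => (c x : ℂ) • (D.sec L x : ℂ)) (C.x j) ↔
      ∃ ε : ℝ, ε ≠ 0 ∧ ∀ᶠ y in 𝓝[C.A] (C.x j),
        0 < ε * (c y * (if j ∈ L then D.offset j y else 1)) := by
  obtain ⟨δ, hδ, h1⟩ := D.exists_sec_mul_pos L j
  constructor
  · intro h
    have e : (fun x => (c x : ℂ) • (D.sec L x : ℂ)) = fun x => ((c x * D.sec L x : ℝ) : ℂ) := by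
      funext x; rw [smul_eq_mul, Complex.ofReal_mul]
    rw [e] at h
    obtain ⟨ε, hε, h2⟩ := D.pos_of_illegalS h
    refine ⟨ε * δ, mul_ne_zero hε hδ, ?_⟩
    filter_upwards [h1, h2] with y h3 h4
    have h5 := mul_pos h3 h4
    have h6 : 0 < (D.sec L y * D.sec L y) *
        (ε * δ * (c y * (if j ∈ L then D.offset j y else 1))) := by linarith
    exact pos_of_mul_pos_right h6 (mul_self_nonneg _)
  · rintro ⟨ε, hε, h2⟩
    refine D.illegalS_of_pos L hlift hc hpos (ε := ε * δ) ?_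
    filter_upwards [h1, h2] with y h3 h4
    have h5 := mul_pos h3 h4
    set o := (if j ∈ L then D.offset j y else 1)
    have h6 : 0 < (o * o) * (ε * δ * (c y * D.sec L y)) := by linarith
    exact pos_of_mul_pos_right h6 (mul_self_nonneg _)

theorem mem_iff_not_illegalS_sec [Finite B]
    (hlift : D.spin.IsLiftingS (fun x => (D.sec L x : ℂ))) (j : B) :
    j ∈ L ↔ ¬ D.spin.IllegalS (fun x => (D.sec L x : ℂ)) (C.x j) := by
  classical
  have h := D.illegalS_smul_sec_iff L hlift (c := fun _ => 1) continuousOn_const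
    (fun _ _ => by simp) j
  simp only [Complex.ofReal_one, one_smul, one_mul] at h
  rw [h]
  by_cases hj : j ∈ L
  · simp only [hj, if_true, true_iff]
    rintro ⟨ε, hε, hev⟩
    have h1 := D.real.tendsto_pt (D.Z (C.x j)).re
    rw [D.real.pt_re (C.x_fix j) (D.real.x_ne_pole j)] at h1
    have h2 := h1.eventually hev
    obtain ⟨δ, hδ, hball⟩ := Metric.mem_nhdsWithin_iff.1 h2
    have h3 : ∀ s : ℝ, |s| < δ → s ≠ 0 → 0 < ε * s := by
      intro s hs hs0
      have h4 := @hball ((D.Z (C.x j)).re + s) ⟨by simpa [Real.dist_eq] using hs, by simpa using hs0⟩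
      have h5 : 0 < ε * D.offset j (D.real.pt (((D.Z (C.x j)).re + s : ℝ) : ℂ)) := h4
      rw [offset, D.real.apply_pt, Complex.ofReal_re] at h5
      simpa using h5
    have h6 := h3 (δ / 2) (by rw [abs_of_pos] <;> linarith) (by linarith)
    have h7 := h3 (-(δ / 2)) (by rw [abs_neg, abs_of_pos] <;> linarith) (by linarith)
    linarith
  · simp only [hj, if_false, false_iff, not_not]
    exact ⟨1, one_ne_zero, Filter.Eventually.of_forall fun y => by norm_num⟩

/-- A lifting with the same legal points is, up to sign, equivalent to the given one. -/
theorem equivS_sec [Finite I] [Finite B] (hlift : D.spin.IsLiftingS (fun x => (D.sec L x : ℂ)))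
    {w : ∀ x, D.spin.fiber x} (hw : D.spin.IsLiftingS w)
    (hL : ∀ j, j ∈ L ↔ ¬ D.spin.IllegalS w (C.x j)) {k : ℝ} (hk : 0 < k)
    (hp : w D.p = (k : ℂ) • (D.sec L D.p : ℂ)) :
    D.spin.EquivS w (fun x => (D.sec L x : ℂ)) := by
  classical
  obtain ⟨c, hc, h1⟩ := hw.exists_ratio D.r_ne_zero hlift
  have hc0 : ∀ x ∈ C.A, c x ≠ 0 := by
    intro x hx h0
    have := (h1 x hx).1
    rw [h0, zero_pow D.r_ne_zero] at this
    exact lt_irrefl _ this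
  have heq : D.spin.EquivS w (fun x => (c x : ℂ) • (D.sec L x : ℂ)) :=
    ⟨fun _ => 1, continuousOn_const, fun x hx => ⟨one_pos, by
      rw [Complex.ofReal_one]
      exact (h1 x hx).2.trans (one_smul ℂ _).symm⟩⟩
  obtain ⟨ε, hε, h2⟩ := D.real.exists_mul_pos hc hc0 (fun j => by
    have h3 := hL j
    rw [heq.illegalS_iff, D.illegalS_smul_sec_iff L hlift hc (fun x hx => (h1 x hx).1)] at h3
    by_cases hj : j ∈ L
    · simp only [hj, if_true, true_iff] at h3
      exact (D.real.exists_mul_pos_or hc hc0 j).resolve_right h3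
    · simpa only [hj, if_false, false_iff, not_not, mul_one] using h3)
  have h3 : c D.p = k := by
    have h4 := (h1 D.p D.real.pole_mem_A).2
    rw [hp] at h4
    have h5 : ((D.sec L D.p : ℝ) : ℂ) ≠ 0 := by
      exact_mod_cast D.sec_ne_zero L D.real.pole_mem_A
    have h6 : (k : ℂ) * (D.sec L D.p : ℂ) = (c D.p : ℂ) * (D.sec L D.p : ℂ) := h4
    exact_mod_cast (mul_right_cancel₀ h5 h6).symm
  have h4 : 0 < ε := by
    have := h2 D.p D.real.pole_mem_A
    rw [h3] at this
    exact pos_of_mul_pos_left this hk.le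
  exact ⟨c, hc, fun x hx => ⟨pos_of_mul_pos_right (h2 x hx) h4.le, (h1 x hx).2⟩⟩

end DiskData

end ModelLegal
end RSpin

namespace RSpin

set_option linter.unusedSectionVars false

/-! ### Classification of spin structures with liftings on a disk -/

section Classification

variable {X : Type*} [TopologicalSpace X] [ChartedSpace ℂ X] [IsManifold 𝓘(ℂ, ℂ) ω X]
  {r : ℕ} {I B : Type*} {C : MarkedDisk X I B}

theorem TwistedSpinBundle.Iso.scalar_mul_frameCoeff {M : Set X} {S S' : TwistedSpinBundle X r M}
    (f : Iso S S') {x y : X} {t : ℂ} (h : orbiChart r M x t = y) :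
    f.scalar y * S.frameCoeff x t y = f.frameScalar x t * S'.frameCoeff x t y := by
  subst h
  rw [frameScalar, S'.triv_eq, f.fiberCoord_apply,
    div_mul_cancel₀ _ (S'.frameCoeff_ne_zero x t _)]
  rfl

theorem ModelData.bundle_τ_tpow {M : Set X} [T1Space X] (D : ModelData X r M) {x : X} (hx : x ∉ M)
    (w : D.bundle.fiber x) :
    D.bundle.τ x hx (D.bundle.tpow w) = D.bundle.fiberCoord x w ^ r • D.η x :=
  (D.bundle_τ hx w).trans
    (congrArg (fun c : ℂ => c ^ r • D.η x) (D.bundle_fiberCoord x w).symm)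

theorem ModelData.η_ne_zero {M : Set X} [T1Space X] (D : ModelData X r M) {x : X} (hx : x ∉ M) :
    D.η x ≠ 0 := by
  intro h
  have h1 := D.bundle_τ_tpow hx ((D.bundle.fiberCoord x).symm 1)
  rw [D.bundle.τ_tpow, LinearEquiv.apply_symm_apply, one_pow, one_mul, one_smul, h] at h1
  exact smul_ne_zero (D.bundle.leadCoeff_ne_zero x) (dz_ne_zero (mem_chart_source ℂ x)) h1

namespace DiskSpin

variable (S : DiskSpin C r)

/-- The coordinate of the image of the unit vector at `x` by the involution. -/
noncomputable def invCoeff (x : X) (hx : x ∉ C.M) : ℂ :=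
  S.fiberCoord (C.φ x) (S.inv x (C.φ x) rfl hx ((S.fiberCoord x).symm 1))

theorem fiberCoord_inv (x : X) (hx : x ∉ C.M) (v : S.fiber x) :
    S.fiberCoord (C.φ x) (S.inv x (C.φ x) rfl hx v) =
      (starRingEnd ℂ) (S.fiberCoord x v) * S.invCoeff x hx := by
  conv_lhs => rw [S.eq_smul x v]
  rw [LinearMap.map_smulₛₗ, map_smul, smul_eq_mul, invCoeff]

theorem tendsto_invCoeff (x : X) : ∃ ψ c : ℂ → ℂ, ψ 0 = 0 ∧ ContinuousAt ψ 0 ∧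
    AnalyticAt ℂ c 0 ∧
    (∀ᶠ t in 𝓝 (0 : ℂ), orbiChart r C.M (C.φ x) (ψ t) = C.φ (orbiChart r C.M x t)) ∧
    ∀ᶠ t in 𝓝 (0 : ℂ), ∀ h : orbiChart r C.M x t ∉ C.M,
      (starRingEnd ℂ) (S.frameCoeff x t (orbiChart r C.M x t)) * S.invCoeff _ h =
      (starRingEnd ℂ) (c t) * S.frameCoeff (C.φ x) (ψ t) (C.φ (orbiChart r C.M x t)) := by
  obtain ⟨ψ, c, h1, h2, h3, h4, -, h5⟩ := S.inv_anti x
  refine ⟨ψ, c, h2, ?_, h4, h3, ?_⟩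
  · have h6 := Complex.continuous_conj.continuousAt.comp h1.continuousAt
    simpa [Function.comp_def] using h6
  · filter_upwards [h5] with t ht h
    have h6 := ht h
    rw [S.triv_eq, div_eq_iff (S.frameCoeff_ne_zero _ _ _), S.fiberCoord_inv] at h6
    exact h6

end DiskSpin

namespace DiskData

variable (D : DiskData C r) [T1Space X] {S : DiskSpin C r}

/-- The failure of an isomorphism to commute with the involutions. -/
theorem exists_defect (f : TwistedSpinBundle.Iso S.toTwistedSpinBundle D.bundle) :
    ∃ δ : X → ℂ, (∀ x, x ∉ C.M → ContinuousAt δ x ∧ δ x ^ r = 1) ∧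
      ∀ x (hx : x ∉ C.M), (starRingEnd ℂ) (f.scalar (C.φ x) * S.invCoeff x hx) =
        δ x * f.scalar x := by
  classical
  set δ : X → ℂ := fun x => if hx : x ∈ C.M then 1 else
    (starRingEnd ℂ) (f.scalar (C.φ x) * S.invCoeff x hx) / f.scalar x with hδ
  have hmul : ∀ x (hx : x ∉ C.M), (starRingEnd ℂ) (f.scalar (C.φ x) * S.invCoeff x hx) =
      δ x * f.scalar x := by
    intro x hx
    simp only [hδ, hx, dif_neg, not_false_eq_true]
    rw [div_mul_cancel₀ _ (f.scalar_ne_zero x)]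
  refine ⟨δ, fun x hx => ⟨?_, ?_⟩, hmul⟩
  · obtain ⟨ψ, c, hψ0, hψ, hc, hlift, hcoeff⟩ := S.tendsto_invCoeff x
    set g : ℂ → ℂ := fun t => (starRingEnd ℂ) (f.frameScalar (C.φ x) (ψ t)) * c t /
      f.frameScalar x t with hg
    have hgc : ContinuousAt g 0 := by
      refine ContinuousAt.div (ContinuousAt.mul (Complex.continuous_conj.continuousAt.comp ?_)
        hc.continuousAt) (f.analyticAt_frameScalar x).continuousAt (f.frameScalar_ne_zero x 0)
      refine ContinuousAt.comp (g := f.frameScalar (C.φ x)) ?_ hψ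
      rw [hψ0]
      exact (f.analyticAt_frameScalar _).continuousAt
    have hM : ∀ᶠ y in 𝓝 x, y ∉ C.M := D.finite.isClosed.isOpen_compl.mem_nhds hx
    have key : ∀ᶠ t in 𝓝 (0 : ℂ), δ (orbiChart r C.M x t) = g t := by
      filter_upwards [hlift, hcoeff, (tendsto_orbiChart (M := C.M) D.r_ne_zero x).eventually hM]
        with t h1 h2 h3
      have h4 := h2 h3
      have h5 := hmul _ h3
      have e1 := f.scalar_mul_frameCoeff (x := x) (t := t) rfl
      have e2 := f.scalar_mul_frameCoeff h1
      have e3 := D.factor_φ hx h1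
      rw [D.bundle_frameCoeff] at e1 e2
      set y := orbiChart r C.M x t
      have n1 := f.scalar_ne_zero y
      have n2 := f.frameScalar_ne_zero x t
      have n3 := S.frameCoeff_ne_zero x t y
      have n4 := D.factor_ne_zero x t
      rw [e3] at e2
      have e4 := congrArg (starRingEnd ℂ) e2
      have h6 := congrArg (starRingEnd ℂ) h4
      simp only [map_mul, map_inv₀, Complex.conj_conj] at e4 h6 h5
      rw [hg, eq_div_iff n2]
      apply mul_right_cancel₀ (inv_ne_zero n4)
      rw [mul_assoc, ← e1, ← mul_assoc, ← h5, mul_right_comm _ (c t), ← e4]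
      linear_combination (starRingEnd ℂ) (f.scalar (C.φ y)) * h6
    have h0 : ContinuousAt (fun y => g (coord x y)) x := by
      refine ContinuousAt.comp (g := g) ?_ (continuousAt_coord (mem_chart_source ℂ x))
      rwa [coord_self]
    refine h0.congr ?_
    filter_upwards [(tendsto_coord x).eventually key, eventually_mem_source x] with y h1 h2
    rw [orbiChart_coord hx h2] at h1
    exact h1.symm
  · have hφx : C.φ x ∉ C.M := C.φ_mem_M_iff.not.2 hx
    set e := (S.fiberCoord x).symm 1 with he
    have hE : S.fiberCoord x e = 1 := by simp [he]
    obtain ⟨u, hu⟩ : ∃ u : ℂ, D.η x u ≠ 0 := by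
      by_contra h
      push Not at h
      exact D.η_ne_zero hx (ContinuousLinearMap.ext fun u => h u)
    have h1 := S.inv_τ x (C.φ x) rfl hx hφx e u
    rw [← f.comm_τ, ← f.comm_τ] at h1
    have h2 : ∀ y (hy : y ∉ C.M) (w : S.fiber y), D.bundle.τ y hy (D.bundle.tpow (f.toEquiv y w)) =
        (f.scalar y * S.fiberCoord y w) ^ r • D.η y := by
      intro y hy w
      rw [← f.fiberCoord_apply, D.bundle_τ_tpow]
    rw [h2, h2] at h1
    have h3 : (f.scalar (C.φ x) * S.fiberCoord (C.φ x) (S.inv x (C.φ x) rfl hx e)) ^ r *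
        D.η (C.φ x) (tangentMapAt C.φ x (C.φ x) u) =
        (starRingEnd ℂ) ((f.scalar x * S.fiberCoord x e) ^ r * D.η x u) := h1
    rw [map_mul, ← D.η_φ rfl u, S.fiberCoord_inv, hE, map_one, one_mul, mul_one] at h3
    have h4 : D.η (C.φ x) (tangentMapAt C.φ x (C.φ x) u) ≠ 0 := by
      intro h
      have := (D.η_φ rfl u).symm.trans h
      exact hu ((map_eq_zero _).1 this)
    have h5 := congrArg (starRingEnd ℂ) (mul_right_cancel₀ h4 h3)
    rw [Complex.conj_conj, map_pow, hmul, mul_pow] at h5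
    exact mul_right_cancel₀ (pow_ne_zero r (f.scalar_ne_zero x)) (h5.trans (one_mul _).symm)

theorem scalar_mul_invCoeff_eq (f : TwistedSpinBundle.Iso S.toTwistedSpinBundle D.bundle)
    {x₀ : X} (hx₀ : x₀ ∉ C.M)
    (h₀ : (starRingEnd ℂ) (f.scalar (C.φ x₀) * S.invCoeff x₀ hx₀) = f.scalar x₀) {x : X}
    (hx : x ∉ C.M) : f.scalar (C.φ x) * S.invCoeff x hx = (starRingEnd ℂ) (f.scalar x) := by
  obtain ⟨δ, h1, h2⟩ := D.exists_defect f
  have hfin : {z : ℂ | z ^ r = 1}.Finite := by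
    refine (Polynomial.nthRoots r (1 : ℂ)).toFinset.finite_toSet.subset fun z hz => ?_
    simpa [Polynomial.mem_nthRoots (Nat.pos_of_ne_zero D.r_ne_zero)] using hz
  have h3 : δ x = δ x₀ := (D.isCoord.isPreconnected_compl D.finite).constant_of_mapsTo
    hfin.isDiscrete (f := δ)
    (fun y hy => (h1 y hy).1.continuousWithinAt) (fun y hy => (h1 y hy).2) hx hx₀
  have h4 : δ x₀ = 1 := by
    have := h2 x₀ hx₀
    rw [h₀] at this
    exact mul_right_cancel₀ (f.scalar_ne_zero x₀) (this.symm.trans (one_mul _).symm)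
  have h5 := h2 x hx
  rw [h3, h4, one_mul] at h5
  rw [← h5, Complex.conj_conj]

/-- An isomorphism compatible with the involutions at one point. -/
noncomputable def diskIso (f : TwistedSpinBundle.Iso S.toTwistedSpinBundle D.bundle)
    {x₀ : X} (hx₀ : x₀ ∉ C.M)
    (h₀ : (starRingEnd ℂ) (f.scalar (C.φ x₀) * S.invCoeff x₀ hx₀) = f.scalar x₀) :
    DiskSpin.Iso S D.spin where
  toIso := f
  comm_inv x y h hx v := by
    subst h
    have h1 : f.toEquiv (C.φ x) (S.inv x (C.φ x) rfl hx v) =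
        f.scalar (C.φ x) * S.fiberCoord (C.φ x) (S.inv x (C.φ x) rfl hx v) :=
      (D.bundle_fiberCoord _ _).symm.trans (f.fiberCoord_apply (C.φ x) _)
    have h2 : f.toEquiv x v = f.scalar x * S.fiberCoord x v :=
      (D.bundle_fiberCoord x _).symm.trans (f.fiberCoord_apply x v)
    refine h1.trans (Eq.trans ?_ (congrArg (starRingEnd ℂ) h2).symm)
    rw [S.fiberCoord_inv, mul_left_comm, D.scalar_mul_invCoeff_eq f hx₀ h₀ hx, map_mul, mul_comm]

theorem exists_iso_sec [Finite I] [Finite B] (L : Finset B)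
    (hlift : D.spin.IsLiftingS (fun x => (D.sec L x : ℂ))) {v : ∀ x, S.fiber x}
    (hv : S.IsLiftingS v) (htw : ∀ x ∈ C.M, S.twist x = D.bundle.twist x)
    (hL : ∀ j, j ∈ L ↔ ¬ S.IllegalS v (C.x j)) :
    ∃ F : DiskSpin.Iso S D.spin,
      D.spin.EquivS (fun x => F.toEquiv x (v x)) (fun x => (D.sec L x : ℂ)) := by
  obtain ⟨f⟩ := TwistedSpinBundle.nonempty_iso_of_twist C.sphere D.finite D.two_le htw
  have hp := D.real.pole_mem_A
  set s : ℂ := (D.sec L D.p : ℂ) with hs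
  have hs0 : s ≠ 0 := Complex.ofReal_ne_zero.2 (D.sec_ne_zero L hp)
  set β := f.scalar D.p * S.fiberCoord D.p (v D.p) with hβ
  have hpos1 : C.IsPos D.p (β ^ r • D.η D.p) := by
    have := hv.positive D.p hp
    rwa [← f.comm_τ, D.bundle_τ_tpow, f.fiberCoord_apply] at this
  have hpos2 : C.IsPos D.p (s ^ r • D.η D.p) := by
    have h1 : D.bundle.τ D.p hp.2 (D.bundle.tpow (x := D.p) s) = s ^ r • D.η D.p :=
      D.bundle_τ hp.2 s
    have := hlift.positive D.p hp
    exact h1 ▸ this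
  obtain ⟨k, hk, hk'⟩ := hpos1.exists_eq_smul hp.1 hpos2
  rw [smul_smul] at hk'
  have hk2 := smul_cotangent_inj (D.η_ne_zero hp.2) hk'
  obtain ⟨ζ, c, hζ, hc, hβc⟩ := exists_root_of_pow_pos (β := β / s) D.r_ne_zero hk (by
    rw [div_pow, hk2, mul_div_cancel_right₀ _ (pow_ne_zero _ hs0)])
  have hζ0 : ζ ≠ 0 := by rintro rfl; simp [D.r_ne_zero] at hζ
  have hζi : ζ⁻¹ ^ r = 1 := by rw [inv_pow, hζ, inv_one]
  set f' := f.rescale ζ⁻¹ D.r_ne_zero hζi with hf'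
  have hf's : ∀ y, f'.scalar y = ζ⁻¹ * f.scalar y := fun y => by
    simp [hf', TwistedSpinBundle.Iso.rescale]
  have hval : f'.scalar D.p * S.fiberCoord D.p (v D.p) = c * s := by
    rw [hf's, mul_assoc, ← hβ, (div_eq_iff hs0).1 hβc]
    field_simp
  have hv0 : S.fiberCoord D.p (v D.p) ≠ 0 := by simpa using hv.ne_zero D.r_ne_zero hp
  have h₀ : (starRingEnd ℂ) (f'.scalar (C.φ D.p) * S.invCoeff D.p hp.2) = f'.scalar D.p := by
    have key : ∀ (y : X) (hy : C.φ D.p = y),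
        S.fiberCoord (C.φ D.p) (S.inv D.p (C.φ D.p) rfl hp.2 (v D.p)) =
          S.fiberCoord y (S.inv D.p y hy hp.2 (v D.p)) ∧
        f'.scalar (C.φ D.p) = f'.scalar y := by
      intro y hy
      subst hy
      exact ⟨rfl, rfl⟩
    obtain ⟨h1, h2⟩ := key D.p hp.1
    rw [hv.invariant D.p hp, S.fiberCoord_inv] at h1
    have h3 : (starRingEnd ℂ) (f'.scalar D.p * S.fiberCoord D.p (v D.p)) =
      f'.scalar D.p * S.fiberCoord D.p (v D.p) := by
      rw [hval, hs, ← Complex.ofReal_mul, Complex.conj_ofReal]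
    rw [h2]
    apply mul_right_cancel₀ hv0
    rw [← h3, map_mul, map_mul]
    have h4 := congrArg (starRingEnd ℂ) h1
    rw [map_mul, Complex.conj_conj] at h4
    linear_combination (starRingEnd ℂ) (f'.scalar D.p) * h4
  refine ⟨D.diskIso f' hp.2 h₀, ?_⟩
  have hmult := TwistedSpinBundle.mult_eq_of_twist htw
  refine D.equivS_sec L hlift (hv.map (D.diskIso f' hp.2 h₀)) (fun j => ?_) hc ?_
  · rw [hL, DiskSpin.illegalS_map_iff]
    exact congrFun hmult.1 _
  · have h1 := f'.fiberCoord_apply D.p (v D.p)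
    exact (D.bundle_fiberCoord D.p _).symm.trans (h1.trans hval)

end DiskData

/-- An automorphism of a spin structure with a lifting is trivial. -/
theorem LiftedS.Iso.apply_eq [Finite I] [Finite B] (hr : 2 ≤ r) {S : LiftedS C r} (f : S.Iso S)
    (x : X) (v : S.fiber x) : f.toEquiv x v = v := by
  obtain ⟨p, Z, hZ⟩ := C.exists_isRealCoord
  have hp : p ∈ C.A := ⟨hZ.φ_pole, hZ.pole_notMem⟩
  obtain ⟨ζ, hζ, h⟩ := f.toIso.exists_apply_eq C.sphere C.M_finite hr
  obtain ⟨c, -, hc⟩ := f.map_lifting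
  obtain ⟨h1, h2⟩ := hc p hp
  have h3 : ζ • S.v p = (c p : ℂ) • S.v p := (h p (S.v p)).symm.trans h2
  have h4 := smul_left_injective ℂ (S.isLifting.ne_zero (by omega) hp) h3
  rw [h x v, eq_one_of_pow_eq_one_of_pos (by omega) hζ h1 h4, one_smul]

/-- The inverse isomorphism. -/
noncomputable def LiftedS.Iso.symm {S S' : LiftedS C r} (f : S.Iso S') : S'.Iso S where
  toDiskIso := f.toDiskIso.symm
  map_lifting := by
    have h := (f.map_lifting.map f.toDiskIso.symm).symm
    have e : (fun x => f.toDiskIso.symm.toEquiv x (f.toEquiv x (S.v x))) = S.v :=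
      funext fun x => f.toIso.symm_apply_apply x (S.v x)
    rwa [e] at h

/-- The composition of isomorphisms. -/
noncomputable def LiftedS.Iso.trans {S S' S'' : LiftedS C r} (f : S.Iso S') (g : S'.Iso S'') :
    S.Iso S'' where
  toDiskIso := f.toDiskIso.trans g.toDiskIso
  map_lifting := by
    have h := (f.map_lifting.map g.toDiskIso).trans g.map_lifting
    have e : (fun x => (f.toDiskIso.trans g.toDiskIso).toEquiv x (S.v x)) =
        fun x => g.toEquiv x (f.toEquiv x (S.v x)) :=
      funext fun x => f.toIso.trans_apply g.toIso x (S.v x)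
    rwa [e]

end Classification
end RSpin

namespace RSpin

set_option linter.unusedSectionVars false

/-! ### Existence of spin structures with liftings on a disk -/

section Existence

variable {X : Type*} [TopologicalSpace X] [ChartedSpace ℂ X] [IsManifold 𝓘(ℂ, ℂ) ω X]
  {r : ℕ} {I B : Type*} [Fintype I] [Fintype B]

/-- The numerical conditions on the twists `a`, `b` and on the set `L` of legal points. -/
structure DiskTwists (r : ℕ) (a : I → ℤ) (b : B → ℤ) (L : Finset B) : Prop where
  two_le : 2 ≤ r
  internal : ∀ i, 0 ≤ a i ∧ a i ≤ r - 1
  boundary : ∀ j, 0 ≤ b j ∧ b j ≤ r - 2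
  dvd : (r : ℤ) ∣ 2 * (∑ i, a i) + (∑ j, b j) - (r - 2)
  even : Even r → (∀ j, Even (b j)) ∧
    (2 * (∑ i, a i) + (∑ j, b j) + 2) / (r : ℤ) ≡ (L.card : ℤ) [ZMOD 2]
  odd : Odd r → ∀ j, j ∈ L ↔ Odd (b j)

namespace DiskTwists

variable {a : I → ℤ} {b : B → ℤ} {L : Finset B}

theorem even_add [DecidableEq B] (h : DiskTwists r a b L) (j : B) :
    Even (((if j ∈ L then r else 0 : ℕ) : ℤ) + b j) := by
  rcases Nat.even_or_odd r with hr | hr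
  · have h1 := (h.even hr).1 j
    split_ifs
    · exact ((Int.even_coe_nat r).2 hr).add h1
    · simpa using h1
  · have h1 := h.odd hr j
    split_ifs with hj
    · exact ((Int.odd_coe_nat r).2 hr).add_odd (h1.1 hj)
    · simpa using (Int.not_odd_iff_even.1 (h1.not.1 hj))

theorem even_card_sub (h : DiskTwists r a b L) {d : ℤ}
    (hd : 2 * (∑ i, a i) + (∑ j, b j) + 2 = -(r * d)) : Even ((L.card : ℤ) - d) := by
  classical
  have hr0 : (r : ℤ) ≠ 0 := by have := h.two_le; omega
  rcases Nat.even_or_odd r with hr | hr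
  · have h1 := (h.even hr).2
    rw [hd, ← mul_neg, Int.mul_ediv_cancel_left _ hr0] at h1
    have h2 := h1.dvd
    rw [even_iff_two_dvd]
    omega
  · have h1 : Even (∑ j, (((if j ∈ L then r else 0 : ℕ) : ℤ) + b j)) :=
      Finset.even_sum _ fun j _ => h.even_add j
    rw [Finset.sum_add_distrib] at h1
    have h2 : ∑ j, ((if j ∈ L then r else 0 : ℕ) : ℤ) = r * L.card := by
      rw [← Nat.cast_sum, Finset.sum_ite_mem]
      simp [mul_comm]
    have h3 : (r : ℤ) * L.card + ∑ j, b j = r * ((L.card : ℤ) - d) + 2 * (-(∑ i, a i) - 1) := by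
      linarith
    rw [h2, h3, Int.even_add] at h1
    have h4 := h1.2 (even_two_mul _)
    rw [Int.even_mul] at h4
    exact h4.resolve_left (Int.not_even_iff_odd.2 ((Int.odd_coe_nat r).2 hr))

end DiskTwists

variable (C : MarkedDisk X I B) {a : I → ℤ} {b : B → ℤ} {L : Finset B}

theorem exists_diskData (h : DiskTwists r a b L) : ∃ D : DiskData C r,
    (∀ i, D.N (C.z i) = a i) ∧ (∀ i, D.N (C.φ (C.z i)) = a i) ∧ ∀ j, D.N (C.x j) = b j := by
  obtain ⟨p, Z, hZ⟩ := C.exists_isRealCoord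
  obtain ⟨e, he⟩ := h.dvd
  set N : X → ℤ := Function.extend C.point (Sum.elim (Sum.elim a a) b) 0 with hN
  have hN1 : ∀ i, N (C.z i) = a i := fun i =>
    C.point_injective.extend_apply _ _ (Sum.inl (Sum.inl i))
  have hN2 : ∀ i, N (C.φ (C.z i)) = a i := fun i =>
    C.point_injective.extend_apply _ _ (Sum.inl (Sum.inr i))
  have hN3 : ∀ j, N (C.x j) = b j := fun j => C.point_injective.extend_apply _ _ (Sum.inr j)
  have hbound : ∀ x ∈ C.M, 0 ≤ N x ∧ N x ≤ r - 1 := by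
    rintro x ((⟨i, rfl⟩ | ⟨i, rfl⟩) | ⟨j, rfl⟩)
    · rw [hN1]; exact h.internal i
    · rw [hN2]; exact h.internal i
    · rw [hN3]; have := h.boundary j; omega
  refine ⟨{ p := p, Z := Z, isCoord := hZ.toIsCoord, two_le := h.two_le, finite := C.M_finite,
            notMem := hZ.pole_notMem, N := N,
            neg_one_le := fun x hx => by have := hbound x hx; omega
            le_sub_one := fun x hx => (hbound x hx).2
            d := -e - 1
            sum_eq := ?_
            real := hZ
            N_φ := ?_
            N_nonneg := fun x hx => (hbound x hx).1 }, hN1, hN2, hN3⟩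
  · rw [C.sum_M C.M_finite]
    simp only [hN1, hN2, hN3, Finset.sum_add_distrib]
    linarith
  · rintro x ((⟨i, rfl⟩ | ⟨i, rfl⟩) | ⟨j, rfl⟩)
    · rw [hN1, hN2]
    · rw [C.φ_φ, hN1, hN2]
    · rw [C.x_fix]

theorem exists_diskData_isLiftingS (h : DiskTwists r a b L) [T1Space X] : ∃ D : DiskData C r,
    D.spin.HasTwists a b ∧ D.spin.IsLiftingS (fun x => (D.sec L x : ℂ)) := by
  classical
  obtain ⟨D, h1, h2, h3⟩ := exists_diskData C h
  refine ⟨D, ⟨fun i => ?_, fun i => ?_, fun j => ?_⟩, D.isLiftingS_sec L (fun j => ?_) ?_⟩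
  · exact (D.bundle_twist (C.z_mem_M i)).trans (h1 i)
  · exact (D.bundle_twist (C.φ_mem_M (C.z_mem_M i))).trans (h2 i)
  · exact (D.bundle_twist (C.x_mem_M j)).trans (h3 j)
  · rw [h3]; exact h.even_add j
  · refine h.even_card_sub ?_
    have := D.sum_eq
    rw [C.sum_M D.finite] at this
    simp only [h1, h2, h3, Finset.sum_add_distrib] at this
    linarith

variable {C}

theorem DiskSpin.HasTwists.twist_eq {S S' : DiskSpin C r} (h : S.HasTwists a b)
    (h' : S'.HasTwists a b) : ∀ x ∈ C.M, S.twist x = S'.twist x := by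
  rintro x ((⟨i, rfl⟩ | ⟨i, rfl⟩) | ⟨j, rfl⟩)
  · rw [h.1, h'.1]
  · rw [h.2.1, h'.2.1]
  · rw [h.2.2, h'.2.2]

theorem exists_liftedS_universal (C : MarkedDisk X I B) (h : DiskTwists r a b L) :
    ∃ S₀ : LiftedS C r, S₀.HasTwists a b ∧ S₀.LegalSet L ∧
      ∀ S : LiftedS C r, S.HasTwists a b → S.LegalSet L → Nonempty (S.Iso S₀) := by
  have := C.sphere.t2Space
  obtain ⟨D, htw, hlift⟩ := exists_diskData_isLiftingS C h
  refine ⟨⟨D.spin, _, hlift⟩, htw, D.mem_iff_not_illegalS_sec L hlift, fun S hS hL => ?_⟩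
  obtain ⟨F, hF⟩ := D.exists_iso_sec L hlift S.isLifting (hS.twist_eq htw) hL
  exact ⟨⟨F, hF⟩⟩

theorem exists_liftedS (C : MarkedDisk X I B) (h : DiskTwists r a b L) :
    ∃ S : LiftedS C r, S.HasTwists a b ∧ S.LegalSet L := by
  obtain ⟨S₀, h1, h2, -⟩ := exists_liftedS_universal C h
  exact ⟨S₀, h1, h2⟩

theorem nonempty_liftedS_iso (h : DiskTwists r a b L) {S S' : LiftedS C r}
    (hS : S.HasTwists a b) (hL : S.LegalSet L) (hS' : S'.HasTwists a b) (hL' : S'.LegalSet L) :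
    Nonempty (S.Iso S') := by
  obtain ⟨S₀, -, -, h0⟩ := exists_liftedS_universal C h
  obtain ⟨f⟩ := h0 S hS hL
  obtain ⟨g⟩ := h0 S' hS' hL'
  exact ⟨f.trans g.symm⟩

end Existence
end RSpin

namespace RSpin

set_option linter.unusedSectionVars false

/-! ### Liftings of the dual bundle -/

section LiftingJ

variable {X : Type*} [TopologicalSpace X] [ChartedSpace ℂ X] [IsManifold 𝓘(ℂ, ℂ) ω X]
  {r : ℕ} {I B : Type*} {C : MarkedDisk X I B}

/-- A continuous positive section of the cotangent bundle over the boundary. -/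
def MarkedDisk.IsPosForm (C : MarkedDisk X I B) (η : ∀ y : X, Cotangent y) : Prop :=
  ∀ q, C.φ q = q → C.IsPos q (η q) ∧
    ∃ h : X → ℂ, ContinuousAt h q ∧ h q ≠ 0 ∧ ∀ᶠ y in 𝓝 q, η y = h y • dz q y

theorem MarkedDisk.IsPos.conj [Finite I] [Finite B] {q : X} (hq : C.φ q = q) {ξ : Cotangent q}
    (h : C.IsPos q ξ) (u : ℂ) : ξ (tangentMapAt C.φ q q u) = (starRingEnd ℂ) (ξ u) := by
  obtain ⟨F, hF⟩ := C.exists_isBoundaryCoord q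
  obtain ⟨c, rfl⟩ := clm_exists_smul (ξ := differential F q) hF.differential_ne_zero ξ
  obtain ⟨h1, h2⟩ := (hF.isPos_smul_iff hq c).1 h
  have h3 := congrArg (starRingEnd ℂ) (hF.conj_differential hq u)
  rw [Complex.conj_conj] at h3
  change c * differential F q (tangentMapAt C.φ q q u) = (starRingEnd ℂ) (c * differential F q u)
  rw [map_mul, Complex.conj_eq_iff_im.2 h2]
  exact congrArg (c * ·) h3

namespace DiskSpin

variable {S S' : DiskSpin C r} {v v' : ∀ x, S.fiber x} {w w' : S.SectionJ}
  {η : ∀ y : X, Cotangent y}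

/-- Continuity of a section of the dual bundle. -/
def ContinuousJ (S : DiskSpin C r) (w : S.SectionJ) : Prop :=
  ∀ x ∈ C.A, ∃ h : X → ℂ, ContinuousWithinAt h C.A x ∧
    ∀ᶠ y in 𝓝[C.A] x, w y ((S.triv x (coord x y) y).symm 1) = h y • dz x y

/-- The section of the dual bundle whose pairing with `v` is `η`. -/
noncomputable def dualSection (S : DiskSpin C r) (η : ∀ y : X, Cotangent y) (v : ∀ x, S.fiber x) :
    S.SectionJ := fun x =>
  (S.fiberCoord x).toLinearMap.smulRight ((S.fiberCoord x (v x))⁻¹ • η x)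

theorem dualSection_apply (x : X) (u : S.fiber x) :
    S.dualSection η v x u = (S.fiberCoord x u * (S.fiberCoord x (v x))⁻¹) • η x :=
  smul_smul (S.fiberCoord x u) (S.fiberCoord x (v x))⁻¹ (η x)

theorem dualSection_self {x : X} (h : v x ≠ 0) : S.dualSection η v x (v x) = η x := by
  rw [dualSection_apply, mul_inv_cancel₀ (by simpa using h)]
  exact one_smul ℂ (η x)

theorem triv_symm_ne_zero (S : DiskSpin C r) (x : X) (t : ℂ) (y : X) :
    (S.triv x t y).symm 1 ≠ 0 := by simp

theorem eq_triv_smul (S : DiskSpin C r) (x : X) (t : ℂ) (y : X) (u : S.fiber y) :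
    u = S.triv x t y u • (S.triv x t y).symm 1 := by
  apply (S.triv x t y).injective
  simp

theorem continuousJ_dualSection (hη : C.IsPosForm η) (hv : S.IsLiftingS v)
    (h0 : ∀ x ∈ C.A, v x ≠ 0) : S.ContinuousJ (S.dualSection η v) := by
  intro x hx
  obtain ⟨-, h, h1, h2, h3⟩ := hη x hx.1
  refine ⟨fun y => (S.triv x (coord x y) y (v y))⁻¹ * h y,
    ((hv.continuous x hx).inv₀ (by simpa using h0 x hx)).mul h1.continuousWithinAt, ?_⟩
  filter_upwards [nhdsWithin_le_nhds h3] with y hy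
  rw [dualSection_apply, hy, smul_smul, S.triv_eq, inv_div, div_eq_mul_inv]
  rfl

theorem isLiftingJ_dualSection [Finite I] [Finite B] (hr : r ≠ 0) (hη : C.IsPosForm η)
    (hv : S.IsLiftingS v) : S.IsLiftingJ (S.dualSection η v) where
  continuous := continuousJ_dualSection hη hv fun _ hx => hv.ne_zero hr hx
  invariant x hx u t := by
    have h1 := ((hη x hx.1).1).conj hx.1 t
    have h2 : S.fiberCoord x (v x) ≠ 0 := by simpa using hv.ne_zero hr hx
    set k := S.fiberCoord x u * (S.fiberCoord x (v x))⁻¹ with hk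
    have h3 : u = k • v x := by
      apply (S.fiberCoord x).injective
      rw [map_smul, smul_eq_mul, hk, inv_mul_cancel_right₀ h2]
    have h4 : S.fiberCoord x (S.inv x x hx.1 hx.2 u) * (S.fiberCoord x (v x))⁻¹ =
        (starRingEnd ℂ) k := by
      rw [h3, LinearMap.map_smulₛₗ, hv.invariant x hx, map_smul, smul_eq_mul,
        mul_inv_cancel_right₀ h2]
    rw [dualSection_apply, dualSection_apply, h4]
    change (starRingEnd ℂ) k * η x (tangentMapAt C.φ x x t) = (starRingEnd ℂ) (k * η x t)
    exact (congrArg ((starRingEnd ℂ) k * ·) h1).trans (map_mul (starRingEnd ℂ) k (η x t)).symm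
  positive := ⟨v, hv, fun x hx => by
    rw [dualSection_self (hv.ne_zero hr hx)]; exact (hη x hx.1).1⟩

/-- Two continuous sections which are positive on the same lifting are equivalent. -/
theorem equivJ_of_isPos [Finite I] [Finite B] (hr : r ≠ 0) (hw : S.ContinuousJ w)
    (hw' : S.ContinuousJ w') (hv : S.IsLiftingS v) (h : ∀ x ∈ C.A, C.IsPos x (w x (v x)))
    (h' : ∀ x ∈ C.A, C.IsPos x (w' x (v x))) : S.EquivJ w w' := by
  have h1 : ∀ x, ∃ c : ℝ, x ∈ C.A → 0 < c ∧ w x = (c : ℂ) • w' x := by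
    intro x
    by_cases hx : x ∈ C.A
    · obtain ⟨c, hc, hc'⟩ := (h x hx).exists_eq_smul hx.1 (h' x hx)
      refine ⟨c, fun _ => ⟨hc, LinearMap.ext fun u => ?_⟩⟩
      have h2 : S.fiberCoord x (v x) ≠ 0 := by simpa using hv.ne_zero hr hx
      have h3 : u = (S.fiberCoord x u * (S.fiberCoord x (v x))⁻¹) • v x := by
        apply (S.fiberCoord x).injective
        rw [map_smul, smul_eq_mul, inv_mul_cancel_right₀ h2]
      rw [h3, map_smul, map_smul, LinearMap.smul_apply, hc']
    · exact ⟨0, fun h => absurd h hx⟩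
  choose c hc using h1
  refine ⟨c, fun x hx => ?_, hc⟩
  obtain ⟨k, hk, hk'⟩ := hw x hx
  obtain ⟨k', hk1, hk1'⟩ := hw' x hx
  have hne : ∀ y ∈ C.A, ∀ e : S.fiber y, e ≠ 0 → w' y e ≠ 0 := by
    intro y hy e he h0
    have h2 : S.fiberCoord y e ≠ 0 := by simpa using he
    have h3 : v y = (S.fiberCoord y (v y) * (S.fiberCoord y e)⁻¹) • e := by
      apply (S.fiberCoord y).injective
      rw [map_smul, smul_eq_mul, inv_mul_cancel_right₀ h2]
    refine (h' y hy).ne_zero hy.1 ?_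
    rw [h3, map_smul, h0]
    have h4 : ∀ k : ℂ, k • (0 : ℂ →L[ℂ] ℂ) = 0 := fun k => by ext; simp
    exact h4 _
  have h2 : ∀ᶠ y in 𝓝[C.A] x, y ∈ C.A → k' y ≠ 0 ∧ (c y : ℂ) = k y / k' y := by
    filter_upwards [hk', hk1', nhdsWithin_le_nhds (eventually_mem_source x)] with y h3 h4 h5 hy
    have h6 := hne y hy _ (S.triv_symm_ne_zero x (coord x y) y)
    rw [h4] at h6
    have h7 : k' y ≠ 0 := by
      intro h0
      rw [h0] at h6
      exact h6 (zero_smul ℂ (dz x y : ℂ →L[ℂ] ℂ))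
    refine ⟨h7, ?_⟩
    rw [(hc y hy).2, LinearMap.smul_apply, h4, smul_smul] at h3
    rw [eq_div_iff h7]
    exact smul_dz_inj h5 h3
  have h3 : ContinuousWithinAt (fun y => (c y : ℂ)) C.A x := by
    have h4 := (h2.self_of_nhdsWithin hx) hx
    refine (hk.div hk1 h4.1).congr_of_eventuallyEq ?_ h4.2
    filter_upwards [h2, self_mem_nhdsWithin] with y h5 h6 using (h5 h6).2
  have h4 := Complex.continuous_re.continuousAt.comp_continuousWithinAt h3
  exact h4.congr (fun y _ => (Complex.ofReal_re (c y)).symm) (Complex.ofReal_re (c x)).symm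

theorem equivS_of_isPos [Finite I] [Finite B] (hr : r ≠ 0) (hv : S.IsLiftingS v)
    (hv' : S.IsLiftingS v') (h : ∀ x ∈ C.A, C.IsPos x (w x (v x)))
    (h' : ∀ x ∈ C.A, C.IsPos x (w x (v' x))) : S.EquivS v v' := by
  obtain ⟨c, hc, h1⟩ := hv.exists_ratio hr hv'
  refine ⟨c, hc, fun x hx => ⟨?_, (h1 x hx).2⟩⟩
  obtain ⟨k, hk, hk'⟩ := (h x hx).exists_eq_smul hx.1 (h' x hx)
  rw [(h1 x hx).2, map_smul] at hk'
  have := smul_cotangent_inj ((h' x hx).ne_zero hx.1) hk'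
  have h2 : c x = k := by exact_mod_cast this
  rw [h2]
  exact hk

theorem EquivS.isPos (h : S.EquivS v v') (hw : ∀ x ∈ C.A, C.IsPos x (w x (v' x))) :
    ∀ x ∈ C.A, C.IsPos x (w x (v x)) := by
  obtain ⟨c, -, h⟩ := h
  intro x hx
  rw [(h x hx).2, map_smul]
  exact (hw x hx).smul (h x hx).1

theorem EquivJ.isPos (h : S.EquivJ w w') (hw : ∀ x ∈ C.A, C.IsPos x (w' x (v x))) :
    ∀ x ∈ C.A, C.IsPos x (w x (v x)) := by
  obtain ⟨c, -, h⟩ := h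
  intro x hx
  rw [(h x hx).2, LinearMap.smul_apply]
  exact (hw x hx).smul (h x hx).1

/-- A lifting normalized to have a given positive pairing. -/
theorem exists_normalized [Finite I] [Finite B] (hr : r ≠ 0) (hη : C.IsPosForm η)
    (hw : S.ContinuousJ w) (hv : S.IsLiftingS v) (h : ∀ x ∈ C.A, C.IsPos x (w x (v x))) :
    ∃ v', S.IsLiftingS v' ∧ S.EquivS v' v ∧ ∀ x ∈ C.A, w x (v' x) = η x := by
  have h0 := isLiftingJ_dualSection hr hη hv
  obtain ⟨c, hc, h1⟩ := equivJ_of_isPos hr h0.continuous hw hv (fun x hx => by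
    rw [dualSection_self (hv.ne_zero hr hx)]; exact (hη x hx.1).1) h
  refine ⟨_, hv.smul hc fun x hx => pow_pos (h1 x hx).1 r, ⟨c, hc, fun x hx =>
    ⟨(h1 x hx).1, rfl⟩⟩, fun x hx => ?_⟩
  rw [map_smul, ← LinearMap.smul_apply, ← (h1 x hx).2, dualSection_self (hv.ne_zero hr hx)]

/-- A lifting of the dual bundle and the corresponding lifting have the same legal points. -/
theorem illegalJ_iff [Finite I] [Finite B] (hr : r ≠ 0) (hη : C.IsPosForm η) (hw : S.IsLiftingJ w)
    (hv : S.IsLiftingS v) (h : ∀ x ∈ C.A, C.IsPos x (w x (v x))) (j : B) :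
    S.IllegalJ w (C.x j) ↔ S.IllegalS v (C.x j) := by
  obtain ⟨-, k, hk, hk0, hkη⟩ := hη (C.x j) (C.x_fix j)
  have hkt : Filter.Tendsto (fun t => k (orbiChart r C.M (C.x j) t))
      (𝓝[punctured C r (C.x j)] 0) (𝓝 (k (C.x j))) :=
    (hk.tendsto.comp (tendsto_orbiChart hr _)).mono_left nhdsWithin_le_nhds
  have hkη' : ∀ᶠ t in 𝓝[punctured C r (C.x j)] 0, η (orbiChart r C.M (C.x j) t) =
      k (orbiChart r C.M (C.x j) t) • dz (C.x j) (orbiChart r C.M (C.x j) t) :=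
    nhdsWithin_le_nhds ((tendsto_orbiChart hr _).eventually hkη)
  constructor
  · rintro ⟨w', h1, h2, g, g₀, h3, h4, h5⟩
    obtain ⟨v', h6, h7, h8⟩ := exists_normalized hr hη h1.continuous hv (h2.isPos h)
    refine ⟨v', h6, h7, fun t => k (orbiChart r C.M (C.x j) t) / g t, k (C.x j) / g₀,
      div_ne_zero hk0 h3, hkt.div h4 h3, ?_⟩
    filter_upwards [h5, hkη', h4.eventually_ne h3, self_mem_nhdsWithin, nhdsWithin_le_nhds
      ((tendsto_orbiChart (M := C.M) hr (C.x j)).eventually (eventually_mem_source (C.x j)))]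
      with t e1 e2 e3 e4 e5
    have e6 := h8 _ e4.2
    have e7 : t ^ S.mult (C.x j) ≠ 0 := pow_ne_zero _ e4.1
    set y := orbiChart r C.M (C.x j) t
    set a := S.triv (C.x j) t y (v' y) * (t ^ S.mult (C.x j))⁻¹ with ha
    have e8 : v' y = a • t ^ S.mult (C.x j) • S.frame (C.x j) t := by
      rw [smul_smul, ha, inv_mul_cancel_right₀ e7]
      exact S.eq_triv_smul (C.x j) t y (v' y)
    rw [e8, map_smul, e1, e2, smul_smul] at e6
    have e9 := smul_dz_inj e5 e6
    rw [e8, ← e9, mul_div_cancel_right₀ _ e3, smul_smul]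
  · rintro ⟨v', h1, h2, g, g₀, h3, h4, h5⟩
    have h6 := isLiftingJ_dualSection hr hη h1
    refine ⟨_, h6, equivJ_of_isPos hr h6.continuous hw.continuous h1 (fun x hx => by
      rw [dualSection_self (h1.ne_zero hr hx)]; exact (hη x hx.1).1) (h2.isPos h),
      fun t => (g t)⁻¹ * k (orbiChart r C.M (C.x j) t), g₀⁻¹ * k (C.x j),
      mul_ne_zero (inv_ne_zero h3) hk0, (h4.inv₀ h3).mul hkt, ?_⟩
    filter_upwards [h5, hkη', h4.eventually_ne h3, self_mem_nhdsWithin] with t e1 e2 e3 e4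
    have e5 : t ^ S.mult (C.x j) • S.frame (C.x j) t =
        (g t)⁻¹ • v' (orbiChart r C.M (C.x j) t) := by
      rw [e1, smul_smul, inv_mul_cancel_left₀ e3]
    rw [e5, map_smul, dualSection_self (h1.ne_zero hr e4.2), e2, smul_smul]

theorem ContinuousJ.map (hw : S.ContinuousJ w) (f : Iso S S') :
    S'.ContinuousJ (fun x => w x ∘ₗ (f.toEquiv x).symm.toLinearMap) := by
  intro x hx
  obtain ⟨h, h1, h2⟩ := hw x hx
  have h3 : ContinuousAt (fun y => f.frameScalar x (coord x y)) x := by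
    refine ContinuousAt.comp (g := f.frameScalar x) ?_
      (continuousAt_coord (mem_chart_source ℂ x))
    rw [coord_self]
    exact (f.analyticAt_frameScalar x).continuousAt
  refine ⟨fun y => (f.frameScalar x (coord x y))⁻¹ * h y,
    (h3.inv₀ (f.frameScalar_ne_zero x _)).continuousWithinAt.mul h1, ?_⟩
  filter_upwards [h2, nhdsWithin_le_nhds (eventually_mem_source x)] with y hy hys
  have e1 : (f.toEquiv y).symm ((S'.triv x (coord x y) y).symm 1) =
      (f.frameScalar x (coord x y))⁻¹ • (S.triv x (coord x y) y).symm 1 := by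
    apply (f.toEquiv y).injective
    apply (S'.triv x (coord x y) y).injective
    rw [LinearEquiv.apply_symm_apply, LinearEquiv.apply_symm_apply, map_smul, map_smul,
      f.triv_apply (orbiChart_coord hx.2 hys), LinearEquiv.apply_symm_apply, mul_one, smul_eq_mul,
      inv_mul_cancel₀ (f.frameScalar_ne_zero x _)]
  change w y ((f.toEquiv y).symm ((S'.triv x (coord x y) y).symm 1)) = _
  rw [e1, map_smul, hy, smul_smul]

end DiskSpin

end LiftingJ

section Results

variable {X : Type*} [TopologicalSpace X] [ChartedSpace ℂ X] [IsManifold 𝓘(ℂ, ℂ) ω X]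
  {r : ℕ} {I B : Type*} [Fintype I] [Fintype B] {a : I → ℤ} {b : B → ℤ} {L : Finset B}

theorem exists_liftedJ (C : MarkedDisk X I B) (h : DiskTwists r a b L) :
    ∃ S : LiftedJ C r, S.HasTwists a b ∧ S.LegalSet L := by
  have hr : r ≠ 0 := by have := h.two_le; omega
  obtain ⟨η, hη⟩ := C.exists_isPos_form
  obtain ⟨S, h1, h2⟩ := exists_liftedS C h
  refine ⟨⟨S.toDiskSpin, _, DiskSpin.isLiftingJ_dualSection hr hη S.isLifting⟩, h1, fun j => ?_⟩
  rw [DiskSpin.illegalJ_iff hr hη (DiskSpin.isLiftingJ_dualSection hr hη S.isLifting) S.isLifting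
    (fun x hx => by
      rw [DiskSpin.dualSection_self (S.isLifting.ne_zero hr hx)]; exact (hη x hx.1).1)]
  exact h2 j

variable {C : MarkedDisk X I B}

/-- A lifting of the dual bundle gives a lifting. -/
theorem LiftedJ.exists_liftedS (hr : r ≠ 0) (S : LiftedJ C r) : ∃ v, ∃ hv : S.IsLiftingS v,
    (∀ x ∈ C.A, C.IsPos x (S.w x (v x))) ∧
    ∀ L, S.LegalSet L → LiftedS.LegalSet ⟨S.toDiskSpin, v, hv⟩ L := by
  obtain ⟨η, hη⟩ := C.exists_isPos_form
  obtain ⟨v, hv, hpos⟩ := S.isLifting.positive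
  refine ⟨v, hv, hpos, fun L hL j => ?_⟩
  rw [hL j, DiskSpin.illegalJ_iff hr hη S.isLifting hv hpos]

theorem nonempty_liftedJ_iso (h : DiskTwists r a b L) {S S' : LiftedJ C r}
    (hS : S.HasTwists a b) (hL : S.LegalSet L) (hS' : S'.HasTwists a b) (hL' : S'.LegalSet L) :
    Nonempty (S.Iso S') := by
  have hr : r ≠ 0 := by have := h.two_le; omega
  obtain ⟨v, hv, hpos, hleg⟩ := S.exists_liftedS hr
  obtain ⟨v', hv', hpos', hleg'⟩ := S'.exists_liftedS hr
  obtain ⟨f⟩ := nonempty_liftedS_iso (S := ⟨S.toDiskSpin, v, hv⟩) (S' := ⟨S'.toDiskSpin, v', hv'⟩)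
    h hS (hleg L hL) hS' (hleg' L hL')
  refine ⟨⟨f.toDiskIso, ?_⟩⟩
  refine DiskSpin.equivJ_of_isPos hr (DiskSpin.ContinuousJ.map S.isLifting.continuous f.toDiskIso)
    S'.isLifting.continuous (hv.map f.toDiskIso) (fun x hx => ?_) (f.map_lifting.isPos hpos')
  have e : (S.w x ∘ₗ (f.toEquiv x).symm.toLinearMap) (f.toEquiv x (v x)) = S.w x (v x) :=
    congrArg (S.w x) ((f.toEquiv x).symm_apply_apply (v x))
  rw [e]
  exact hpos x hx

/-- An automorphism of a spin structure with a lifting of the dual bundle is trivial. -/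
theorem LiftedJ.Iso.apply_eq (hr : 2 ≤ r) {S : LiftedJ C r} (f : S.Iso S) (x : X)
    (u : S.fiber x) : f.toEquiv x u = u := by
  have hr0 : r ≠ 0 := by omega
  obtain ⟨v, hv, hpos, -⟩ := S.exists_liftedS hr0
  have h1 : ∀ x ∈ C.A, C.IsPos x (S.w x (f.toEquiv x (v x))) := by
    obtain ⟨c, -, hc⟩ := f.map_lifting
    intro x hx
    obtain ⟨h2, h3⟩ := hc x hx
    have h4 : S.w x (v x) = (c x : ℂ) • S.w x (f.toEquiv x (v x)) := by
      have := LinearMap.congr_fun h3 (f.toEquiv x (v x))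
      rw [LinearMap.smul_apply] at this
      rw [← this]
      exact congrArg (S.w x) ((f.toEquiv x).symm_apply_apply (v x)).symm
    have h5 := (hpos x hx).smul (inv_pos.2 h2)
    rw [h4, smul_smul, ← Complex.ofReal_mul, inv_mul_cancel₀ h2.ne', Complex.ofReal_one] at h5
    have h6 : (1 : ℂ) • S.w x (f.toEquiv x (v x)) = S.w x (f.toEquiv x (v x)) :=
      one_smul ℂ (S.w x (f.toEquiv x (v x)))
    rwa [h6] at h5
  exact LiftedS.Iso.apply_eq hr (S := ⟨S.toDiskSpin, v, hv⟩)
    ⟨f.toDiskIso, DiskSpin.equivS_of_isPos hr0 (hv.map f.toDiskIso) hv h1 hpos⟩ x u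

end Results
end RSpin

namespace RSpin

set_option linter.unusedSectionVars false

/-! ### Graded disks -/

theorem DiskTwists.of_graded {I B : Type*} [Fintype I] [Fintype B] {r : ℕ} {a : I → ℤ} {e : ℤ}
    (hr : 2 ≤ r) (ha : ∀ i, 0 ≤ a i ∧ a i ≤ r - 1)
    (he : 2 * (∑ i, a i) + (∑ _j : B, ((r : ℤ) - 2)) - (r - 2) = r * e)
    (hpar : e ≡ (Fintype.card B : ℤ) - 1 [ZMOD 2]) :
    DiskTwists r a (fun _ : B => (r : ℤ) - 2) Finset.univ where
  two_le := hr
  internal := ha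
  boundary _ := ⟨by omega, le_rfl⟩
  dvd := ⟨e, he⟩
  even h := by
    have h2 : Even ((r : ℤ) - 2) := by
      rw [Int.even_sub]
      simpa using h
    refine ⟨fun _ => h2, ?_⟩
    have h3 : 2 * (∑ i, a i) + (∑ _j : B, ((r : ℤ) - 2)) + 2 = r * (e + 1) := by linarith
    rw [h3, Int.mul_ediv_cancel_left _ (by omega), Finset.card_univ]
    simpa using hpar.add_right 1
  odd h j := by
    have h2 : Odd ((r : ℤ) - 2) := by
      rw [Int.odd_sub]
      simpa using h
    simpa using h2

variable {X : Type*} [TopologicalSpace X] [ChartedSpace ℂ X] [IsManifold 𝓘(ℂ, ℂ) ω X]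
  {r : ℕ} {I B : Type*} [Fintype I] [Fintype B] {a : I → ℤ}

theorem GradedDisk.legalSet_univ {C : MarkedDisk X I B} (S : GradedDisk C r) :
    S.toLiftedJ.LegalSet Finset.univ :=
  fun j => iff_of_true (Finset.mem_univ j) (S.alternates j)

theorem exists_gradedDisk (C : MarkedDisk X I B)
    (h : DiskTwists r a (fun _ : B => (r : ℤ) - 2) Finset.univ) :
    ∃ S : GradedDisk C r, S.HasTwists a fun _ => r - 2 := by
  obtain ⟨S, h1, h2⟩ := exists_liftedJ C h
  obtain ⟨v, hv, -⟩ := S.isLifting.positive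
  exact ⟨⟨S, ⟨v, hv⟩, h1.2.2, fun j => (h2 j).1 (Finset.mem_univ j)⟩, h1⟩

end RSpin

open scoped Manifold ContDiff in
open RSpin in
theorem proposition2 {X : Type*} [TopologicalSpace X] [ChartedSpace ℂ X]
    [IsManifold 𝓘(ℂ, ℂ) ω X] {I B : Type*} [Fintype I] [Fintype B] (r : ℕ) (hr : 2 ≤ r) :
    -- closed case
    (∀ (C : MarkedSphere X I) (a : I → ℤ),
      (∀ i, -1 ≤ a i ∧ a i ≤ r - 1) →
      (∀ i j, a i = -1 → a j = -1 → i = j) →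
      (r : ℤ) ∣ (∑ i, a i) - (r - 2) →
      -- existence and uniqueness
      (∃ S : SphereSpin C r, S.HasTwists a) ∧
      (∀ S S' : SphereSpin C r, S.HasTwists a → S'.HasTwists a → Nonempty (S.Iso S')) ∧
      (∀ S : SphereSpin C r, S.HasTwists a →
        -- automorphisms
        (∀ f : S.Iso S, ∃ ζ : ℂ, ζ ^ r = 1 ∧ ∀ x v, f.toEquiv x v = ζ • v) ∧
        (∀ ζ : ℂ, ζ ^ r = 1 → ∃ f : S.Iso S, ∀ x v, f.toEquiv x v = ζ • v) ∧
        -- graded structures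
        (∀ i, C.mark i = none → (∀ j, j ≠ i → C.mark j ≠ none) → (∀ j, a j = -1 → j = i) →
          Nonempty (S.Grading i) ∧
          (∀ G G' : S.Grading i, ∃ f : S.Iso S, G.IsIso G' f) ∧
          (a i = r - 1 → ∀ (G : S.Grading i) (f : S.Iso S), G.IsIso G f →
            ∀ x v, f.toEquiv x v = v)))) ∧
    -- disks, with liftings of `S` and of `J`
    (∀ (C : MarkedDisk X I B) (a : I → ℤ) (b : B → ℤ) (D : Finset B),
      (∀ i, 0 ≤ a i ∧ a i ≤ r - 1) →
      (∀ j, 0 ≤ b j ∧ b j ≤ r - 2) →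
      (r : ℤ) ∣ 2 * (∑ i, a i) + (∑ j, b j) - (r - 2) →
      (Even r → (∀ j, Even (b j)) ∧
        (2 * (∑ i, a i) + (∑ j, b j) + 2) / (r : ℤ) ≡ (D.card : ℤ) [ZMOD 2]) →
      (Odd r → ∀ j, j ∈ D ↔ Odd (b j)) →
      ((∃ S : LiftedS C r, S.HasTwists a b ∧ S.LegalSet D) ∧
        (∀ S S' : LiftedS C r, S.HasTwists a b → S.LegalSet D →
          S'.HasTwists a b → S'.LegalSet D → Nonempty (S.Iso S')) ∧
        (∀ S : LiftedS C r, S.HasTwists a b → S.LegalSet D →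
          ∀ f : S.Iso S, ∀ x v, f.toEquiv x v = v)) ∧
      ((∃ S : LiftedJ C r, S.HasTwists a b ∧ S.LegalSet D) ∧
        (∀ S S' : LiftedJ C r, S.HasTwists a b → S.LegalSet D →
          S'.HasTwists a b → S'.LegalSet D → Nonempty (S.Iso S')) ∧
        (∀ S : LiftedJ C r, S.HasTwists a b → S.LegalSet D →
          ∀ f : S.Iso S, ∀ x v, f.toEquiv x v = v))) ∧
    -- graded disks
    (∀ (C : MarkedDisk X I B) (a : I → ℤ) (e : ℤ),
      (∀ i, 0 ≤ a i ∧ a i ≤ r - 1) →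
      2 * (∑ i, a i) + (∑ _j : B, ((r : ℤ) - 2)) - (r - 2) = r * e →
      e ≡ (Fintype.card B : ℤ) - 1 [ZMOD 2] →
      (∃ S : GradedDisk C r, S.HasTwists a (fun _ => r - 2)) ∧
      (∀ S S' : GradedDisk C r, S.HasTwists a (fun _ => r - 2) → S'.HasTwists a (fun _ => r - 2) →
        Nonempty (S.toLiftedJ.Iso S'.toLiftedJ)) ∧
      (∀ S : GradedDisk C r, S.HasTwists a (fun _ => r - 2) →
        ∀ f : S.toLiftedJ.Iso S.toLiftedJ, ∀ x v, f.toEquiv x v = v)) := by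
  refine ⟨fun C a ha ha' hsum => ⟨C.exists_spin hr a ha ha' hsum,
    fun S S' hS hS' => C.nonempty_iso hr hS hS', fun S hS =>
    ⟨fun f => TwistedSpinBundle.Iso.exists_apply_eq C.sphere C.M_finite hr f,
      fun ζ hζ => TwistedSpinBundle.exists_iso_apply_eq (by omega) hζ,
      fun i h1 h2 h3 => ⟨MarkedSphere.exists_grading hr h1 h2 fun j hj =>
        h3 j ((hS j).symm.trans hj), fun G G' => MarkedSphere.exists_grading_iso hr G G',
        fun h G f hf => MarkedSphere.grading_rigid hr ((hS i).trans h) G f hf⟩⟩⟩,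
    fun C a b D ha hb hdvd heven hodd => ?_, fun C a e ha he hpar => ?_⟩
  · have h : DiskTwists r a b D := ⟨hr, ha, hb, hdvd, heven, hodd⟩
    exact ⟨⟨exists_liftedS C h, fun S S' hS hD hS' hD' => nonempty_liftedS_iso h hS hD hS' hD',
        fun S _ _ f => LiftedS.Iso.apply_eq hr f⟩,
      ⟨exists_liftedJ C h, fun S S' hS hD hS' hD' => nonempty_liftedJ_iso h hS hD hS' hD',
        fun S _ _ f => LiftedJ.Iso.apply_eq hr f⟩⟩
  · have h : DiskTwists r a (fun _ : B => (r : ℤ) - 2) Finset.univ := .of_graded hr ha he hpar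
    exact ⟨exists_gradedDisk C h, fun S S' hS hS' =>
        nonempty_liftedJ_iso h hS S.legalSet_univ hS' S'.legalSet_univ,
      fun S _ f => LiftedJ.Iso.apply_eq hr f⟩
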